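/- **Theorem.** Let $k\ge 0$ be a real number. Suppose that for every $\varepsilon>0$ the 3SUM problem for $N$ integers in $\{-2^{N^{k+o(1)}},\dots,2^{N^{k+o(1)}}\}$ (decide whether three of the given numbers, at distinct positions, sum to zero) does not admit an $O(N^{2-\varepsilon+k+o(1)})$-time algorithm. Then for every $\varepsilon'>0$, $$NDTIME\Big(\Big\lceil \tfrac1{1+k}\log_2 n\Big\rceil,\ n\Big)\ \nsubseteq\ DTIME\Big(n^{1+\frac1{1+k}-\varepsilon'}\Big).$$ Here the following conventions are used. * $NDTIME(f(n),g(n))$ is the class of languages $L\subseteq\{0,1\}^*$ for which there is a multi-tape Turing machine that, on every input $x$ of length $n$ and for all outcomes of its nondeterministic binary guesses, halts within $O(g(n))$ steps after using at most $f(n)$ guessed bits, and such that $x\in L$ if and only if some outcome of the guesses leads to acceptance. $DTIME(g(n))=NDTIME(0,g(n))$. * An algorithm is a program of a random access machine (on integers, with addition, subtraction, multiplication, floor division, indirect addressing and conditional jumps); its time is measured under the logarithmic cost criterion. It reads $N$ and then the $N$ numbers. * That the problem admits an $O(N^{e+o(1)})$-time algorithm means that there is one program with the following property: for every function $\delta$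 with $\delta(N)\to0$ there is a function $\delta'$ with $\delta'(N)\to 0$ such that on all instances consisting of $N$ integers of absolute value at most $2^{N^{k+\delta(N)}}$ the program answers correctly in time $O(N^{e+\delta'(N)})$. -/

import Mathlib

open Filter Topology Asymptotics

/-! ## Multi-tape Turing machines with a nondeterministic bit oracle -/

/-- A multi-tape Turing machine with `extra + 1` two-way infinite tapes over a finite alphabet
(the blank is `default`), tape `0` being the input tape.  In a state with `guess q = true` the
transition consumes one bit of the nondeterministic oracle; in all other states the machine is
deterministic (the bit handed to `next` is then always `false`).  `verdict q = some true`
(`some false`) means that `q` is an accepting (rejecting) halting state. -/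
structure OracleTM where
  State : Type
  Symbol : Type
  [finiteState : Finite State]
  [finiteSymbol : Finite Symbol]
  [inhabitedSymbol : Inhabited Symbol]
  /-- the input letters, as tape symbols different from the blank -/
  letter : Bool ↪ Symbol
  letter_ne_blank : ∀ b, letter b ≠ default
  extra : ℕ
  start : State
  verdict : State → Option Bool
  guess : State → Bool
  /-- new state, and for every tape the symbol to write and the head move (`none`: stay) -/
  next : State → (Fin (extra + 1) → Symbol) → Bool →
    State × (Fin (extra + 1) → Symbol × Option Turing.Dir)

namespace OracleTM

attribute [instance] OracleTM.finiteState OracleTM.finiteSymbol OracleTM.inhabitedSymbol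

/-- A configuration: state, tapes, and the number of oracle bits consumed so far. -/
structure Cfg (M : OracleTM) where
  state : M.State
  tape : Fin (M.extra + 1) → Turing.Tape M.Symbol
  used : ℕ

/-- The input word stands on tape `0`, its first letter under the head; other tapes are blank. -/
def startCfg (M : OracleTM) (x : List Bool) : M.Cfg where
  state := M.start
  tape := fun i => if i = 0 then Turing.Tape.mk₁ (x.map M.letter) else Turing.Tape.mk₁ []
  used := 0

/-- Write a symbol, then move the head (or not). -/
def act {Γ : Type} [Inhabited Γ] (T : Turing.Tape Γ) (a : Γ × Option Turing.Dir) :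
    Turing.Tape Γ :=
  match a.2 with
  | none => T.write a.1
  | some d => (T.write a.1).move d

/-- One step, when the oracle bits are `y 0, y 1, …`; halting configurations do not change. -/
def step (M : OracleTM) (y : ℕ → Bool) (c : M.Cfg) : M.Cfg :=
  match M.verdict c.state with
  | some _ => c
  | none =>
    let b := if M.guess c.state then y c.used else false
    let r := M.next c.state (fun i => (c.tape i).head) b
    { state := r.1
      tape := fun i => act (c.tape i) (r.2 i)
      used := if M.guess c.state then c.used + 1 else c.used }

/-- The configuration after `t` steps on input `x` with oracle bits `y`. -/
def cfgAt (M : OracleTM) (x : List Bool) (y : ℕ → Bool) (t : ℕ) : M.Cfg :=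
  (M.step y)^[t] (M.startCfg x)

/-- On input `x` with oracle bits `y` the machine halts within `t` steps with answer `b`. -/
def AnswersWithin (M : OracleTM) (x : List Bool) (y : ℕ → Bool) (t : ℕ) (b : Bool) : Prop :=
  M.verdict (M.cfgAt x y t).state = some b

end OracleTM

/-- `NDTIME f g`: the languages `L` over `{0,1}` for which some multi-tape Turing machine, on each
input of length `n` and for every outcome of its guesses, halts within `O(g n)` steps and consumes
at most `f n` nondeterministic bits, where `x ∈ L` iff some outcome of the guesses makes it
accept. -/
def NDTIME (f : ℕ → ℕ) (g : ℕ → ℝ) : Set (Language Bool) :=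
  {L | ∃ (M : OracleTM) (t : ℕ → ℕ),
    (fun n => (t n : ℝ)) =O[atTop] g ∧
    ∀ x : List Bool,
      (∀ y : ℕ → Bool, (∃ b, M.AnswersWithin x y (t x.length) b) ∧
        (M.cfgAt x y (t x.length)).used ≤ f x.length) ∧
      (x ∈ L ↔ ∃ y : ℕ → Bool, M.AnswersWithin x y (t x.length) true)}

/-- Deterministic time. -/
def DTIME (g : ℕ → ℝ) : Set (Language Bool) := NDTIME (fun _ => 0) g

/-! ## Random access machines under the logarithmic cost criterion -/

namespace RAM

/-- The logarithmic size of an integer: `⌊log₂ |i|⌋ + 1` for `i ≠ 0`, and `1` for `i = 0`. -/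
def size (i : ℤ) : ℕ := Nat.log 2 i.natAbs + 1

/-- The address of a register: given directly, or as the content of another register. -/
inductive Addr where
  | direct (i : ℕ)
  | indirect (i : ℕ)

/-- An operand: a literal integer, or the content of a register. -/
inductive Operand where
  | const (v : ℤ)
  | reg (a : Addr)

/-- The instruction set; register `0` is the accumulator, jump targets are line numbers. -/
inductive Instr where
  | load (a : Operand)
  | store (a : Addr)
  | add (a : Operand)
  | sub (a : Operand)
  | mult (a : Operand)
  | div (a : Operand)
  | read (a : Addr)
  | write (a : Operand)
  | jump (b : ℕ)
  | jgtz (b : ℕ)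
  | jzero (b : ℕ)
  | halt

/-- A program is a finite list of instructions. -/
abbrev Program := List Instr

/-- A configuration: program counter, registers, rest of the input tape, output so far. -/
structure Cfg where
  pc : ℕ
  mem : ℕ → ℤ
  input : List ℤ
  output : List ℤ

/-- The register addressed and the cost of finding it; an indirect negative address is an error. -/
def Addr.eval (mem : ℕ → ℤ) : Addr → Option (ℕ × ℕ)
  | .direct i => some (i, size i)
  | .indirect i => if 0 ≤ mem i then some ((mem i).toNat, size i + size (mem i)) else none

/-- The value of an operand and the cost of fetching it. -/
def Operand.eval (mem : ℕ → ℤ) : Operand → Option (ℤ × ℕ)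
  | .const v => some (v, size v)
  | .reg a => (a.eval mem).map fun p => (mem p.1, p.2 + size (mem p.1))

/-- Store `v` in register `r` and go to the next instruction. -/
def Cfg.set (c : Cfg) (r : ℕ) (v : ℤ) : Cfg :=
  { c with pc := c.pc + 1, mem := Function.update c.mem r v }

/-- The next configuration and the logarithmic cost of one instruction; `none` for `halt` and for
errors (negative address, division by zero).  Past the end of the input, zeros are read. -/
def Instr.exec (c : Cfg) : Instr → Option (Cfg × ℕ)
  | .load a => (a.eval c.mem).map fun p => (c.set 0 p.1, p.2)
  | .store a => (a.eval c.mem).map fun p => (c.set p.1 (c.mem 0), size (c.mem 0) + p.2)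
  | .add a => (a.eval c.mem).map fun p => (c.set 0 (c.mem 0 + p.1), size (c.mem 0) + p.2)
  | .sub a => (a.eval c.mem).map fun p => (c.set 0 (c.mem 0 - p.1), size (c.mem 0) + p.2)
  | .mult a => (a.eval c.mem).map fun p => (c.set 0 (c.mem 0 * p.1), size (c.mem 0) + p.2)
  | .div a => (a.eval c.mem).bind fun p =>
      if p.1 = 0 then none else some (c.set 0 ((c.mem 0).fdiv p.1), size (c.mem 0) + p.2)
  | .read a => (a.eval c.mem).map fun p =>
      ({ c.set p.1 (c.input.headD 0) with input := c.input.tail },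
        size (c.input.headD 0) + p.2)
  | .write a => (a.eval c.mem).map fun p =>
      ({ c with pc := c.pc + 1, output := c.output ++ [p.1] }, p.2)
  | .jump b => some ({ c with pc := b }, 1)
  | .jgtz b => some ({ c with pc := if 0 < c.mem 0 then b else c.pc + 1 }, size (c.mem 0))
  | .jzero b => some ({ c with pc := if c.mem 0 = 0 then b else c.pc + 1 }, size (c.mem 0))
  | .halt => none

/-- `HaltsWith P c out m`: started in `c`, the program `P` reaches a `halt` instruction with `out`
on the output tape, at total logarithmic cost `m`. -/
inductive HaltsWith (P : Program) : Cfg → List ℤ → ℕ → Prop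
  | halt {c : Cfg} (h : P[c.pc]? = some Instr.halt) : HaltsWith P c c.output 1
  | step {c c' : Cfg} {i : Instr} {w m : ℕ} {out : List ℤ} (hi : P[c.pc]? = some i)
      (hc : i.exec c = some (c', w)) (h : HaltsWith P c' out m) : HaltsWith P c out (w + m)

/-- All registers are `0` at the start. -/
def startCfg (input : List ℤ) : Cfg := ⟨0, fun _ => 0, input, []⟩

end RAM

/-! ## 3SUM -/

/-- Three of the numbers `a 0, …, a (N - 1)`, at different positions, sum to zero. -/
def HasThreeSum {N : ℕ} (a : Fin N → ℤ) : Prop :=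
  ∃ i j l : Fin N, i ≠ j ∧ i ≠ l ∧ j ≠ l ∧ a i + a j + a l = 0

/-- The random access machine program `P`, given `N` and then the `N` numbers on its input tape,
decides 3SUM (printing exactly `1` for yes) at logarithmic cost at most `T N` on all instances
of `N` integers in `{-2^(N^r(N)), …, 2^(N^r(N))}`. -/
def DecidesThreeSum (P : RAM.Program) (r : ℕ → ℝ) (T : ℕ → ℕ) : Prop :=
  ∀ (N : ℕ) (a : Fin N → ℤ), (∀ i, |(a i : ℝ)| ≤ (2 : ℝ) ^ ((N : ℝ) ^ r N)) →
    ∃ (out : List ℤ) (m : ℕ), m ≤ T N ∧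
      RAM.HaltsWith P (RAM.startCfg ((N : ℤ) :: List.ofFn a)) out m ∧
      (out = [1] ↔ HasThreeSum a)

/-- 3SUM for `N` integers in the range `{-2^(N^(k+o(1))), …, 2^(N^(k+o(1)))}` has an
`O(N^(e+o(1)))`-time algorithm: one program which, for every range exponent `k + δ N` with
`δ = o(1)`, takes time `O(N^(e + δ' N))` for some `δ' = o(1)`. -/
def ThreeSumInTime (k e : ℝ) : Prop :=
  ∃ P : RAM.Program, ∀ δ : ℕ → ℝ, Tendsto δ atTop (𝓝 0) →
    ∃ (δ' : ℕ → ℝ) (T : ℕ → ℕ), Tendsto δ' atTop (𝓝 0) ∧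
      (fun N => (T N : ℝ)) =O[atTop] (fun N : ℕ => (N : ℝ) ^ (e + δ' N)) ∧
      DecidesThreeSum P (fun N => k + δ N) T

/-! Suppose the inclusion holds. A list of `N` numbers of about `N ^ k` bits occupies `n ≈ N ^ (1 +
k)` letters, so `log₂ n / (1 + k) ≈ log₂ N` guessed bits are just enough to name one entry of the
list. If the list is sorted, then after guessing the smallest index `i` of a solution the two
partners are found by one sweep of two pointers, which takes linear time. So there is a language in
the nondeterministic class (`lang_mem`) that solves 3SUM on suitably encoded sorted lists
(`encode_mem_lang`). A deterministic machine for it with time `n ^ (1 + 1 / (1 + k) - ε)` would run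
on such words in time about `N ^ ((1 + k) * (1 + 1 / (1 + k) - ε)) = N ^ (2 + k - (1 + k) * ε)`.
Preparing the word on a random access machine and simulating the deterministic machine there costs
only factors `N ^ η` more, which contradicts the hardness of 3SUM.

Three points need care. The machine must keep to its time and guess bounds on every input, so it
measures its own input: with unary counters multiplied by `2 ^ p` it finds the largest number of
rounds that the input length allows, guesses `q + 1` bits per round, and in the last phase uses the
input tape as a clock (`mul_phase`, `setup_halts`, `halts_late`). The fraction `(q + 1) / p`
approximates `1 / (1 + k)` from below.

The numbers are shifted by `(2 ^ W - 1) / 3`, where `W` is the word length. They become nonnegative,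
and three of them sum to zero exactly when the shifted ones sum to the word of ones, which a finite
automaton checks from the most significant bit on (`upd_sgn`, `exists_triple_iff`).

The preparation must be quasilinear in the number of bits under logarithmic cost. Numbers are cut
into bits by repeated halving (`splitting_meets`) and sorted by radix sort (`sorting_meets`). The
program is written in a small language of loops, compiled to random access code with a verified cost
(`Does.of_wp`, `Does.loop`); `program_spec` and `threeSumInTime_of_decides` collect the result. -/

namespace OracleTM

/-! ### Turing machine tapes as functions on the integers -/

/-- The displacement of a head. -/
def shift : Option Turing.Dir → ℤ
  | none => 0
  | some .left => -1
  | some .right => 1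

/-- A configuration whose tapes are functions on `ℤ` together with head positions. -/
structure FCfg (M : OracleTM) where
  state : M.State
  cell : Fin (M.extra + 1) → ℤ → M.Symbol
  pos : Fin (M.extra + 1) → ℤ
  used : ℕ

/-- One step on function tapes. -/
def fstep (M : OracleTM) (y : ℕ → Bool) (c : M.FCfg) : M.FCfg :=
  match M.verdict c.state with
  | some _ => c
  | none =>
    let b := if M.guess c.state then y c.used else false
    let r := M.next c.state (fun i => c.cell i (c.pos i)) b
    { state := r.1
      cell := fun i => Function.update (c.cell i) (c.pos i) (r.2 i).1
      pos := fun i => c.pos i + shift (r.2 i).2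
      used := if M.guess c.state then c.used + 1 else c.used }

/-- A configuration and its description by function tapes. -/
def Agrees {M : OracleTM} (c : M.Cfg) (d : M.FCfg) : Prop :=
  c.state = d.state ∧ c.used = d.used ∧ ∀ i z, (c.tape i).nth z = d.cell i (d.pos i + z)

theorem act_nth {Γ : Type} [Inhabited Γ] (T : Turing.Tape Γ) (a : Γ × Option Turing.Dir) (z : ℤ) :
    (act T a).nth z = if z + shift a.2 = 0 then a.1 else T.nth (z + shift a.2) := by
  obtain ⟨a, d⟩ := a
  rcases d with _ | _ | _ <;> simp [act, shift, sub_eq_add_neg] <;> congr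

/-- Content relative to the head is renumbered at every move. Adding the head position gives
absolute cells, for which a step is one `Function.update` per tape, so that whole runs can be
described by closed formulas. -/
theorem Agrees.step {M : OracleTM} (y : ℕ → Bool) {c : M.Cfg} {d : M.FCfg} (h : Agrees c d) :
    Agrees (M.step y c) (M.fstep y d) := by
  obtain ⟨hs, hu, ht⟩ := h
  have hh : (fun i => (c.tape i).head) = fun i => d.cell i (d.pos i) := by
    funext i
    have := ht i 0
    simpa using this
  unfold OracleTM.step OracleTM.fstep
  rw [hs]
  cases hv : M.verdict d.state with
  | some b => exact ⟨hs, hu, ht⟩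
  | none =>
    refine ⟨?_, ?_, ?_⟩
    · simp only [hh, hu]
    · simp only [hu]
    · intro i z
      simp only [hh, hu, act_nth, Function.update_apply, ht, add_assoc]
      congr 1
      · apply propext
        constructor <;> intro h' <;> omega
      · congr 1; ring

theorem Agrees.iterate {M : OracleTM} (y : ℕ → Bool) {c : M.Cfg} {d : M.FCfg} (h : Agrees c d)
    (t : ℕ) : Agrees ((M.step y)^[t] c) ((M.fstep y)^[t] d) := by
  induction t with
  | zero => exact h
  | succ t ih => simpa only [Function.iterate_succ_apply'] using ih.step y

/-- The content of the input tape. -/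
def inputCell (M : OracleTM) (x : List Bool) (z : ℤ) : M.Symbol :=
  if 0 ≤ z then ((x[z.toNat]?).map M.letter).getD default else default

/-- The start configuration on function tapes. -/
def fstart (M : OracleTM) (x : List Bool) : M.FCfg where
  state := M.start
  cell := fun i => if i = 0 then M.inputCell x else fun _ => default
  pos := fun _ => 0
  used := 0

theorem mk₁_nth {Γ : Type} [Inhabited Γ] (l : List Γ) (z : ℤ) :
    (Turing.Tape.mk₁ l).nth z = if 0 ≤ z then (l[z.toNat]?).getD default else default := by
  rcases z with n | n
  · have := Turing.Tape.mk'_nth_nat (Turing.ListBlank.mk ([] : List Γ)) (Turing.ListBlank.mk l) n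
    simp only [Turing.Tape.mk₁, Turing.Tape.mk₂, Int.ofNat_eq_natCast, this,
      Turing.ListBlank.nth_mk, List.getI_eq_getElem?_getD]
    simp
  · have : (Turing.Tape.mk₁ l).nth (Int.negSucc n) = (Turing.ListBlank.mk ([] : List Γ)).nth n := rfl
    rw [this, Turing.ListBlank.nth_mk, if_neg (by omega)]
    simp [List.getI_eq_getElem?_getD]

theorem agrees_start (M : OracleTM) (x : List Bool) : Agrees (M.startCfg x) (M.fstart x) := by
  refine ⟨rfl, rfl, fun i z => ?_⟩
  simp only [startCfg, fstart, zero_add]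
  split_ifs with h
  · rw [mk₁_nth]
    simp only [inputCell, List.getElem?_map]
  · rw [mk₁_nth]; simp

/-- The function-tape configuration after `t` steps. -/
def fcfgAt (M : OracleTM) (x : List Bool) (y : ℕ → Bool) (t : ℕ) : M.FCfg :=
  (M.fstep y)^[t] (M.fstart x)

theorem cfgAt_state (M : OracleTM) (x : List Bool) (y : ℕ → Bool) (t : ℕ) :
    (M.cfgAt x y t).state = (M.fcfgAt x y t).state :=
  ((agrees_start M x).iterate y t).1

theorem cfgAt_used (M : OracleTM) (x : List Bool) (y : ℕ → Bool) (t : ℕ) :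
    (M.cfgAt x y t).used = (M.fcfgAt x y t).used :=
  ((agrees_start M x).iterate y t).2.1

theorem answersWithin_iff (M : OracleTM) (x : List Bool) (y : ℕ → Bool) (t : ℕ) (b : Bool) :
    M.AnswersWithin x y t b ↔ M.verdict (M.fcfgAt x y t).state = some b := by
  rw [AnswersWithin, cfgAt_state]

theorem fstep_of_verdict (M : OracleTM) (y : ℕ → Bool) (c : M.FCfg) {b : Bool}
    (h : M.verdict c.state = some b) : M.fstep y c = c := by
  simp [fstep, h]

theorem fcfgAt_succ (M : OracleTM) (x : List Bool) (y : ℕ → Bool) (t : ℕ) :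
    M.fcfgAt x y (t + 1) = M.fstep y (M.fcfgAt x y t) := by
  simp only [fcfgAt, Function.iterate_succ_apply']

theorem iterate_fstep_of_verdict (M : OracleTM) (y : ℕ → Bool) (c : M.FCfg) {b : Bool}
    (h : M.verdict c.state = some b) (n : ℕ) : (M.fstep y)^[n] c = c :=
  Function.iterate_fixed (M.fstep_of_verdict y c h) n

theorem used_le_fstep (M : OracleTM) (y : ℕ → Bool) (c : M.FCfg) :
    c.used ≤ (M.fstep y c).used := by
  unfold fstep
  cases M.verdict c.state with
  | some b => simp
  | none => dsimp only; split_ifs <;> omega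

/-- Without guesses the oracle is irrelevant. -/
theorem fcfgAt_eq_of_used_eq_zero (M : OracleTM) (x : List Bool) (y y' : ℕ → Bool) (t : ℕ)
    (h : (M.fcfgAt x y t).used = 0) : M.fcfgAt x y' t = M.fcfgAt x y t := by
  induction t with
  | zero => rfl
  | succ t ih =>
    rw [fcfgAt_succ] at h
    have h0 : (M.fcfgAt x y t).used = 0 := by
      have := M.used_le_fstep y (M.fcfgAt x y t); omega
    rw [fcfgAt_succ, fcfgAt_succ, ih h0]
    revert h
    unfold fstep
    cases M.verdict (M.fcfgAt x y t).state with
    | some b => simp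
    | none =>
      dsimp only
      cases M.guess (M.fcfgAt x y t).state <;> simp

end OracleTM

/-! ### The nondeterministic machine: definition and clock -/

namespace TripleTM

/-- The states of the machine that guesses a list entry and then runs the two-pointer search. -/
inductive Q (R q : ℕ) where
  | load (c : Fin 5)
  | mul (s : Bool) (r : Fin (R + 1))
  | toss (s : Bool) (i : Fin (q + 1))
  | sel (mis : Bool)
  | back (m : Fin 4)
  | cmp (d : Fin 4)
  | acc
  | rej

/-- A code for states, showing that there are finitely many. -/
def Q.code {R q : ℕ} : Q R q →
    Fin 5 ⊕ (Bool × Fin (R + 1)) ⊕ (Bool × Fin (q + 1)) ⊕ Bool ⊕ Fin 4 ⊕ Fin 4 ⊕ Bool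
  | .load c => .inl c
  | .mul s r => .inr (.inl (s, r))
  | .toss s i => .inr (.inr (.inl (s, i)))
  | .sel m => .inr (.inr (.inr (.inl m)))
  | .back m => .inr (.inr (.inr (.inr (.inl m))))
  | .cmp m => .inr (.inr (.inr (.inr (.inr (.inl m)))))
  | .acc => .inr (.inr (.inr (.inr (.inr (.inr true)))))
  | .rej => .inr (.inr (.inr (.inr (.inr (.inr false)))))

theorem Q.code_injective {R q : ℕ} : Function.Injective (Q.code : Q R q → _) := by
  intro a b h
  cases a <;> cases b <;> simp_all [Q.code]

instance {R q : ℕ} : Finite (Q R q) := Finite.of_injective _ Q.code_injective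

/-- The comparison state after one more digit; `0, 1, 2, 3` stand for `≤ -2, -1, 0, ≥ 1`. -/
def upd (d : Fin 4) (e : ℕ) : Fin 4 :=
  match d with
  | 0 => 0
  | 3 => 3
  | 1 => if e = 3 then 2 else if e = 2 then 1 else 0
  | 2 => if e = 0 then 1 else if e = 1 then 2 else 3

/-- The comparison state that stands for an integer. -/
def sgn (z : ℤ) : Fin 4 := if z ≤ -2 then 0 else if z = -1 then 1 else if z = 0 then 2 else 3

/-- Let `z` be the sum of three prefixes of length `b` minus `2 ^ b - 1`. If the next bits contain
`e` ones, the new value is `2 * z + e - 1`. From `z ≥ 1` it stays `≥ 1` and from `z ≤ -2` it stays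
`≤ -2`, so four states decide the final sign and no carries are needed. -/
theorem upd_sgn (z : ℤ) (e : ℕ) (he : e ≤ 3) : upd (sgn z) e = sgn (2 * z + e - 1) := by
  unfold sgn
  by_cases h1 : z ≤ -2
  · have : (2 * z + e - 1 ≤ -2) := by omega
    simp [h1, this, upd]
  by_cases h2 : z = -1
  · subst h2
    interval_cases e <;> simp [upd]
  by_cases h3 : z = 0
  · subst h3
    interval_cases e <;> simp [upd]
  · have a1 : ¬ (2 * z + e - 1 ≤ -2) := by omega
    have a2 : ¬ (2 * z + e - 1 = -1) := by omega
    have a3 : ¬ (2 * z + e - 1 = 0) := by omega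
    simp [h1, h2, h3, a1, a2, a3, upd]

/-- The tape from which marks are taken while multiplying. -/
def src (s : Bool) : Fin 10 := if s then 9 else 8

/-- The tape to which marks are written while multiplying. -/
def dst (s : Bool) : Fin 10 := if s then 8 else 9

/-- The direction of a head which moves when `b` holds. -/
def go (d : Turing.Dir) (b : Bool) : Option Turing.Dir := if b then some d else none

/-- The third phase, without the clock on tape `0`. -/
def core {R q : ℕ} : Q R q → (Fin 10 → Option Bool) →
    Q R q × (Fin 10 → Option Bool) × (Fin 10 → Option Turing.Dir)
  | .sel mis, h =>
    let mis' : Bool := mis || ((h 4 == some true) != (h 6 == some true))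
    let w := Function.update h 7 (some (h 1 == some true))
    if h 3 = some true then
      (.back (if mis' then 0 else 1), w, fun i => go .right (i = 1 ∨ i = 3 ∨ i = 4 ∨ i = 5))
    else
      (.sel mis', w, fun i => go .right (i = 1 ∨ i = 3 ∨ i = 4 ∨ i = 6 ∨ i = 7))
  | .back m, h =>
    let z : Fin 10 := if m = 0 then 6 else if m = 2 then 1 else if m = 3 then 2 else 7
    if h 7 = none then
      (if h 5 = some true then (if m = 0 then .sel false else .cmp 2) else .rej,
        h, fun i => go .right (i = 7 ∨ i = z))
    else (.back m, h, fun i => go .left (i = 7 ∨ i = z))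
  | .cmp d, h =>
    if h 7 = none then
      if d = 2 then (.acc, h, fun _ => none)
      else if d = 3 then (.back 2, h,
        fun i => if i = 5 then some .right else go .left (i = 7 ∨ i = 1))
      else (.back 3, h, fun i => if i = 5 then some .right else go .left (i = 7 ∨ i = 2))
    else
      (.cmp (upd d ((h 1 == some true).toNat + (h 2 == some true).toNat +
        (h 7 == some true).toNat)), h, fun i => go .right (i = 1 ∨ i = 2 ∨ i = 7))
  | s, h => (s, h, fun _ => none)

/-- The transition function. -/
def next {R q : ℕ} : Q R q → (Fin 10 → Option Bool) → Bool →
    Q R q × (Fin 10 → Option Bool × Option Turing.Dir)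
  | .load c, h, _ =>
    if h 0 = none then
      (.mul false 0, fun i => (if i = 8 then some true else h i, go .left (i = 0)))
    else
      (.load (c + 1), fun i => (if (i : ℕ) = c + 1 then h 0 else h i,
        if i = 0 then some .right else go .left ((i : ℕ) = c + 1)))
  | .mul s r, h, _ =>
    if h 0 = none then
      (.sel false, fun i => (h i, go .right ((i : ℕ) ≤ 6)))
    else if h (src s) = none then
      (.toss s 0, fun i => (h i, go .left (i = 0 ∨ i = dst s)))
    else
      (.mul s (if r = Fin.last R then 0 else r + 1), fun i =>
        (if i = dst s then some true else if i = src s ∧ r = Fin.last R then none else h i,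
          if i = dst s then some .right
          else go .left (i = 0 ∨ (i = src s ∧ r = Fin.last R))))
  | .toss s j, h, b =>
    (if j = Fin.last q then .mul (!s) 0 else .toss s (j + 1),
      fun i => (if i = 6 then some b else h i, go .left (i = 6)))
  | s, h, _ =>
    if h 0 = none then (.rej, fun i => (h i, none))
    else ((core s h).1, fun i => ((core s h).2.1 i, if i = 0 then some .right else (core s h).2.2 i))

/-- The machine that guesses an entry of a sorted list and searches for two later entries which
complement it. -/
def machine (R q : ℕ) : OracleTM where
  State := Q R q
  Symbol := Option Bool
  inhabitedSymbol := ⟨none⟩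
  letter := ⟨some, Option.some_injective _⟩
  letter_ne_blank := fun b => by simp [default]
  extra := 9
  start := .load 0
  verdict := fun s => match s with
    | .acc => some true
    | .rej => some false
    | _ => none
  guess := fun s => match s with
    | .toss _ _ => true
    | _ => false
  next := next

/-- Configurations of the machine, with plain types. -/
def conf {R q : ℕ} (s : Q R q) (f : Fin 10 → ℤ → Option Bool) (p : Fin 10 → ℤ) (u : ℕ) :
    (machine R q).FCfg := ⟨s, f, p, u⟩

section Steps

variable {R q : ℕ} (y : ℕ → Bool) (f : Fin 10 → ℤ → Option Bool) (p : Fin 10 → ℤ) (u : ℕ)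

theorem fstep_load (c : Fin 5) : (machine R q).fstep y (conf (.load c) f p u) =
    conf (next (R := R) (q := q) (.load c) (fun i => f i (p i)) false).1
      (fun i => Function.update (f i) (p i)
        ((next (R := R) (q := q) (.load c) (fun i => f i (p i)) false).2 i).1)
      (fun i => p i + OracleTM.shift
        ((next (R := R) (q := q) (.load c) (fun i => f i (p i)) false).2 i).2) u := rfl

theorem fstep_mul (s : Bool) (r : Fin (R + 1)) :
    (machine R q).fstep y (conf (.mul s r) f p u) =
    conf (next (R := R) (q := q) (.mul s r) (fun i => f i (p i)) false).1
      (fun i => Function.update (f i) (p i)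
        ((next (R := R) (q := q) (.mul s r) (fun i => f i (p i)) false).2 i).1)
      (fun i => p i + OracleTM.shift
        ((next (R := R) (q := q) (.mul s r) (fun i => f i (p i)) false).2 i).2) u := rfl

theorem fstep_toss (s : Bool) (j : Fin (q + 1)) :
    (machine R q).fstep y (conf (.toss s j) f p u) =
    conf (next (R := R) (q := q) (.toss s j) (fun i => f i (p i)) (y u)).1
      (fun i => Function.update (f i) (p i)
        ((next (R := R) (q := q) (.toss s j) (fun i => f i (p i)) (y u)).2 i).1)
      (fun i => p i + OracleTM.shift
        ((next (R := R) (q := q) (.toss s j) (fun i => f i (p i)) (y u)).2 i).2) (u + 1) := rfl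

/-- The states of the third phase which do not halt. -/
def Late {R q : ℕ} (s : Q R q) : Prop :=
  (∃ m, s = .sel m) ∨ (∃ m, s = .back m) ∨ ∃ m, s = .cmp m

/-- In the third phase the head of tape `0` moves right whenever it reads a letter, and the blank
behind the input forces rejection. This bounds the time on all inputs, including those that encode
no list. -/
theorem fstep_late_none {s : Q R q} (hs : Late s) (h0 : f 0 (p 0) = none) :
    ((machine R q).fstep y (conf s f p u)) = conf .rej f p u := by
  rcases hs with ⟨m, rfl⟩ | ⟨m, rfl⟩ | ⟨m, rfl⟩ <;>
  · simp only [OracleTM.fstep, conf, machine, next, h0, if_true]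
    simp [OracleTM.shift]

theorem fstep_late {s : Q R q} (hs : Late s) (h0 : f 0 (p 0) ≠ none) :
    ((machine R q).fstep y (conf s f p u)) = conf (core s (fun i => f i (p i))).1
      (fun i => Function.update (f i) (p i) ((core s (fun i => f i (p i))).2.1 i))
      (fun i => p i + OracleTM.shift
        (if i = 0 then some .right else (core s (fun i => f i (p i))).2.2 i)) u := by
  rcases hs with ⟨m, rfl⟩ | ⟨m, rfl⟩ | ⟨m, rfl⟩ <;>
  · simp only [OracleTM.fstep, conf, machine, next, h0, if_false]
    rfl

theorem core_late_or {s : Q R q} (hs : Late s) (h : Fin 10 → Option Bool) :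
    Late (core s h).1 ∨ (core s h).1 = .acc ∨ (core s h).1 = .rej := by
  rcases hs with ⟨m, rfl⟩ | ⟨m, rfl⟩ | ⟨m, rfl⟩ <;> simp only [core]
  · split_ifs <;> simp [Late]
  · split_ifs <;> simp [Late]
  · split_ifs <;> simp [Late]

theorem core_tape_zero {s : Q R q} (hs : Late s) (h : Fin 10 → Option Bool) :
    (core s h).2.1 0 = h 0 := by
  rcases hs with ⟨m, rfl⟩ | ⟨m, rfl⟩ | ⟨m, rfl⟩ <;> simp only [core]
  · split_ifs <;> simp
  · split_ifs <;> simp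
  · split_ifs <;> simp

end Steps

/-- In the third phase the machine halts as soon as the clock tape is exhausted, without further
guesses. -/
theorem halts_late {R q : ℕ} (y : ℕ → Bool) (u : ℕ) (n : ℕ) : ∀ (s : Q R q)
    (f : Fin 10 → ℤ → Option Bool) (p : Fin 10 → ℤ), (Late s ∨ s = .acc ∨ s = .rej) →
    f 0 (p 0 + n) = none →
    ∃ b, (machine R q).verdict (((machine R q).fstep y)^[n + 1] (conf s f p u)).state = some b ∧
      (((machine R q).fstep y)^[n + 1] (conf s f p u)).used = u := by
  induction n with
  | zero =>
    intro s f p hs h0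
    rcases hs with hs | rfl | rfl
    · refine ⟨false, ?_⟩
      simp only [zero_add, Function.iterate_one]
      rw [fstep_late_none _ _ _ _ hs (by simpa using h0)]
      exact ⟨rfl, rfl⟩
    · exact ⟨true, rfl, rfl⟩
    · exact ⟨false, rfl, rfl⟩
  | succ n ih =>
    intro s f p hs h0
    rcases hs with hs | rfl | rfl
    · rw [Function.iterate_succ_apply]
      by_cases h : f 0 (p 0) = none
      · rw [fstep_late_none _ _ _ _ hs h, OracleTM.iterate_fstep_of_verdict _ _ _ (b := false) rfl]
        exact ⟨false, rfl, rfl⟩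
      · rw [fstep_late _ _ _ _ hs h]
        apply ih _ _ _ (core_late_or hs _)
        rw [core_tape_zero hs]
        simp only [if_true, OracleTM.shift, Function.update_eq_self]
        rw [← h0]; push_cast; ring_nf
    · rw [OracleTM.iterate_fstep_of_verdict _ _ _ (b := true) rfl]
      exact ⟨true, rfl, rfl⟩
    · rw [OracleTM.iterate_fstep_of_verdict _ _ _ (b := false) rfl]
      exact ⟨false, rfl, rfl⟩

end TripleTM

/-! ### Second phase: unary multiplication and guessing -/

namespace TripleTM

section Multiply

variable {R q : ℕ} (y : ℕ → Bool)

/-- Cells during the second phase: a source tape, a target tape, the tape of guesses, the rest. -/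
def mcell (s : Bool) (F : Fin 10 → ℤ → Option Bool) (S D G : ℤ → Option Bool) :
    Fin 10 → ℤ → Option Bool :=
  fun i => if i = src s then S else if i = dst s then D else if i = 6 then G else F i

/-- Head positions during the second phase. -/
def mpos (s : Bool) (P : Fin 10 → ℤ) (a b g z : ℤ) : Fin 10 → ℤ :=
  fun i => if i = src s then a else if i = dst s then b else if i = 6 then g
    else if i = 0 then z else P i

variable (s : Bool) (F : Fin 10 → ℤ → Option Bool) (S D G : ℤ → Option Bool)
  (P : Fin 10 → ℤ) (a b g z : ℤ) (u : ℕ)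

/-- Each mark of the source is replaced by `R + 1` marks on the target, one per step. The source
head waits until the last of them, when it erases its mark. Every such step uses up one cell of the
input tape, which is traversed backwards. -/
theorem mul_step_mark (r : Fin (R + 1)) (hr : r ≠ Fin.last R) (h0 : F 0 z ≠ none)
    (hS : S a ≠ none) :
    (machine R q).fstep y (conf (.mul s r) (mcell s F S D G) (mpos s P a b g z) u) =
      conf (.mul s (r + 1)) (mcell s F S (Function.update D b (some true)) G)
        (mpos s P a (b + 1) g (z - 1)) u := by
  rw [fstep_mul]
  have e0 : mcell s F S D G 0 (mpos s P a b g z 0) = F 0 z := by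
    cases s <;> simp [mcell, mpos, src, dst]
  have e1 : mcell s F S D G (src s) (mpos s P a b g z (src s)) = S a := by
    simp [mcell, mpos]
  simp only [next, e0, e1, h0, hS, hr, if_false, and_false]
  congr 1
  · funext i
    cases s <;> fin_cases i <;> simp [mcell, mpos, src, dst]
  · funext i
    cases s <;> fin_cases i <;> simp [mpos, src, dst, go, OracleTM.shift, sub_eq_add_neg]

theorem mul_step_last (h0 : F 0 z ≠ none) (hS : S a ≠ none) :
    (machine R q).fstep y (conf (.mul s (Fin.last R)) (mcell s F S D G) (mpos s P a b g z) u) =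
      conf (.mul s 0) (mcell s F (Function.update S a none) (Function.update D b (some true)) G)
        (mpos s P (a - 1) (b + 1) g (z - 1)) u := by
  rw [fstep_mul]
  have e0 : mcell s F S D G 0 (mpos s P a b g z 0) = F 0 z := by
    cases s <;> simp [mcell, mpos, src, dst]
  have e1 : mcell s F S D G (src s) (mpos s P a b g z (src s)) = S a := by
    simp [mcell, mpos]
  simp only [next, e0, e1, h0, hS, if_false, if_true, and_true]
  congr 1
  · funext i
    cases s <;> fin_cases i <;> simp [mcell, mpos, src, dst]
  · funext i
    cases s <;> fin_cases i <;> simp [mpos, src, dst, go, OracleTM.shift, sub_eq_add_neg]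

/-- A blank under the source head means that the round is complete. The target head stands behind
its last mark and goes back onto it, ready to act as the source of the next round. -/
theorem mul_step_blank (r : Fin (R + 1)) (h0 : F 0 z ≠ none) (hS : S a = none) :
    (machine R q).fstep y (conf (.mul s r) (mcell s F S D G) (mpos s P a b g z) u) =
      conf (.toss s 0) (mcell s F S D G) (mpos s P a (b - 1) g (z - 1)) u := by
  rw [fstep_mul]
  have e0 : mcell s F S D G 0 (mpos s P a b g z 0) = F 0 z := by
    cases s <;> simp [mcell, mpos, src, dst]
  have e1 : mcell s F S D G (src s) (mpos s P a b g z (src s)) = S a := by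
    simp [mcell, mpos]
  simp only [next, e0, e1, h0, hS, if_false, if_true]
  congr 1
  · funext i
    cases s <;> fin_cases i <;> simp [mcell, mpos, src, dst]
  · funext i
    cases s <;> fin_cases i <;> simp [mpos, src, dst, go, OracleTM.shift, sub_eq_add_neg]

/-- The input tape has been traversed. Heads `0` to `6` stand one cell to the left of their data and
move onto it: the first letter, the leftmost cells of the tracks, and the most recent guess. -/
theorem mul_step_end (r : Fin (R + 1)) (h0 : F 0 z = none) :
    (machine R q).fstep y (conf (.mul s r) (mcell s F S D G) (mpos s P a b g z) u) =
      conf (.sel false) (mcell s F S D G)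
        (mpos s (fun i => if (i : ℕ) ≤ 5 then P i + 1 else P i) a b (g + 1) (z + 1)) u := by
  rw [fstep_mul]
  have e0 : mcell s F S D G 0 (mpos s P a b g z 0) = F 0 z := by
    cases s <;> simp [mcell, mpos, src, dst]
  simp only [next, e0, h0, if_true]
  congr 1
  · funext i
    cases s <;> fin_cases i <;> simp [mcell, mpos, src, dst]
  · funext i
    cases s <;> fin_cases i <;> simp [mpos, src, dst, go, OracleTM.shift]

theorem toss_step (j : Fin (q + 1)) :
    (machine R q).fstep y (conf (.toss s j) (mcell s F S D G) (mpos s P a b g z) u) =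
      conf (if j = Fin.last q then .mul (!s) 0 else .toss s (j + 1))
        (mcell s F S D (Function.update G g (some (y u)))) (mpos s P a b (g - 1) z) (u + 1) := by
  rw [fstep_toss]
  simp only [next]
  congr 1
  · funext i
    cases s <;> fin_cases i <;> simp [mcell, mpos, src, dst]
  · funext i
    cases s <;> fin_cases i <;> simp [mpos, src, dst, go, OracleTM.shift, sub_eq_add_neg]

/-- The flag `s` only says which of the two counters is the source, so the roles are exchanged after
a round without copying. -/
theorem mcell_swap : mcell s F S D G = mcell (!s) F D S G := by
  funext i
  cases s <;> fin_cases i <;> simp [mcell, src, dst]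

theorem mpos_swap : mpos s P a b g z = mpos (!s) P b a g z := by
  funext i
  cases s <;> fin_cases i <;> simp [mpos, src, dst]

/-- The tape of guesses after `u` guesses. -/
def gcell (y : ℕ → Bool) (u : ℕ) (z : ℤ) : Option Bool :=
  if -(u : ℤ) < z ∧ z ≤ 0 then some (y (-z).toNat) else none

theorem gcell_succ (y : ℕ → Bool) (u : ℕ) :
    Function.update (gcell y u) (-(u : ℤ)) (some (y u)) = gcell y (u + 1) := by
  funext z
  simp only [Function.update_apply, gcell]
  by_cases h : z = -(u : ℤ)
  · subst h; simp
  · rw [if_neg h]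
    congr 1
    apply propext
    push_cast
    omega

/-- `l` marks on consecutive cells, starting at `a`. -/
def marks (a : ℤ) (l : ℕ) (z : ℤ) : Option Bool := if a ≤ z ∧ z < a + l then some true else none

theorem marks_zero (a : ℤ) : marks a 0 = fun _ => none := by
  funext z; simp only [marks]; rw [if_neg (by push_cast; omega)]

theorem marks_snoc (a : ℤ) (l : ℕ) :
    Function.update (marks a l) (a + l) (some true) = marks a (l + 1) := by
  funext z
  simp only [Function.update_apply, marks]
  by_cases h : z = a + l
  · subst h; simp
  · rw [if_neg h]; congr 1; apply propext; push_cast; omega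

theorem marks_erase (a : ℤ) (l : ℕ) :
    Function.update (marks a (l + 1)) (a + l) none = marks a l := by
  funext z
  simp only [Function.update_apply, marks]
  by_cases h : z = a + l
  · subst h; simp
  · rw [if_neg h]; congr 1; apply propext; push_cast; omega

/-- All guesses of one round. -/
theorem toss_run (j : ℕ) (hj : j ≤ q) :
    ((machine R q).fstep y)^[j + 1] (conf (.toss s ⟨q - j, by omega⟩)
        (mcell s F S D (gcell y u)) (mpos s P a b (-u) z) u) =
      conf (.mul (!s) 0) (mcell s F S D (gcell y (u + (j + 1))))
        (mpos s P a b (-(u + (j + 1) : ℕ)) z) (u + (j + 1)) := by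
  induction j generalizing u with
  | zero =>
    simp only [zero_add, Function.iterate_one, Nat.sub_zero]
    rw [toss_step, gcell_succ, if_pos (by ext; simp)]
    congr 2; push_cast; ring
  | succ j ih =>
    rw [Function.iterate_succ_apply, toss_step, gcell_succ, if_neg, ]
    · have e : ((⟨q - (j + 1), by omega⟩ : Fin (q + 1)) + 1) = ⟨q - j, by omega⟩ := by
        ext
        rw [Fin.val_add_one_of_lt]
        · simp only; omega
        · rw [Fin.lt_def]; simp; omega
      have e2 : (-(u : ℤ) - 1) = -((u + 1 : ℕ) : ℤ) := by push_cast; ring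
      rw [e, e2, ih (u := u + 1) (by omega), show u + 1 + (j + 1) = u + (j + 1 + 1) by omega]
    · intro h
      have := congrArg Fin.val h
      simp at this; omega

/-- The part of a round in which marks are multiplied. -/
theorem mark_run (l m : ℕ) (hm : m ≤ (R + 1) * l) (hF : ∀ i : ℕ, i < m → F 0 (z - i) ≠ none) :
    ((machine R q).fstep y)^[m] (conf (.mul s 0)
        (mcell s F (marks a l) (marks b 0) G) (mpos s P (a + l - 1) b g z) u) =
      conf (.mul s ⟨m % (R + 1), Nat.mod_lt _ (by omega)⟩)
        (mcell s F (marks a (l - m / (R + 1))) (marks b m) G)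
        (mpos s P (a + l - (m / (R + 1) : ℕ) - 1) (b + m) g (z - m)) u := by
  induction m with
  | zero => simp
  | succ m ih =>
    rw [Function.iterate_succ_apply', ih (by omega) (fun i hi => hF i (by omega))]
    have hlt : m / (R + 1) < l := by
      rw [Nat.div_lt_iff_lt_mul (by omega)]; rw [mul_comm]; omega
    have hS : marks a (l - m / (R + 1)) (a + l - (m / (R + 1) : ℕ) - 1) ≠ none := by
      have : a ≤ (a + l - (m / (R + 1) : ℕ) - 1) ∧
        (a + l - (m / (R + 1) : ℕ) - 1) < a + ((l - m / (R + 1) : ℕ) : ℤ) := by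
        omega
      rw [marks, if_pos this]; simp
    -- Either step `m` writes the last of the `R + 1` copies of a mark, which is then erased, or the
    -- source tape does not change.
    by_cases hr : m % (R + 1) = R
    · have hdiv : (m + 1) / (R + 1) = m / (R + 1) + 1 := by
        rw [Nat.succ_div, if_pos]
        rw [Nat.dvd_iff_mod_eq_zero, Nat.add_mod, hr]
        rcases R with _ | R <;> simp [Nat.mod_eq_of_lt]
      have hmod : (m + 1) % (R + 1) = 0 := by
        have h1 := Nat.div_add_mod (m + 1) (R + 1)
        have h2 := Nat.div_add_mod m (R + 1)
        rw [hdiv] at h1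
        rw [hr] at h2
        have : (R + 1) * (m / (R + 1) + 1) = (R + 1) * (m / (R + 1)) + (R + 1) := by ring
        omega
      have e : (⟨m % (R + 1), Nat.mod_lt _ (by omega)⟩ : Fin (R + 1)) = Fin.last R := by
        ext; simpa using hr
      rw [e, mul_step_last _ _ _ _ _ _ _ _ _ _ _ _ (hF m (by omega)) hS]
      have e1 : l - m / (R + 1) = (l - (m + 1) / (R + 1)) + 1 := by omega
      have e2 : a + l - (m / (R + 1) : ℕ) - 1 = a + (l - (m + 1) / (R + 1) : ℕ) := by omega
      have e3 : (⟨(m + 1) % (R + 1), Nat.mod_lt _ (by omega)⟩ : Fin (R + 1)) = 0 := by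
        ext; simpa using hmod
      rw [e1, e2, marks_erase, marks_snoc, e3]
      have e4 : a + ((l - (m + 1) / (R + 1) : ℕ) : ℤ) - 1 =
        a + l - ((m + 1) / (R + 1) : ℕ) - 1 := by omega
      have e5 : b + (m : ℤ) + 1 = b + (m + 1 : ℕ) := by omega
      have e6 : z - (m : ℤ) - 1 = z - (m + 1 : ℕ) := by omega
      rw [e4, e5, e6]
    · have hlt' := Nat.mod_lt m (show 0 < R + 1 by omega)
      have h2 := Nat.div_add_mod m (R + 1)
      have hdm : (m + 1) / (R + 1) = m / (R + 1) ∧ (m + 1) % (R + 1) = m % (R + 1) + 1 := by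
        rw [Nat.div_mod_unique (by omega)]
        omega
      rw [mul_step_mark _ _ _ _ _ _ _ _ _ _ _ _ _ _ (hF m (by omega)) hS, marks_snoc, hdm.1]
      · have e : (⟨m % (R + 1), Nat.mod_lt _ (by omega)⟩ : Fin (R + 1)) + 1 =
            ⟨(m + 1) % (R + 1), Nat.mod_lt _ (by omega)⟩ := by
          ext
          rw [Fin.val_add_one_of_lt]
          · exact hdm.2.symm
          · rw [Fin.lt_def]; simp; omega
        have e5 : b + (m : ℤ) + 1 = b + (m + 1 : ℕ) := by omega
        have e6 : z - (m : ℤ) - 1 = z - (m + 1 : ℕ) := by omega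
        rw [e, e5, e6]
      · intro h
        have := congrArg Fin.val h
        simp at this; omega

/-- A full round. -/
theorem round_run (l : ℕ) (hF : ∀ i : ℕ, i < (R + 1) * l + 1 → F 0 (z - i) ≠ none) :
    ((machine R q).fstep y)^[(R + 1) * l + 1 + (q + 1)] (conf (.mul s 0)
        (mcell s F (marks a l) (marks b 0) (gcell y u)) (mpos s P (a + l - 1) b (-u) z) u) =
      conf (.mul (!s) 0)
        (mcell (!s) F (marks b ((R + 1) * l)) (marks (a - 1) 0) (gcell y (u + (q + 1))))
        (mpos (!s) P (b + ((R + 1) * l : ℕ) - 1) (a - 1) (-(u + (q + 1) : ℕ))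
          (z - ((R + 1) * l : ℕ) - 1)) (u + (q + 1)) := by
  rw [show (R + 1) * l + 1 + (q + 1) = (q + 1) + 1 + (R + 1) * l by ring,
    Function.iterate_add_apply, mark_run _ _ _ _ _ _ _ _ _ _ _ _ le_rfl (fun i hi => hF i (by omega))]
  have e1 : (R + 1) * l / (R + 1) = l := Nat.mul_div_cancel_left _ (by omega)
  simp only [e1]
  rw [Function.iterate_succ_apply, mul_step_blank]
  · have := toss_run (R := R) y s F (marks a (l - l)) (marks b ((R + 1) * l)) P
      (a + l - (l : ℕ) - 1) (b + ((R + 1) * l : ℕ) - 1) (z - ((R + 1) * l : ℕ) - 1) u q le_rfl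
    simp only [Nat.sub_self] at this ⊢
    have e : (⟨0, by omega⟩ : Fin (q + 1)) = 0 := rfl
    rw [e] at this
    rw [this, mcell_swap, mpos_swap, marks_zero, marks_zero]
    congr 2
    ring
  · exact hF _ (by omega)
  · simp [marks_zero]

end Multiply

end TripleTM

/-! ### First and second phase together -/

namespace TripleTM

/-- Here `w` is the number of clock cells still available when the counter is `(R + 1) ^ j`. The
rounds so far have used a geometric sum, hence at most `4 * (R + 1) ^ j - 1` cells, while the last
round alone has used more than `(R + 1) ^ j`. So the final `J` is determined by `n` up to a
constant: `(R + 1) ^ J < n` unless `J = 0`, and `n < 3 * (R + 1) ^ (J + 1)`. The numbers `J` and `t`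
are chosen before the guesses `y`. -/
theorem mul_phase {R q n : ℕ} (hR : 1 ≤ R) (F : Fin 10 → ℤ → Option Bool) (P : Fin 10 → ℤ)
    (hF : ∀ z : ℤ, F 0 z ≠ none ↔ 0 ≤ z ∧ z < n) (w : ℕ) :
    ∀ (s : Bool) (j : ℕ) (a b : ℤ), w ≤ n → (j = 0 ∨ (R + 1) ^ j + 1 + w ≤ n) →
      n + 1 ≤ 4 * (R + 1) ^ j + w →
      ∃ (J t : ℕ) (s' : Bool) (S D : ℤ → Option Bool) (a' b' : ℤ),
        t ≤ (w + 1) * (q + 2) ∧ (J = 0 ∨ (R + 1) ^ J + 1 ≤ n) ∧ n + 1 ≤ 3 * (R + 1) ^ (J + 1) ∧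
        ∀ y : ℕ → Bool, ((machine R q).fstep y)^[t] (conf (.mul s 0)
          (mcell s F (marks a ((R + 1) ^ j)) (marks b 0) (gcell y ((q + 1) * j)))
          (mpos s P (a + ((R + 1) ^ j : ℕ) - 1) b (-((q + 1) * j : ℕ)) (w - 1)) ((q + 1) * j)) =
        conf (.sel false) (mcell s' F S D (gcell y ((q + 1) * J)))
          (mpos s' (fun i => if (i : ℕ) ≤ 5 then P i + 1 else P i) a' b'
            (-((q + 1) * J : ℕ) + 1) 0) ((q + 1) * J) := by
  induction w using Nat.strong_induction_on with
  | _ w ih =>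
    intro s j a b hw h1 h2
    -- A full round needs one cell per new mark and one more for noticing the end of the source; the
    -- guesses do not move the clock.
    by_cases hc : (R + 1) * (R + 1) ^ j + 1 ≤ w
    · have hpow : (R + 1) ^ (j + 1) = (R + 1) * (R + 1) ^ j := by rw [pow_succ, mul_comm]
      obtain ⟨J, t, s', S, D, a', b', ht, hJ1, hJ2, hrun⟩ :=
        ih (w - ((R + 1) * (R + 1) ^ j + 1)) (by omega) (!s) (j + 1) b (a - 1) (by omega)
          (Or.inr (by rw [hpow]; omega)) (by
            rw [hpow]
            have : 2 * (R + 1) ^ j ≤ (R + 1) * (R + 1) ^ j := by gcongr; omega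
            omega)
      refine ⟨J, t + ((R + 1) * (R + 1) ^ j + 1 + (q + 1)), s', S, D, a', b', ?_, hJ1, hJ2, ?_⟩
      · obtain ⟨d, hd⟩ := Nat.exists_eq_add_of_le hc
        rw [hd] at ht ⊢
        have : (R + 1) * (R + 1) ^ j + 1 + d - ((R + 1) * (R + 1) ^ j + 1) = d := by omega
        rw [this] at ht
        nlinarith [Nat.zero_le ((R + 1) * (R + 1) ^ j), Nat.zero_le q,
          Nat.zero_le ((R + 1) * (R + 1) ^ j * q)]
      · intro y
        rw [Function.iterate_add_apply, round_run]
        · have := hrun y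
          rw [← this]
          have e2 : ((w : ℤ) - 1) - ((R + 1) * (R + 1) ^ j : ℕ) - 1 =
            ((w - ((R + 1) * (R + 1) ^ j + 1) : ℕ) : ℤ) - 1 := by omega
          rw [e2, hpow, show (q + 1) * j + (q + 1) = (q + 1) * (j + 1) by ring]
        · intro i hi
          rw [hF]; omega
    · have hpow : (R + 1) ^ (j + 1) = (R + 1) * (R + 1) ^ j := by rw [pow_succ, mul_comm]
      refine ⟨j, w + 1, s, marks a ((R + 1) ^ j - w / (R + 1)), marks b w,
        a + ((R + 1) ^ j : ℕ) - (w / (R + 1) : ℕ) - 1, b + w, ?_, ?_, ?_, fun y => ?_⟩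
      rotate_left 3
      · rw [Function.iterate_succ_apply', mark_run _ _ _ _ _ _ _ _ _ _ _ _ (by omega)
          (fun i hi => by rw [hF]; omega), mul_step_end]
        · have e : (w : ℤ) - 1 - w + 1 = 0 := by ring
          rw [e]
        · have := (hF ((w : ℤ) - 1 - w)).not
          simp only [not_not] at this
          rw [this]; omega
      · exact Nat.le_mul_of_pos_right _ (by omega)
      · omega
      · rw [hpow]
        have : 2 * (R + 1) ^ j ≤ (R + 1) * (R + 1) ^ j := by gcongr; omega
        omega

/-- Tapes after the input has been distributed over the five tracks. -/
def track (X : ℤ → Option Bool) (i : Fin 10) (z : ℤ) : Option Bool :=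
  if i = 0 then X z else if (i : ℕ) ≤ 5 then X ((i : ℤ) - 1 - 5 * z) else none

/-- Tapes while the input is being distributed. -/
def lcell (X : ℤ → Option Bool) (m : ℕ) (i : Fin 10) (z : ℤ) : Option Bool :=
  if i = 0 then X z else if (i : ℕ) ≤ 5 ∧ (i : ℤ) - 1 - 5 * z < m then X ((i : ℤ) - 1 - 5 * z)
  else none

/-- Head positions while the input is being distributed. -/
def lpos (m : ℕ) (i : Fin 10) : ℤ :=
  if i = 0 then m else if (i : ℕ) ≤ 5 then -((m + 5 - i) / 5 : ℕ) else 0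

variable {R q : ℕ}

/-- Letter `m` goes to tape `m % 5 + 1`, whose head then moves left, so the tracks carry the input
backwards. After `m` letters, tape `i` has received `(m + 5 - i) / 5` of them, which is the
displacement in `lpos`. -/
theorem load_step (y : ℕ → Bool) (X : ℤ → Option Bool) (m : ℕ)
    (h : X m ≠ none) :
    (machine R q).fstep y (conf (.load ⟨m % 5, Nat.mod_lt _ (by omega)⟩) (lcell X m) (lpos m) 0) =
    conf (.load ⟨(m + 1) % 5, Nat.mod_lt _ (by omega)⟩) (lcell X (m + 1)) (lpos (m + 1)) 0 := by
  rw [fstep_load]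
  have e0 : lcell X m 0 (lpos m 0) = X m := by simp [lcell, lpos]
  simp only [next, e0, h, if_false]
  congr 1
  · congr 1
    ext
    rw [Fin.val_add]
    show (m % 5 + 1) % 5 = (m + 1) % 5
    omega
  · funext i z
    simp only [Function.update_apply]
    by_cases hi : i = 0
    · subst hi
      simp [lcell, lpos]
      intro h; subst h; rfl
    · have hi' : 0 < (i : ℕ) := Fin.pos_iff_ne_zero.mpr hi
      simp only [lcell, lpos, hi, if_false]
      by_cases h5 : (i : ℕ) ≤ 5
      · simp only [h5, if_true, true_and]
        by_cases hc : (i : ℕ) = m % 5 + 1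
        · simp only [hc, if_true]
          by_cases hz : z = -((m + 5 - (m % 5 + 1)) / 5 : ℕ)
          · rw [if_pos hz, if_pos (by push_cast; omega)]
            congr 1
            omega
          · rw [if_neg hz]
            by_cases hlt : ((m % 5 + 1 : ℕ) : ℤ) - 1 - 5 * z < m
            · rw [if_pos hlt, if_pos (by push_cast at *; omega)]
            · rw [if_neg hlt, if_neg (by push_cast at *; omega)]
        · simp only [hc, if_false]
          have : ((i : ℤ) - 1 - 5 * z < (m : ℤ)) ↔ ((i : ℤ) - 1 - 5 * z < (m + 1 : ℕ)) := by
            push_cast; omega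
          split_ifs with h1 h2 h3 h4 h5 <;> first | rfl | (subst h1; rfl) | (exfalso; omega)
      · have : ¬ ((i : ℕ) = m % 5 + 1) := by omega
        simp [h5, this]
  · funext i
    by_cases hi : i = 0
    · subst hi
      simp [lpos, OracleTM.shift]
    · have hi' : 0 < (i : ℕ) := Fin.pos_iff_ne_zero.mpr hi
      simp only [lpos, hi, if_false]
      by_cases h5 : (i : ℕ) ≤ 5
      · simp only [h5, if_true]
        by_cases hc : (i : ℕ) = m % 5 + 1
        · simp [hc, go, OracleTM.shift]
          omega
        · simp [hc, go, OracleTM.shift]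
          omega
      · have : ¬ ((i : ℕ) = m % 5 + 1) := by omega
        simp [h5, this, go, OracleTM.shift]

theorem load_run (y : ℕ → Bool) (X : ℤ → Option Bool) (m : ℕ)
    (h : ∀ i : ℕ, i < m → X i ≠ none) :
    ((machine R q).fstep y)^[m] (conf (.load 0) (lcell X 0) (lpos 0) 0) =
    conf (.load ⟨m % 5, Nat.mod_lt _ (by omega)⟩) (lcell X m) (lpos m) 0 := by
  induction m with
  | zero => rfl
  | succ m ih =>
    rw [Function.iterate_succ_apply', ih (fun i hi => h i (by omega)),
      load_step _ _ _ (h m (by omega))]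

theorem lcell_zero (X : ℤ → Option Bool) (hX : ∀ z < 0, X z = none) :
    lcell X 0 = fun i => if i = 0 then X else fun _ => none := by
  funext i z
  unfold lcell
  split_ifs with h1 h2
  · rfl
  · apply hX; push_cast at h2; exact h2.2
  · rfl

theorem lcell_eq_track (X : ℤ → Option Bool) (n : ℕ) (hX : ∀ z : ℤ, (n : ℤ) ≤ z → X z = none) :
    lcell X n = track X := by
  funext i z
  unfold lcell track
  by_cases h0 : i = 0
  · simp [h0]
  by_cases h5 : (i : ℕ) ≤ 5
  · simp only [h0, h5, if_false, if_true, true_and]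
    split_ifs with h
    · rfl
    · exact (hX _ (by omega)).symm
  · simp [h0, h5]

theorem lpos_zero : lpos 0 = fun _ => 0 := by
  funext i
  unfold lpos
  by_cases hi : i = 0
  · subst hi
    simp
  · have hi' : 0 < (i : ℕ) := Fin.pos_iff_ne_zero.mpr hi
    simp only [hi, if_false]
    split_ifs <;> omega

/-- The blank behind the input puts a single mark on tape `8`, so the counter starts at `(R + 1) ^
0`, and the input head turns back. -/
theorem load_end (y : ℕ → Bool) (X : ℤ → Option Bool) (n : ℕ)
    (hX : ∀ z : ℤ, (n : ℤ) ≤ z → X z = none) :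
    (machine R q).fstep y (conf (.load ⟨n % 5, Nat.mod_lt _ (by omega)⟩) (lcell X n) (lpos n) 0) =
    conf (.mul false 0) (mcell false (track X) (marks 0 ((R + 1) ^ 0)) (marks 0 0) (gcell y ((q + 1) * 0)))
      (mpos false (lpos n) (0 + ((R + 1) ^ 0 : ℕ) - 1) 0 (-((q + 1) * 0 : ℕ)) (n - 1))
      ((q + 1) * 0) := by
  rw [fstep_load, lcell_eq_track X n hX]
  have e0 : track X 0 (lpos n 0) = none := by simp [track, lpos]; exact hX _ le_rfl
  simp only [next, e0, if_true]
  congr 1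
  · funext i
    have e1 : Function.update (fun _ : ℤ => (none : Option Bool)) 0 (some true) = marks 0 1 := by
      have := marks_snoc 0 0
      rw [marks_zero] at this
      simpa using this
    have e2 : gcell y 0 = fun _ => none := by
      funext z
      rw [gcell, if_neg (by push_cast; omega)]
    by_cases h8 : i = 8
    · subst h8
      have e3 : track X 8 = fun _ => none := by funext z; simp [track]
      simp [mcell, src, e3, lpos, e1]
    · rw [if_neg h8, Function.update_eq_self]
      funext z
      simp only [mcell, src, dst, mul_zero, e2, marks_zero, h8, if_false, Bool.false_eq_true]
      split_ifs with h9 h6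
      · subst h9; simp [track]
      · subst h6; simp [track]
      · rfl
  · funext i
    fin_cases i <;> simp [mpos, src, dst, lpos, go, OracleTM.shift, sub_eq_add_neg]

theorem inputCell_eq (x : List Bool) (z : ℤ) : (machine R q).inputCell x z =
    if 0 ≤ z then x[z.toNat]? else none := by
  unfold OracleTM.inputCell
  split_ifs
  · show Option.getD (Option.map some (x[z.toNat]?)) none = _
    cases x[z.toNat]? <;> rfl
  · rfl

/-- The input tape. -/
def icell (x : List Bool) (z : ℤ) : Option Bool := if 0 ≤ z then x[z.toNat]? else none

theorem icell_ne_none (x : List Bool) (z : ℤ) : icell x z ≠ none ↔ 0 ≤ z ∧ z < x.length := by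
  unfold icell
  split_ifs with h
  · rw [Ne, List.getElem?_eq_none_iff]; omega
  · simp; omega

theorem icell_of_lt (x : List Bool) (z : ℤ) (h : z < 0) : icell x z = none := by
  rw [icell, if_neg (by omega)]

theorem icell_of_le (x : List Bool) (z : ℤ) (h : (x.length : ℤ) ≤ z) : icell x z = none := by
  by_contra h'
  have := (icell_ne_none x z).mp h'
  omega

theorem fstart_eq (x : List Bool) :
    (machine R q).fstart x = conf (.load 0) (lcell (icell x) 0) (lpos 0) 0 := by
  rw [lcell_zero _ (icell_of_lt x), lpos_zero]
  have : (machine R q).inputCell x = icell x := funext (inputCell_eq x)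
  unfold OracleTM.fstart
  rw [this]
  rfl

/-- Head positions at the beginning of the third phase. -/
def spos (n : ℕ) (i : Fin 10) : ℤ := if (i : ℕ) ≤ 5 then lpos n i + 1 else lpos n i

/-- The first two phases: the tracks are in place and `(q + 1) * J` bits have been guessed. -/
theorem setup_run (hR : 1 ≤ R) (x : List Bool) :
    ∃ (J t : ℕ) (s' : Bool) (S D : ℤ → Option Bool) (a' b' : ℤ),
      t ≤ (x.length + 1) * (q + 3) ∧ (J = 0 ∨ (R + 1) ^ J + 1 ≤ x.length) ∧
      x.length + 1 ≤ 3 * (R + 1) ^ (J + 1) ∧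
      ∀ y : ℕ → Bool, (machine R q).fcfgAt x y t =
        conf (.sel false) (mcell s' (track (icell x)) S D (gcell y ((q + 1) * J)))
          (mpos s' (spos x.length) a' b' (-((q + 1) * J : ℕ) + 1) 0) ((q + 1) * J) := by
  obtain ⟨J, t, s', S, D, a', b', ht, h1, h2, hrun⟩ :=
    mul_phase (R := R) (q := q) (n := x.length) hR (track (icell x)) (lpos x.length)
      (fun z => by simpa [track] using icell_ne_none x z) x.length false 0 0 0 le_rfl
      (Or.inl rfl) (by simp)
  refine ⟨J, t + (1 + x.length), s', S, D, a', b', ?_, h1, h2, fun y => ?_⟩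
  · nlinarith [ht]
  · rw [OracleTM.fcfgAt, fstart_eq, Function.iterate_add_apply, Function.iterate_add_apply,
      load_run, Function.iterate_one, load_end _ _ _ (icell_of_le x), hrun y]
    · rfl
    · intro i hi
      rw [icell_ne_none]; omega

end TripleTM

/-! ### Third phase: comparing labels, rewinding, adding three words -/

namespace TripleTM

/-- The number given by the first `b` bits, most significant bit first. -/
def pref (v : ℕ → Bool) : ℕ → ℕ
  | 0 => 0
  | b + 1 => 2 * pref v b + (v b).toNat

/-- The tapes of the third phase; tape `7` has content `U`. -/
def scell (F : Fin 10 → ℤ → Option Bool) (U : ℤ → Option Bool) : Fin 10 → ℤ → Option Bool :=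
  fun i => if i = 7 then U else F i

/-- A word of length `W` on cells `0, …, W - 1`. -/
def word (W : ℕ) (v : ℕ → Bool) (z : ℤ) : Option Bool :=
  if 0 ≤ z ∧ z < W then some (v z.toNat) else none

/-- The well-formed content of the tapes at the beginning of the third phase: a list of `N` words
of `W` bits, in increasing order on tape `1` and in decreasing order on tape `2`, with labels `lab`
on tape `4`, and a guess `g` on tape `6`. -/
structure Layout (F : Fin 10 → ℤ → Option Bool) (o og : ℤ) (n N W : ℕ) (v lab : ℕ → ℕ → Bool)
    (g : ℕ → Bool) : Prop where
  clock : ∀ z : ℤ, 0 ≤ z → z < n → F 0 z ≠ none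
  up : ∀ i < N, ∀ b < W, F 1 (o + (i * W + b : ℕ)) = some (v i b)
  down : ∀ i < N, ∀ b < W, F 2 (o + (i * W + b : ℕ)) = some (v (N - 1 - i) b)
  flag : ∀ i < N, ∀ b < W, F 3 (o + (i * W + b : ℕ)) = some (decide (b + 1 = W))
  label : ∀ i < N, ∀ b < W, F 4 (o + (i * W + b : ℕ)) = some (lab i b)
  count : ∀ t ≤ N, (F 5 (o + t) = some true ↔ t < N - 1)
  guess : ∀ b < W, (F 6 (og + b) == some true) = g b

variable {R q : ℕ} (y : ℕ → Bool) {F : Fin 10 → ℤ → Option Bool} {o og : ℤ} {n N W : ℕ}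
  {v lab : ℕ → ℕ → Bool} {g : ℕ → Bool}

/-- The label of entry `i` differs from the guess on the first `b` bits. -/
def mism (lab : ℕ → ℕ → Bool) (g : ℕ → Bool) (i : ℕ) : ℕ → Bool
  | 0 => false
  | b + 1 => mism lab g i b || (lab i b != g b)

theorem mism_eq_false (i b : ℕ) : mism lab g i b = false ↔ ∀ c < b, lab i c = g c := by
  induction b with
  | zero => simp [mism]
  | succ b ih =>
    simp only [mism, Bool.or_eq_false_iff, ih, bne_eq_false_iff_eq]
    constructor
    · rintro ⟨h1, h2⟩ c hc
      rcases Nat.lt_succ_iff_lt_or_eq.mp hc with h | rfl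
      · exact h1 c h
      · exact h2
    · intro h
      exact ⟨fun c hc => h c (by omega), h b (by omega)⟩

/-- The head positions given by a list. -/
def vpos (z pv pw pf pl pc pg pu a b : ℤ) : Fin 10 → ℤ := ![z, pv, pw, pf, pl, pc, pg, pu, a, b]

/-- The positions after moving all heads in the set `B` by `k` and the clock by `t`. -/
theorem sel_run (L : Layout F o og n N W v lab g) (i : ℕ) (hi : i < N) (U : ℤ → Option Bool)
    (z pw pc a' b' : ℤ) (u b : ℕ) (hb : b < W) (hz : 0 ≤ z) (hzn : z + b ≤ n) :
    ((machine R q).fstep y)^[b] (conf (.sel false) (scell F U)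
      (vpos z (o + (i * W : ℕ)) pw (o + (i * W : ℕ)) (o + (i * W : ℕ)) pc og 0 a' b') u) =
    conf (.sel (mism lab g i b))
      (scell F (fun x => if 0 ≤ x ∧ x < b then some (v i x.toNat) else U x))
      (vpos (z + b) (o + (i * W + b : ℕ)) pw (o + (i * W + b : ℕ)) (o + (i * W + b : ℕ)) pc (og + b)
        b a' b') u := by
  induction b with
  | zero =>
    have : (fun x : ℤ => if 0 ≤ x ∧ x < ((0 : ℕ) : ℤ) then some (v i x.toNat) else U x) = U := by
      funext x; rw [if_neg]; push_cast; omega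
    rw [this]; simp [mism]
  | succ b ih =>
    rw [Function.iterate_succ_apply', ih (by omega) (by push_cast at hzn; omega), fstep_late _ _ _ _ (Or.inl ⟨_, rfl⟩)]
    · have h1 := L.up i hi b (by omega)
      have h3 := L.flag i hi b (by omega)
      have h4 := L.label i hi b (by omega)
      have h6 := L.guess b (by omega)
      have hne : ¬ (b + 1 = W) := by omega
      simp only [core, scell, vpos, Matrix.cons_val]
      simp only [Fin.reduceEq, if_false, h1, h3, h4, h6, hne, decide_false, Option.some.injEq,
        Bool.false_eq_true]
      congr 1
      · simp [mism]
      · funext j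
        by_cases h7 : j = 7
        · subst h7
          simp only [scell, if_true, Function.update_self, Matrix.cons_val]
          funext x
          rw [Function.update_apply]
          by_cases hx : x = b
          · subst hx
            simp
          · rw [if_neg hx]
            congr 1
            apply propext
            push_cast; omega
        · simp only [h7, if_false, scell]
          rw [Function.update_of_ne h7]
          fin_cases j <;> first | exact absurd rfl h7 | simp
      · funext j
        fin_cases j <;> simp [OracleTM.shift, go] <;> ring
    · simp only [scell, vpos, Matrix.cons_val]
      exact L.clock _ (by omega) (by push_cast at hzn; omega)

/-- Scanning one entry and comparing its label with the guess. -/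
theorem sel_pass (L : Layout F o og n N W v lab g) (i : ℕ) (hi : i < N) (U : ℤ → Option Bool)
    (hU : ∀ x, x < 0 ∨ (W : ℤ) ≤ x → U x = none)
    (z pw pc a' b' : ℤ) (u : ℕ) (hW : 0 < W) (hz : 0 ≤ z) (hzn : z + W ≤ n) :
    ((machine R q).fstep y)^[W] (conf (.sel false) (scell F U)
      (vpos z (o + (i * W : ℕ)) pw (o + (i * W : ℕ)) (o + (i * W : ℕ)) pc og 0 a' b') u) =
    conf (.back (if mism lab g i W then 0 else 1)) (scell F (word W (v i)))
      (vpos (z + W) (o + ((i + 1) * W : ℕ)) pw (o + ((i + 1) * W : ℕ)) (o + ((i + 1) * W : ℕ))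
        (pc + 1) (og + W - 1) (W - 1) a' b') u := by
  obtain ⟨b, rfl⟩ : ∃ b, W = b + 1 := ⟨W - 1, by omega⟩
  rw [Function.iterate_succ_apply', sel_run y L i hi U z pw pc a' b' u b (by omega) hz
    (by push_cast at hzn; omega), fstep_late _ _ _ _ (Or.inl ⟨_, rfl⟩)]
  · have h1 := L.up i hi b (by omega)
    have h3 := L.flag i hi b (by omega)
    have h4 := L.label i hi b (by omega)
    have h6 := L.guess b (by omega)
    simp only [core, scell, vpos, Matrix.cons_val]
    simp only [Fin.reduceEq, if_false, h1, h3, h4, h6, decide_true, if_true]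
    congr 1
    · simp [mism]
    · funext j
      by_cases h7 : j = 7
      · subst h7
        simp only [scell, if_true, Function.update_self, Matrix.cons_val]
        funext x
        rw [Function.update_apply, word]
        by_cases hx : x = b
        · subst hx
          simp
        · rw [if_neg hx]
          by_cases hx2 : 0 ≤ x ∧ x < b
          · rw [if_pos hx2, if_pos (by push_cast; omega)]
          · rw [if_neg hx2, if_neg (by push_cast; omega)]
            -- Outside the first `W` cells tape `7` has to be blank: these blanks delimit the word
            -- when it is rewound and added.
            exact hU x (by push_cast; omega)
      · simp only [h7, if_false, scell]
        rw [Function.update_of_ne h7]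
        fin_cases j <;> first | exact absurd rfl h7 | simp
    · funext j
      fin_cases j <;> simp [OracleTM.shift, go] <;> ring
  · simp only [scell, vpos, Matrix.cons_val]
    exact L.clock _ (by omega) (by push_cast at hzn; omega)

/-- The tape that goes back together with tape `7`. -/
def mate (m : Fin 4) : Fin 10 := if m = 0 then 6 else if m = 2 then 1 else if m = 3 then 2 else 7

/-- Tape `7` holds exactly one word, so the blank on its left tells when `W` cells have been
crossed. The companion tape moves in step and is thereby taken back by one entry although it has no
marker of its own. The value `mate 1 = 7` means that no other tape is rewound. -/
theorem back_run (hF : ∀ z : ℤ, 0 ≤ z → z < n → F 0 z ≠ none) (m : Fin 4) (v' : ℕ → Bool)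
    (p : Fin 10 → ℤ) (u k : ℕ) (hk : k ≤ W) (hp : p 7 = W - 1) (hz : 0 ≤ p 0) (hzn : p 0 + k ≤ n) :
    ((machine R q).fstep y)^[k] (conf (.back m) (scell F (word W v')) p u) =
    conf (.back m) (scell F (word W v'))
      (fun i => if i = 0 then p i + k else if i = 7 ∨ i = mate m then p i - k else p i) u := by
  have m0 : mate m ≠ 0 := by fin_cases m <;> simp [mate]
  induction k with
  | zero => simp
  | succ k ih =>
    rw [Function.iterate_succ_apply', ih (by omega) (by push_cast at hzn; omega),
      fstep_late _ _ _ _ (Or.inr (Or.inl ⟨_, rfl⟩))]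
    · have h7 : scell F (word W v') 7 (p 7 - k) ≠ none := by
        simp only [scell, if_true, word]
        rw [if_pos (by omega)]; simp
      simp only [core, Fin.reduceEq, if_false, true_or, if_true, h7]
      congr 1
      · funext i; exact Function.update_eq_self _ _
      · funext i
        by_cases h0 : i = 0
        · subst h0
          simp [OracleTM.shift]; ring
        · simp only [h0, if_false, OracleTM.shift, go]
          by_cases h : i = 7 ∨ i = mate m
          · have h' := h
            simp only [mate] at h'
            simp [h, h']; ring
          · have h' := h
            simp only [mate] at h'
            simp [h, h']
    · simp only [scell, Fin.reduceEq, if_false, if_true]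
      exact hF _ (by omega) (by push_cast at hzn; omega)

/-- Going back to the beginning of an entry and looking at the counter. -/
theorem back_pass (hF : ∀ z : ℤ, 0 ≤ z → z < n → F 0 z ≠ none) (m : Fin 4) (v' : ℕ → Bool)
    (p : Fin 10 → ℤ) (u : ℕ) (hp : p 7 = W - 1) (hz : 0 ≤ p 0) (hzn : p 0 + W + 1 ≤ n) :
    ((machine R q).fstep y)^[W + 1] (conf (.back m) (scell F (word W v')) p u) =
    conf (if F 5 (p 5) = some true then (if m = 0 then .sel false else .cmp 2) else .rej)
      (scell F (word W v'))
      (fun i => if i = 0 then p i + W + 1 else if i = 7 ∨ i = mate m then p i - W + 1 else p i)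
      u := by
  have m0 : mate m ≠ 0 := by fin_cases m <;> simp [mate]
  have m5 : mate m ≠ 5 := by fin_cases m <;> simp [mate]
  rw [Function.iterate_succ_apply', back_run y hF m v' p u W le_rfl hp hz (by omega),
      fstep_late _ _ _ _ (Or.inr (Or.inl ⟨_, rfl⟩))]
  · have h7 : scell F (word W v') 7 (p 7 - W) = none := by
      simp only [scell, if_true, word]
      rw [if_neg (by omega)]
    have h5 : scell F (word W v') 5 = F 5 := by
      simp [scell]
    simp only [core, Fin.reduceEq, if_false, true_or, if_true, h7, false_or, m5.symm, h5]
    congr 1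
    · funext i; exact Function.update_eq_self _ _
    · funext i
      by_cases h0 : i = 0
      · subst h0
        simp [OracleTM.shift]
      · simp only [h0, if_false, OracleTM.shift, go]
        by_cases h : i = 7 ∨ i = mate m
        · have h' := h
          simp only [mate] at h'
          simp [h, h']
        · have h' := h
          simp only [mate] at h'
          simp [h, h']
  · simp only [scell, Fin.reduceEq, if_false, if_true]
    exact hF _ (by omega) (by omega)

theorem pref_snoc (w : ℕ → Bool) (b : ℕ) : (pref w (b + 1) : ℤ) = 2 * pref w b + (w b).toNat := by
  simp [pref]

/-- Adding up three words. -/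
theorem cmp_run (L : Layout F o og n N W v lab g) (i j l : ℕ) (hj : j < N) (hl : l < N)
    (z pf pl pc pg a' b' : ℤ) (u b : ℕ) (hb : b ≤ W) (hz : 0 ≤ z) (hzn : z + b ≤ n) :
    ((machine R q).fstep y)^[b] (conf (.cmp 2) (scell F (word W (v i)))
      (vpos z (o + (j * W : ℕ)) (o + ((N - 1 - l) * W : ℕ)) pf pl pc pg 0 a' b') u) =
    conf (.cmp (sgn (pref (v i) b + pref (v j) b + pref (v l) b - (2 ^ b - 1))))
      (scell F (word W (v i)))
      (vpos (z + b) (o + (j * W + b : ℕ)) (o + ((N - 1 - l) * W + b : ℕ)) pf pl pc pg b a' b') u := by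
  induction b with
  | zero => simp [pref, sgn]
  | succ b ih =>
    rw [Function.iterate_succ_apply', ih (by omega) (by push_cast at hzn; omega),
      fstep_late _ _ _ _ (Or.inr (Or.inr ⟨_, rfl⟩))]
    · have h1 := L.up j hj b (by omega)
      have h2 := L.down (N - 1 - l) (by omega) b (by omega)
      rw [show N - 1 - (N - 1 - l) = l by omega] at h2
      have h7 : word W (v i) (b : ℤ) = some (v i b) := by
        rw [word, if_pos (by omega)]; simp
      simp only [core, scell, vpos, Matrix.cons_val]
      simp only [Fin.reduceEq, if_false, if_true, h1, h2, h7, reduceCtorEq]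
      congr 1
      · have e : ∀ c : Bool, (some c == some true) = c := by decide
        simp only [e]
        rw [upd_sgn]
        · congr 2
          simp only [pref_snoc, pow_succ]; push_cast; ring
        · cases v j b <;> cases v l b <;> cases v i b <;> simp
      · funext j; exact Function.update_eq_self _ _
      · funext j
        fin_cases j <;> simp [OracleTM.shift, go] <;> ring
    · simp only [scell, vpos, Matrix.cons_val]
      exact L.clock _ (by omega) (by push_cast at hzn; omega)

end TripleTM

/-! ### Third phase: the two-pointer search -/

namespace TripleTM

variable {R q : ℕ} (y : ℕ → Bool) {F : Fin 10 → ℤ → Option Bool} {o og : ℤ} {n N W : ℕ}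
  {v lab : ℕ → ℕ → Bool} {g : ℕ → Bool}

/-- Started in `c`, the machine halts within `t` steps, and accepts iff `p` holds. -/
def Verdict (R q : ℕ) (y : ℕ → Bool) (c : (machine R q).FCfg) (t : ℕ) (p : Prop) : Prop :=
  ∃ b, (machine R q).verdict (((machine R q).fstep y)^[t] c).state = some b ∧ (b = true ↔ p)

theorem Verdict.congr {c : (machine R q).FCfg} {t : ℕ} {p p' : Prop}
    (h : Verdict R q y c t p) (hp : p ↔ p') : Verdict R q y c t p' := by
  obtain ⟨b, h1, h2⟩ := h
  exact ⟨b, h1, h2.trans hp⟩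

theorem Verdict.mono {c : (machine R q).FCfg} {t t' : ℕ} {p : Prop}
    (h : Verdict R q y c t p) (ht : t ≤ t') : Verdict R q y c t' p := by
  obtain ⟨b, h1, h2⟩ := h
  refine ⟨b, ?_, h2⟩
  obtain ⟨k, rfl⟩ := Nat.exists_eq_add_of_le ht
  rw [add_comm, Function.iterate_add_apply, OracleTM.iterate_fstep_of_verdict _ _ _ h1, h1]

theorem Verdict.after {c c' : (machine R q).FCfg} {t t' : ℕ} {p : Prop}
    (h : Verdict R q y c' t' p) (hc : ((machine R q).fstep y)^[t] c = c') :
    Verdict R q y c (t' + t) p := by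
  obtain ⟨b, h1, h2⟩ := h
  exact ⟨b, by rw [Function.iterate_add_apply, hc, h1], h2⟩

theorem Verdict.after_one {c c' : (machine R q).FCfg} {t' : ℕ} {p : Prop}
    (h : Verdict R q y c' t' p) (hc : (machine R q).fstep y c = c') :
    Verdict R q y c (t' + 1) p :=
  Verdict.after (t := 1) y h hc

theorem Verdict.acc {f : Fin 10 → ℤ → Option Bool} {p : Fin 10 → ℤ} {u : ℕ} {P : Prop} (hP : P) :
    Verdict R q y (conf .acc f p u) 0 P := ⟨true, rfl, by simpa using hP⟩

theorem Verdict.rej {f : Fin 10 → ℤ → Option Bool} {p : Fin 10 → ℤ} {u : ℕ} {P : Prop}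
    (hP : ¬ P) : Verdict R q y (conf .rej f p u) 0 P := ⟨false, rfl, by simpa using hP⟩

/-- After an addition both list heads have passed their entries. If the sum is too large, tape `1`
must return to its entry, whereas tape `2`, in decreasing order, already stands before the next
smaller one. If it is too small, the roles are exchanged. Both cases advance the counter on tape `5`
by one. -/
theorem fstep_cmp_end (d : Fin 4) (v' : ℕ → Bool) (z pv pw pf pl pc pg a' b' : ℤ) (u : ℕ)
    (h0 : F 0 z ≠ none) :
    (machine R q).fstep y (conf (.cmp d) (scell F (word W v'))
      (vpos z pv pw pf pl pc pg W a' b') u) =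
    if d = 2 then conf .acc (scell F (word W v')) (vpos (z + 1) pv pw pf pl pc pg W a' b') u
    else if d = 3 then conf (.back 2) (scell F (word W v'))
      (vpos (z + 1) (pv - 1) pw pf pl (pc + 1) pg (W - 1) a' b') u
    else conf (.back 3) (scell F (word W v'))
      (vpos (z + 1) pv (pw - 1) pf pl (pc + 1) pg (W - 1) a' b') u := by
  rw [fstep_late _ _ _ _ (Or.inr (Or.inr ⟨_, rfl⟩))]
  · have h7 : word W v' (W : ℤ) = none := by
      rw [word, if_neg (by omega)]
    simp only [core, scell, vpos, Matrix.cons_val]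
    simp only [Fin.reduceEq, if_false, if_true, h7]
    split_ifs
    all_goals
      congr 1
      · funext j; exact Function.update_eq_self _ _
      · funext j
        fin_cases j <;> simp [OracleTM.shift, go, sub_eq_add_neg]
  · simpa [scell, vpos] using h0

theorem mate_two : mate 2 = 1 := rfl
theorem mate_three : mate 3 = 2 := rfl
theorem mate_one : mate 1 = 7 := rfl
theorem mate_zero : mate 0 = 6 := rfl

theorem sgn_eq_two (z : ℤ) : sgn z = 2 ↔ z = 0 := by
  unfold sgn; split_ifs <;> simp <;> omega

theorem sgn_eq_three (z : ℤ) : sgn z = 3 ↔ 0 < z := by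
  unfold sgn; split_ifs <;> simp <;> omega

/-- The two-pointer search. -/
theorem walk (L : Layout F o og n N W v lab g)
    (hsort : ∀ i j, i ≤ j → j < N → pref (v i) W ≤ pref (v j) W) (i : ℕ)
    (pf pl pg a' b' : ℤ) (u : ℕ) (d : ℕ) :
    ∀ (j l : ℕ) (z : ℤ), j < l → l < N → l = j + d → 0 ≤ z → z + d * (2 * W + 2 : ℕ) ≤ n →
    Verdict R q y (conf (.cmp 2) (scell F (word W (v i)))
      (vpos z (o + (j * W : ℕ)) (o + ((N - 1 - l) * W : ℕ)) pf pl (o + (j + (N - 1 - l) : ℕ))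
        pg 0 a' b') u) (d * (2 * W + 2))
      (∃ j' l', j ≤ j' ∧ j' < l' ∧ l' ≤ l ∧
        pref (v i) W + pref (v j') W + pref (v l') W + 1 = 2 ^ W) := by
  induction d with
  | zero => intro j l z h1 h2 h3; omega
  | succ d ih =>
    intro j l z hjl hl hd hz hzn
    have hzn' : z + (2 * W + 2) + d * (2 * W + 2 : ℕ) ≤ n := by
      push_cast at hzn ⊢; linarith
    have hd0 : (0 : ℤ) ≤ (d : ℤ) * (2 * W + 2 : ℕ) := by positivity
    have hrun := cmp_run (R := R) (q := q) y L i j l (by omega) hl z pf pl (o + (j + (N - 1 - l) : ℕ)) pg a' b' u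
      W le_rfl hz (by omega)
    set D : ℤ := pref (v i) W + pref (v j) W + pref (v l) W - (2 ^ W - 1) with hD
    have h0 : F 0 (z + W) ≠ none := L.clock _ (by omega) (by omega)
    have hstep := fstep_cmp_end (R := R) (q := q) (W := W) y (sgn D) (v i) (z + W) (o + (j * W + W : ℕ))
      (o + ((N - 1 - l) * W + W : ℕ)) pf pl (o + (j + (N - 1 - l) : ℕ)) pg a' b' u h0
    have hcast : ∀ j' l', (pref (v i) W + pref (v j') W + pref (v l') W + 1 = 2 ^ W ↔
        (pref (v i) W + pref (v j') W + pref (v l') W : ℤ) - (2 ^ W - 1) = 0) := by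
      intro j' l'
      rw [← @Nat.cast_inj ℤ]
      push_cast
      constructor <;> intro h <;> linarith
    have hcount := L.count (j + (N - 1 - l) + 1) (by omega)
    by_cases hD0 : D = 0
    · rw [if_pos ((sgn_eq_two D).mpr hD0)] at hstep
      refine (((Verdict.acc y ?_).after_one y hstep).after y hrun).mono y ?_
      · exact ⟨j, l, le_rfl, hjl, le_rfl, (hcast j l).mpr hD0⟩
      · nlinarith
    · rw [if_neg (by rwa [sgn_eq_two])] at hstep
      -- The common part of the two unsuccessful cases: one end of the interval is dropped, `j₁` and
      -- `l₁` are the new ends, and `m` tells which tape is rewound.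
      have hmain : ∀ (j₁ l₁ : ℕ) (m : Fin 4) (V1 W1 : ℤ), m ≠ 0 →
          (machine R q).fstep y (conf (.cmp (sgn D)) (scell F (word W (v i)))
            (vpos (z + W) (o + (j * W + W : ℕ)) (o + ((N - 1 - l) * W + W : ℕ)) pf pl
              (o + (j + (N - 1 - l) : ℕ)) pg W a' b') u) =
            conf (.back m) (scell F (word W (v i)))
              (vpos (z + W + 1) V1 W1 pf pl (o + (j + (N - 1 - l) : ℕ) + 1) pg (W - 1) a' b') u →
          (j₁ + 1 = l₁ + 1 - d) → l₁ < N → j₁ + (N - 1 - l₁) = j + (N - 1 - l) + 1 →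
          j₁ + d = l₁ →
          (fun i => if i = 0 then (vpos (z + W + 1) V1 W1 pf pl (o + (j + (N - 1 - l) : ℕ) + 1) pg
              (W - 1) a' b') i + W + 1 else if i = 7 ∨ i = mate m then
              (vpos (z + W + 1) V1 W1 pf pl (o + (j + (N - 1 - l) : ℕ) + 1) pg (W - 1) a' b') i
                - W + 1
            else (vpos (z + W + 1) V1 W1 pf pl (o + (j + (N - 1 - l) : ℕ) + 1) pg (W - 1) a' b') i)
            = vpos (z + W + 1 + W + 1) (o + (j₁ * W : ℕ)) (o + ((N - 1 - l₁) * W : ℕ)) pf pl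
              (o + (j₁ + (N - 1 - l₁) : ℕ)) pg 0 a' b' →
          ((∃ j' l', j ≤ j' ∧ j' < l' ∧ l' ≤ l ∧
            pref (v i) W + pref (v j') W + pref (v l') W + 1 = 2 ^ W) ↔
            ∃ j' l', j₁ ≤ j' ∧ j' < l' ∧ l' ≤ l₁ ∧
            pref (v i) W + pref (v j') W + pref (v l') W + 1 = 2 ^ W) →
          Verdict R q y (conf (.cmp 2) (scell F (word W (v i)))
            (vpos z (o + (j * W : ℕ)) (o + ((N - 1 - l) * W : ℕ)) pf pl (o + (j + (N - 1 - l) : ℕ))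
              pg 0 a' b') u) ((d + 1) * (2 * W + 2))
            (∃ j' l', j ≤ j' ∧ j' < l' ∧ l' ≤ l ∧
              pref (v i) W + pref (v j') W + pref (v l') W + 1 = 2 ^ W) := by
        intro j₁ l₁ m V1 W1 hm hst _ hl₁ hcnt hdl hpos hiff
        have hb := back_pass (R := R) (q := q) (W := W) y L.clock m (v i)
          (vpos (z + W + 1) V1 W1 pf pl (o + (j + (N - 1 - l) : ℕ) + 1) pg (W - 1) a' b') u
          (by simp [vpos]) (by simp [vpos]; omega) (by simp [vpos]; omega)
        rw [hpos, if_neg hm] at hb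
        have h5 : vpos (z + W + 1) V1 W1 pf pl (o + (j + (N - 1 - l) : ℕ) + 1) pg (W - 1) a' b' 5 =
            o + ((j + (N - 1 - l) + 1 : ℕ) : ℤ) := by
          simp [vpos]; ring
        rw [h5] at hb
        by_cases hlt : j₁ < l₁
        · rw [if_pos (hcount.mpr (by omega))] at hb
          have := ((((ih j₁ l₁ (z + W + 1 + W + 1) hlt hl₁ hdl.symm (by omega) (by omega)).after y
            hb).after_one y hst).after y hrun).mono y (t' := (d + 1) * (2 * W + 2)) (by nlinarith)
          exact this.congr y hiff.symm
        · rw [if_neg (hcount.not.mpr (by omega))] at hb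
          refine ((((Verdict.rej y ?_).after y hb).after_one y hst).after y hrun).mono y
            (by nlinarith)
          rw [hiff]
          rintro ⟨j', l', h1, h2, h3, -⟩
          omega
      -- If the sum is too large, then entry `l` is too large together with every `j' ≥ j`, and it
      -- can be dropped. Otherwise the sum is too small, and entry `j` is too small together with
      -- every `l' ≤ l`.
      by_cases hpos : 0 < D
      · rw [if_pos ((sgn_eq_three D).mpr hpos)] at hstep
        refine hmain j (l - 1) 2 _ _ (by simp) hstep (by omega) (by omega) (by omega) (by omega) ?_ ?_
        · have e : N - 1 - (l - 1) = N - 1 - l + 1 := by omega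
          rw [e]
          funext k
          fin_cases k <;> simp [vpos, mate_two] <;> ring
        · constructor
          · rintro ⟨j', l', h1, h2, h3, h4⟩
            refine ⟨j', l', h1, h2, ?_, h4⟩
            by_contra hcon
            have hl' : l' = l := by omega
            subst hl'
            have := hsort j j' h1 (by omega)
            rw [hcast] at h4
            have : (pref (v j) W : ℤ) ≤ pref (v j') W := by exact_mod_cast this
            linarith
          · rintro ⟨j', l', h1, h2, h3, h4⟩
            exact ⟨j', l', h1, h2, by omega, h4⟩
      · rw [if_neg (by rwa [sgn_eq_three])] at hstep
        refine hmain (j + 1) l 3 _ _ (by simp) hstep (by omega) (by omega) (by omega) (by omega) ?_ ?_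
        · funext k
          fin_cases k <;> simp [vpos, mate_three] <;> ring
        · constructor
          · rintro ⟨j', l', h1, h2, h3, h4⟩
            refine ⟨j', l', ?_, h2, h3, h4⟩
            by_contra hcon
            have hl' : j' = j := by omega
            subst hl'
            have := hsort l' l h3 (by omega)
            rw [hcast] at h4
            have : (pref (v l') W : ℤ) ≤ pref (v l) W := by exact_mod_cast this
            have : D < 0 := lt_of_le_of_ne (not_lt.mp hpos) hD0
            linarith
          · rintro ⟨j', l', h1, h2, h3, h4⟩
            exact ⟨j', l', by omega, h2, h3, h4⟩

/-- The first entry from `i` on whose label is the guess has two later complements. -/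
def Found (W N : ℕ) (v lab : ℕ → ℕ → Bool) (g : ℕ → Bool) (i : ℕ) : Prop :=
  ∃ i', i ≤ i' ∧ (∀ k, i ≤ k → k < i' → ∃ b < W, lab k b ≠ g b) ∧ (∀ b < W, lab i' b = g b) ∧
    ∃ j l, i' < j ∧ j < l ∧ l < N ∧ pref (v i') W + pref (v j) W + pref (v l) W + 1 = 2 ^ W

theorem Found.succ_iff {i : ℕ} (h : ∃ b < W, lab i b ≠ g b) :
    Found W N v lab g i ↔ Found W N v lab g (i + 1) := by
  constructor
  · rintro ⟨i', h1, h2, h3, h4⟩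
    refine ⟨i', ?_, fun k hk => h2 k (by omega), h3, h4⟩
    rcases h1.lt_or_eq with h1 | rfl
    · exact h1
    · obtain ⟨b, hb, hne⟩ := h
      exact absurd (h3 b hb) hne
  · rintro ⟨i', h1, h2, h3, h4⟩
    refine ⟨i', by omega, fun k hk hk' => ?_, h3, h4⟩
    rcases hk.lt_or_eq with hk | rfl
    · exact h2 k hk hk'
    · exact h

theorem Found.iff_of_match {i : ℕ} (h : ∀ b < W, lab i b = g b) :
    Found W N v lab g i ↔ ∃ j l, i < j ∧ j < l ∧ l < N ∧
      pref (v i) W + pref (v j) W + pref (v l) W + 1 = 2 ^ W := by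
  constructor
  · rintro ⟨i', h1, h2, h3, h4⟩
    rcases h1.lt_or_eq with h1 | rfl
    · obtain ⟨b, hb, hne⟩ := h2 i le_rfl h1
      exact absurd (h b hb) hne
    · exact h4
  · intro h4
    exact ⟨i, le_rfl, fun k hk hk' => by omega, h, h4⟩

/-- Looking for the guessed entry, then searching for its two complements. -/
theorem select (L : Layout F o og n N W v lab g) (hW : 0 < W) (hN : 2 ≤ N)
    (hsort : ∀ i j, i ≤ j → j < N → pref (v i) W ≤ pref (v j) W)
    (a' b' : ℤ) (u : ℕ) (d : ℕ) :
    ∀ (i : ℕ) (U : ℤ → Option Bool) (z : ℤ), i + 1 + d = N →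
    (∀ x, x < 0 ∨ (W : ℤ) ≤ x → U x = none) → 0 ≤ z →
    z + (d + 1) * (2 * W + 1 : ℕ) + N * (2 * W + 2 : ℕ) ≤ n →
    Verdict R q y (conf (.sel false) (scell F U)
      (vpos z (o + (i * W : ℕ)) o (o + (i * W : ℕ)) (o + (i * W : ℕ)) (o + i) og 0 a' b') u)
      ((d + 1) * (2 * W + 1) + N * (2 * W + 2))
      (Found W N v lab g i) := by
  -- The treatment of a single entry, where `hnext` stands for the induction hypothesis. After the
  -- scan the counter stands at `i + 1`; if this is not below `N - 1`, fewer than two entries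
  -- follow, and neither entry `i` nor a later one can be the smallest of a triple.
  have key : ∀ (d i : ℕ) (U : ℤ → Option Bool) (z : ℤ), i + 1 + d = N →
      (∀ x, x < 0 ∨ (W : ℤ) ≤ x → U x = none) → 0 ≤ z →
      z + (d + 1) * (2 * W + 1 : ℕ) + N * (2 * W + 2 : ℕ) ≤ n →
      (∀ U' : ℤ → Option Bool, (∀ x, x < 0 ∨ (W : ℤ) ≤ x → U' x = none) → i + 1 < N - 1 →
        Verdict R q y (conf (.sel false) (scell F U')
          (vpos (z + (2 * W + 1)) (o + ((i + 1) * W : ℕ)) o (o + ((i + 1) * W : ℕ))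
            (o + ((i + 1) * W : ℕ)) (o + (i + 1 : ℕ)) og 0 a' b') u)
          (d * (2 * W + 1) + N * (2 * W + 2)) (Found W N v lab g (i + 1))) →
      Verdict R q y (conf (.sel false) (scell F U)
        (vpos z (o + (i * W : ℕ)) o (o + (i * W : ℕ)) (o + (i * W : ℕ)) (o + i) og 0 a' b') u)
        ((d + 1) * (2 * W + 1) + N * (2 * W + 2)) (Found W N v lab g i) := by
    intro d i U z hi hU hz hzn hnext
    have hd0 : (0 : ℤ) ≤ (d : ℤ) * (2 * W + 1 : ℕ) := by positivity
    have hN0 : (2 * W + 2 : ℤ) ≤ (N : ℤ) * (2 * W + 2 : ℕ) := by push_cast; nlinarith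
    have hzn2 : z + (2 * W + 1) + d * (2 * W + 1 : ℕ) + N * (2 * W + 2 : ℕ) ≤ n := by
      push_cast at hzn ⊢; linarith
    have hrun := sel_pass (R := R) (q := q) y L i (by omega) U hU z o (o + i) a' b' u hW hz
      (by omega)
    have hcount := L.count (i + 1)
    cases hm : mism lab g i W with
    | true =>
      have hno : ∃ b < W, lab i b ≠ g b := by
        by_contra hcon
        push Not at hcon
        rw [(mism_eq_false i W).mpr hcon] at hm
        exact absurd hm (by decide)
      rw [hm, if_pos rfl] at hrun
      have hb := back_pass (R := R) (q := q) (W := W) y L.clock 0 (v i)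
        (vpos (z + W) (o + ((i + 1) * W : ℕ)) o (o + ((i + 1) * W : ℕ)) (o + ((i + 1) * W : ℕ))
        (o + i + 1) (og + W - 1) (W - 1) a' b') u (by simp [vpos]) (by simp [vpos]; omega)
        (by simp [vpos]; omega)
      have hpos : (fun k => if k = 0 then (vpos (z + W) (o + ((i + 1) * W : ℕ)) o
          (o + ((i + 1) * W : ℕ)) (o + ((i + 1) * W : ℕ)) (o + i + 1) (og + W - 1) (W - 1) a' b') k
          + W + 1 else if k = 7 ∨ k = mate 0 then
          (vpos (z + W) (o + ((i + 1) * W : ℕ)) o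
          (o + ((i + 1) * W : ℕ)) (o + ((i + 1) * W : ℕ)) (o + i + 1) (og + W - 1) (W - 1) a' b') k
          - W + 1 else (vpos (z + W) (o + ((i + 1) * W : ℕ)) o
          (o + ((i + 1) * W : ℕ)) (o + ((i + 1) * W : ℕ)) (o + i + 1) (og + W - 1) (W - 1) a' b') k)
          = vpos (z + (2 * W + 1)) (o + ((i + 1) * W : ℕ)) o (o + ((i + 1) * W : ℕ))
            (o + ((i + 1) * W : ℕ)) (o + (i + 1 : ℕ)) og 0 a' b' := by
        funext k
        fin_cases k <;> simp [vpos, mate_zero] <;> ring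
      rw [hpos, if_pos rfl] at hb
      have h5 : vpos (z + W) (o + ((i + 1) * W : ℕ)) o (o + ((i + 1) * W : ℕ))
          (o + ((i + 1) * W : ℕ)) (o + i + 1) (og + W - 1) (W - 1) a' b' 5 =
          o + ((i + 1 : ℕ) : ℤ) := by
        simp [vpos]; ring
      rw [h5] at hb
      by_cases hlt : i + 1 < N - 1
      · rw [if_pos ((hcount (by omega)).mpr hlt)] at hb
        have := (((hnext (word W (v i)) (fun x hx => by rw [word, if_neg (by omega)])
          hlt).after y hb).after y hrun).mono y (t' := (d + 1) * (2 * W + 1) + N * (2 * W + 2))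
          (by nlinarith)
        exact this.congr y (Found.succ_iff hno).symm
      · rw [if_neg ((hcount (by omega)).not.mpr hlt)] at hb
        refine (((Verdict.rej y ?_).after y hb).after y hrun).mono y (by nlinarith)
        rw [Found.succ_iff hno]
        rintro ⟨i', h1, h2, h3, j, l, h4, h5, h6, -⟩
        omega
    | false =>
      have hyes := (mism_eq_false i W).mp hm
      rw [hm, if_neg (by decide)] at hrun
      have hb := back_pass (R := R) (q := q) (W := W) y L.clock 1 (v i)
        (vpos (z + W) (o + ((i + 1) * W : ℕ)) o (o + ((i + 1) * W : ℕ)) (o + ((i + 1) * W : ℕ))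
        (o + i + 1) (og + W - 1) (W - 1) a' b') u (by simp [vpos]) (by simp [vpos]; omega)
        (by simp [vpos]; omega)
      have hpos : (fun k => if k = 0 then (vpos (z + W) (o + ((i + 1) * W : ℕ)) o
          (o + ((i + 1) * W : ℕ)) (o + ((i + 1) * W : ℕ)) (o + i + 1) (og + W - 1) (W - 1) a' b') k
          + W + 1 else if k = 7 ∨ k = mate 1 then
          (vpos (z + W) (o + ((i + 1) * W : ℕ)) o
          (o + ((i + 1) * W : ℕ)) (o + ((i + 1) * W : ℕ)) (o + i + 1) (og + W - 1) (W - 1) a' b') k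
          - W + 1 else (vpos (z + W) (o + ((i + 1) * W : ℕ)) o
          (o + ((i + 1) * W : ℕ)) (o + ((i + 1) * W : ℕ)) (o + i + 1) (og + W - 1) (W - 1) a' b') k)
          = vpos (z + (2 * W + 1)) (o + ((i + 1) * W : ℕ)) o (o + ((i + 1) * W : ℕ))
            (o + ((i + 1) * W : ℕ)) (o + (i + 1 : ℕ)) (og + W - 1) 0 a' b' := by
        funext k
        fin_cases k <;> simp [vpos, mate_one] <;> ring
      rw [hpos, if_neg (show ¬ (1 : Fin 4) = 0 by decide)] at hb
      have h5 : vpos (z + W) (o + ((i + 1) * W : ℕ)) o (o + ((i + 1) * W : ℕ))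
          (o + ((i + 1) * W : ℕ)) (o + i + 1) (og + W - 1) (W - 1) a' b' 5 =
          o + ((i + 1 : ℕ) : ℤ) := by
        simp [vpos]; ring
      rw [h5] at hb
      by_cases hlt : i + 1 < N - 1
      · rw [if_pos ((hcount (by omega)).mpr hlt)] at hb
        -- The scan has left tape `1` at entry `i + 1`, and tape `2` has not moved from the largest
        -- entry. So the search starts with the widest interval behind `i`, and the counter already
        -- has the matching value.
        have hw := walk (R := R) (q := q) y L hsort i (o + ((i + 1) * W : ℕ))
          (o + ((i + 1) * W : ℕ)) (og + W - 1) a' b' u (N - 1 - (i + 1)) (i + 1) (N - 1)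
          (z + (2 * W + 1)) (by omega) (by omega) (by omega) (by omega) (by
            have : ((N - 1 - (i + 1) : ℕ) : ℤ) * (2 * W + 2 : ℕ) ≤ N * (2 * W + 2 : ℕ) := by
              gcongr; omega
            omega)
        simp only [Nat.sub_self, zero_mul, Nat.cast_zero, add_zero] at hw
        have := ((hw.after y hb).after y hrun).mono y
          (t' := (d + 1) * (2 * W + 1) + N * (2 * W + 2)) (by
            have : (N - 1 - (i + 1)) * (2 * W + 2) ≤ N * (2 * W + 2) := by gcongr; omega
            nlinarith)
        refine this.congr y ?_
        rw [Found.iff_of_match hyes]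
        constructor
        · rintro ⟨j, l, h1, h2, h3, h4⟩
          exact ⟨j, l, by omega, h2, by omega, h4⟩
        · rintro ⟨j, l, h1, h2, h3, h4⟩
          exact ⟨j, l, by omega, h2, by omega, h4⟩
      · rw [if_neg ((hcount (by omega)).not.mpr hlt)] at hb
        refine (((Verdict.rej y ?_).after y hb).after y hrun).mono y (by nlinarith)
        rw [Found.iff_of_match hyes]
        rintro ⟨j, l, h1, h2, h3, h4⟩
        omega
  induction d with
  | zero =>
    intro i U z hi hU hz hzn
    exact key 0 i U z hi hU hz hzn (fun _ _ h => by omega)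
  | succ d ih =>
    intro i U z hi hU hz hzn
    refine key (d + 1) i U z hi hU hz hzn (fun U' hU' h => ?_)
    refine ih (i + 1) U' (z + (2 * W + 1)) (by omega) hU' (by omega) ?_
    push_cast at hzn ⊢
    linarith

end TripleTM

/-! ### The language: resource bounds and encodings of lists -/

namespace TripleTM

/-- The language accepted by the machine. -/
def lang (R q : ℕ) : Language Bool :=
  {x | ∃ y : ℕ → Bool, (machine R q).AnswersWithin x y ((x.length + 1) * (q + 4)) true}

theorem track_of_gt (X : ℤ → Option Bool) (i : Fin 10) (hi : 5 < (i : ℕ)) :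
    track X i = fun _ => none := by
  funext z
  have : i ≠ 0 := by rintro rfl; simp at hi
  simp [track, this, not_le.mpr hi]

/-- After the first two phases the clock bounds the remaining time by the length of the input, and
no further bit is guessed. Hence the number of guesses depends on `x` only, not on their outcome. -/
theorem setup_halts {R q : ℕ} (hR : 1 ≤ R) (x : List Bool) :
    ∃ J : ℕ, (J = 0 ∨ (R + 1) ^ J + 1 ≤ x.length) ∧ ∀ y : ℕ → Bool,
      (∃ b, (machine R q).AnswersWithin x y ((x.length + 1) * (q + 4)) b) ∧
      ((machine R q).cfgAt x y ((x.length + 1) * (q + 4))).used = (q + 1) * J := by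
  obtain ⟨J, t, s', S, D, a', b', ht, h1, -, hrun⟩ := setup_run (R := R) (q := q) hR x
  refine ⟨J, h1, fun y => ?_⟩
  have hfin := halts_late (R := R) (q := q) y ((q + 1) * J) x.length (.sel false)
    (mcell s' (track (icell x)) S D (gcell y ((q + 1) * J)))
    (mpos s' (spos x.length) a' b' (-((q + 1) * J : ℕ) + 1) 0) (Or.inl (Or.inl ⟨_, rfl⟩)) (by
      have e : mcell s' (track (icell x)) S D (gcell y ((q + 1) * J)) 0 = icell x := by
        funext z
        cases s' <;> simp [mcell, src, dst, track]
      have e' : mpos s' (spos x.length) a' b' (-((q + 1) * J : ℕ) + 1) 0 0 = 0 := by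
        cases s' <;> simp [mpos, src, dst]
      rw [e, e']
      exact icell_of_le x _ (by omega))
  rw [← hrun y, OracleTM.fcfgAt, ← Function.iterate_add_apply] at hfin
  obtain ⟨b, hb, hu⟩ := hfin
  obtain ⟨k, hk⟩ := Nat.exists_eq_add_of_le
    (show x.length + 1 + t ≤ (x.length + 1) * (q + 4) by nlinarith)
  have hfix : (machine R q).fcfgAt x y ((x.length + 1) * (q + 4)) =
      ((machine R q).fstep y)^[x.length + 1 + t] ((machine R q).fstart x) := by
    rw [hk, OracleTM.fcfgAt, add_comm _ k, Function.iterate_add_apply,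
      OracleTM.iterate_fstep_of_verdict _ _ _ hb]
  refine ⟨⟨b, ?_⟩, ?_⟩
  · rw [OracleTM.answersWithin_iff, hfix, hb]
  · rw [OracleTM.cfgAt_used, hfix, hu]

/-- The language is accepted in linear time with few guesses. -/
theorem lang_mem (p q : ℕ) (hp : 1 ≤ p) (k : ℝ) (hk : 0 ≤ k)
    (hpq : ((q + 1 : ℕ) : ℝ) * (1 + k) ≤ p) :
    lang (2 ^ p - 1) q ∈
      NDTIME (fun n => ⌈1 / (1 + k) * Real.logb 2 n⌉₊) (fun n => (n : ℝ)) := by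
  have hp2 : 2 ≤ 2 ^ p := by
    calc 2 = 2 ^ 1 := rfl
      _ ≤ 2 ^ p := Nat.pow_le_pow_right (by norm_num) hp
  refine ⟨machine (2 ^ p - 1) q, fun n => (n + 1) * (q + 4), ?_, fun x => ⟨fun y => ?_, Iff.rfl⟩⟩
  · refine IsBigO.of_bound (2 * (q + 4)) ?_
    filter_upwards [eventually_ge_atTop 1] with n hn
    have : (1 : ℝ) ≤ n := by exact_mod_cast hn
    rw [Real.norm_of_nonneg (by positivity), Real.norm_of_nonneg (by positivity)]
    push_cast
    nlinarith [Nat.cast_nonneg (α := ℝ) q]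
  · obtain ⟨J, hJ, h⟩ := setup_halts (R := 2 ^ p - 1) (q := q) (by omega) x
    refine ⟨(h y).1, ?_⟩
    rw [(h y).2]
    rcases hJ with rfl | hJ
    · simp
    -- With base `2 ^ p`, completing `J` rounds means `p * J ≤ log₂ n`. As `(q + 1) * (1 + k) ≤ p`,
    -- the number `(q + 1) * J` of guesses is at most `log₂ n / (1 + k)`.
    · rw [Nat.sub_add_cancel (by omega), ← pow_mul] at hJ
      have hlen : (2 : ℝ) ^ (p * J) ≤ (x.length : ℝ) := by
        exact_mod_cast (Nat.le_succ _).trans hJ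
      have hlog : ((p * J : ℕ) : ℝ) ≤ Real.logb 2 x.length := by
        rw [Real.le_logb_iff_rpow_le (by norm_num)
          (lt_of_lt_of_le (by positivity) hlen), Real.rpow_natCast]
        exact hlen
      have hk1 : 0 < 1 + k := by linarith
      rw [← Nat.cast_le (α := ℝ)]
      refine le_trans ?_ (Nat.le_ceil _)
      rw [one_div, inv_mul_eq_div, le_div_iff₀ hk1]
      refine le_trans ?_ hlog
      push_cast at hpq ⊢
      nlinarith [Nat.cast_nonneg (α := ℝ) J]

/-- The bit on track `c` in cell `t` of the encoding of a list of `N` words of `W` bits. -/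
def cellBit (N W : ℕ) (v : ℕ → ℕ → Bool) (t c : ℕ) : Bool :=
  if t < N * W then
    if c = 0 then v (t / W) (t % W)
    else if c = 1 then v (N - 1 - t / W) (t % W)
    else if c = 2 then decide (t % W + 1 = W)
    else if c = 3 then (t / W).testBit (t % W)
    else decide (t < N - 1)
  else false

/-- The encoding of a list of `N` words of `W` bits, padded to `T` cells of five letters each. -/
def encode (T N W : ℕ) (v : ℕ → ℕ → Bool) : List Bool :=
  List.ofFn fun i : Fin (5 * T) => cellBit N W v (T - 1 - i / 5) (i % 5)

theorem encode_length (T N W : ℕ) (v : ℕ → ℕ → Bool) : (encode T N W v).length = 5 * T := by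
  simp [encode]

/-- The cells occur in the word in reverse order because loading writes the tracks from right to
left; on the tracks they are in the order `0, 1, …` again. -/
theorem icell_encode (T N W : ℕ) (v : ℕ → ℕ → Bool) (t c : ℕ) (ht : t < T) (hc : c < 5) :
    icell (encode T N W v) (c - 5 * (-(T : ℤ) + 1 + t)) = some (cellBit N W v t c) := by
  have e : ((c : ℤ) - 5 * (-(T : ℤ) + 1 + t)) = ((c + 5 * (T - 1 - t) : ℕ) : ℤ) := by omega
  rw [e, icell, if_pos (by omega), Int.toNat_natCast, List.getElem?_eq_getElem (by
    rw [encode_length]; omega)]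
  simp only [encode, List.getElem_ofFn]
  congr 2 <;> omega

/-- Label `i` is the binary expansion of `i`, least significant bit first. Guesses are written
leftwards as well, so bit `b` of the guess is the guess number `u - 1 - b`; cells beyond the guesses
are blank and count as zero bits. -/
theorem encode_layout (T N W : ℕ) (v : ℕ → ℕ → Bool) (hW : 0 < W) (hT : N * W < T)
    (s' : Bool) (S D : ℤ → Option Bool) (y : ℕ → Bool) (u : ℕ) :
    Layout (mcell s' (track (icell (encode T N W v))) S D (gcell y u)) (-(T : ℤ) + 1)
      (-(u : ℤ) + 1) (5 * T) N W v (fun i b => i.testBit b)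
      (fun b => if b < u then y (u - 1 - b) else false) := by
  set F := mcell s' (track (icell (encode T N W v))) S D (gcell y u) with hF
  have hF' : ∀ c : ℕ, c < 5 → ∀ (i : Fin 10), (i : ℕ) = c + 1 → ∀ t < T,
      F i (-(T : ℤ) + 1 + t) = some (cellBit N W v t c) := by
    intro c hc i hi t ht
    rw [← icell_encode T N W v t c ht hc, hF]
    have h0 : i ≠ 0 := by rintro rfl; simp at hi
    have h6 : i ≠ 6 := by rintro rfl; simp at hi; omega
    have h8 : i ≠ 8 := by rintro rfl; simp at hi; omega
    have h9 : i ≠ 9 := by rintro rfl; simp at hi; omega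
    have h5 : (i : ℕ) ≤ 5 := by omega
    have hs : i ≠ src s' := by cases s' <;> simpa [src]
    have hd : i ≠ dst s' := by cases s' <;> simpa [dst]
    simp only [mcell, hs, hd, h6, if_false, track, h0, h5, if_true]
    congr 1; omega
  have hlt : ∀ i < N, ∀ b < W, i * W + b < N * W := by
    intro i hi b hb
    calc i * W + b < i * W + W := by omega
      _ = (i + 1) * W := by ring
      _ ≤ N * W := by gcongr; omega
  have hdiv : ∀ i b : ℕ, b < W → (i * W + b) / W = i := fun i b hb => by
    rw [add_comm, Nat.add_mul_div_right _ _ hW, Nat.div_eq_of_lt hb, zero_add]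
  have hmod : ∀ i b : ℕ, b < W → (i * W + b) % W = b := fun i b hb => by
    rw [add_comm, Nat.add_mul_mod_self_right, Nat.mod_eq_of_lt hb]
  have hNW : N ≤ N * W := Nat.le_mul_of_pos_right _ hW
  refine ⟨fun z h1 h2 => ?_, fun i hi b hb => ?_, fun i hi b hb => ?_, fun i hi b hb => ?_,
    fun i hi b hb => ?_, fun t ht => ?_, fun b hb => ?_⟩
  · have : F 0 = icell (encode T N W v) := by
      funext z
      rw [hF]
      cases s' <;> simp [mcell, src, dst, track]
    rw [this, icell_ne_none, encode_length]
    exact ⟨h1, h2⟩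
  · rw [hF' 0 (by omega) 1 rfl _ ((hlt i hi b hb).trans hT), cellBit, if_pos (hlt i hi b hb)]
    simp [hdiv i b hb, hmod i b hb]
  · rw [hF' 1 (by omega) 2 rfl _ ((hlt i hi b hb).trans hT), cellBit, if_pos (hlt i hi b hb)]
    simp [hdiv i b hb, hmod i b hb]
  · rw [hF' 2 (by omega) 3 rfl _ ((hlt i hi b hb).trans hT), cellBit, if_pos (hlt i hi b hb)]
    simp [hmod i b hb]
  · rw [hF' 3 (by omega) 4 rfl _ ((hlt i hi b hb).trans hT), cellBit, if_pos (hlt i hi b hb)]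
    simp [hdiv i b hb, hmod i b hb]
  · rw [hF' 4 (by omega) 5 rfl _ (by omega), cellBit]
    split_ifs with h <;> simp_all
    omega
  · have : F 6 = gcell y u := by
      funext z
      rw [hF]
      cases s' <;> simp [mcell, src, dst]
    rw [this, gcell]
    by_cases h : b < u
    · rw [if_pos (by omega), if_pos h, show (-(-(u : ℤ) + 1 + b)).toNat = u - 1 - b by omega]
      cases y (u - 1 - b) <;> rfl
    · rw [if_neg (by omega), if_neg h]; rfl

/-- On encodings of sorted lists the language says whether three entries at different positions
add up to the word of ones. -/
theorem encode_mem_lang {R q T N W h : ℕ} {v : ℕ → ℕ → Bool} (hR : 1 ≤ R) (hW : 0 < W)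
    (hN : 2 ≤ N) (hT : N * W + N ≤ T) (hNW : N ≤ 2 ^ W) (hNh : N ≤ 2 ^ ((q + 1) * h))
    (hTh : (R + 1) ^ h ≤ T)
    (hsort : ∀ i j, i ≤ j → j < N → pref (v i) W ≤ pref (v j) W) :
    encode T N W v ∈ lang R q ↔ ∃ i j l, i < j ∧ j < l ∧ l < N ∧
      pref (v i) W + pref (v j) W + pref (v l) W + 1 = 2 ^ W := by
  set x := encode T N W v with hx
  have hlen : x.length = 5 * T := encode_length T N W v
  obtain ⟨J, t, s', S, D, a', b', ht, h1, h2, hrun⟩ := setup_run (R := R) (q := q) hR x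
  have hver : ∀ y : ℕ → Bool, Verdict R q y ((machine R q).fstart x) ((x.length + 1) * (q + 4))
      (Found W N v (fun i b => i.testBit b)
        (fun b => if b < (q + 1) * J then y ((q + 1) * J - 1 - b) else false) 0) := by
    intro y
    have L := encode_layout T N W v hW (by omega) s' S D y ((q + 1) * J)
    -- The clock has `5 * T` cells, and selection and search together need at most `N * (2 * W + 1)
    -- + N * (2 * W + 2)` of them, which is less than `5 * (N * W + N)`. The two counter positions
    -- are exchanged according to the parity flag `s'`.
    have hsel := select (R := R) (q := q) y L hW hN hsort (if s' then b' else a')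
      (if s' then a' else b') ((q + 1) * J) (N - 1) 0 (fun _ => none) 0 (by omega)
      (fun _ _ => rfl) le_rfl (by
        have : N - 1 + 1 = N := by omega
        have hc : ((N - 1 : ℕ) : ℤ) + 1 = N := by omega
        rw [hc]; push_cast
        have : (N : ℤ) * W + N ≤ T := by exact_mod_cast hT
        nlinarith)
    refine (hsel.after y (t := t) (c := (machine R q).fstart x) ?_).mono y ?_
    · have := hrun y
      rw [OracleTM.fcfgAt] at this
      rw [this]
      congr 1
      · funext i
        by_cases h7 : i = 7
        · subst h7
          cases s' <;> simp [mcell, scell, src, dst, track_of_gt]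
        · simp [scell, h7, hx]
      · have hl : ∀ i : Fin 10, 1 ≤ (i : ℕ) → (i : ℕ) ≤ 5 → spos x.length i = -(T : ℤ) + 1 := by
          intro i hi1 hi2
          have h0 : i ≠ 0 := by rintro rfl; simp at hi1
          simp only [spos, lpos, h0, hi2, if_true, if_false, hlen]
          omega
        have l1 := hl 1 (by decide) (by decide)
        have l2 := hl 2 (by decide) (by decide)
        have l3 := hl 3 (by decide) (by decide)
        have l4 := hl 4 (by decide) (by decide)
        have l5 := hl 5 (by decide) (by decide)
        have l7 : spos x.length 7 = 0 := by simp [spos, lpos]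
        funext i
        cases s' <;> fin_cases i <;> simp [mpos, vpos, src, dst, l1, l2, l3, l4, l5, l7]
    · have hN1 : N - 1 + 1 = N := by omega
      rw [hN1, hlen]
      rw [hlen] at ht
      nlinarith
  have hmem : x ∈ lang R q ↔ ∃ y : ℕ → Bool, Found W N v (fun i b => i.testBit b)
        (fun b => if b < (q + 1) * J then y ((q + 1) * J - 1 - b) else false) 0 := by
    refine exists_congr fun y => ?_
    rw [OracleTM.answersWithin_iff]
    obtain ⟨b, hb, hiff⟩ := hver y
    rw [← hiff, OracleTM.fcfgAt, hb]
    simp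
  rw [hmem]
  constructor
  · rintro ⟨y, i, -, -, -, j, l, h⟩
    exact ⟨i, j, l, h⟩
  · rintro ⟨i, j, l, hij, hjl, hl, hsum⟩
    -- If `J < h`, then `5 * T + 1 ≤ 3 * (R + 1) ^ (J + 1) ≤ 3 * (R + 1) ^ h ≤ 3 * T`, which is
    -- absurd. So at least `(q + 1) * h` bits are guessed, enough for every index below `N`.
    have hJ : h ≤ J := by
      by_contra hcon
      have h3 : (R + 1) ^ (J + 1) ≤ (R + 1) ^ h := Nat.pow_le_pow_right (by omega) (by omega)
      omega
    have hiu : i < 2 ^ ((q + 1) * J) :=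
      (lt_of_lt_of_le (by omega) hNh).trans_le
        (Nat.pow_le_pow_right (by norm_num) (Nat.mul_le_mul_left _ hJ))
    have hg : ∀ b, (if b < (q + 1) * J then
        i.testBit ((q + 1) * J - 1 - ((q + 1) * J - 1 - b)) else false) = i.testBit b := by
      intro b
      split_ifs with hb
      · congr 1; omega
      · exact (Nat.testBit_lt_two_pow (hiu.trans_le
          (Nat.pow_le_pow_right (by norm_num) (not_lt.mp hb)))).symm
    -- The successful guess spells `i` in reverse. No earlier entry matches it, since `N ≤ 2 ^ W`
    -- makes the labels distinct already on their first `W` bits.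
    refine ⟨fun c => i.testBit ((q + 1) * J - 1 - c), i, Nat.zero_le _, fun k _ hk => ?_,
      fun b _ => (hg b).symm, j, l, hij, hjl, hl, hsum⟩
    by_contra hcon
    push Not at hcon
    refine hk.ne (Nat.eq_of_testBit_eq fun b => ?_)
    by_cases hb : b < W
    · rw [hcon b hb, hg b]
    · have h2W : 2 ^ W ≤ 2 ^ b := Nat.pow_le_pow_right (by norm_num) (not_lt.mp hb)
      rw [Nat.testBit_lt_two_pow (by omega), Nat.testBit_lt_two_pow (by omega)]

end TripleTM

/-! ### A small imperative language: expressions and their code -/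

namespace While

/-- Integer expressions over scalar variables `V` and arrays `A` indexed by integers. -/
inductive Exp (V A : Type) where
  | lit (k : ℤ)
  | var (x : V)
  | get (a : A) (e : Exp V A)
  | add (e f : Exp V A)
  | sub (e f : Exp V A)
  | mul (e f : Exp V A)
  | div (e f : Exp V A)

/-- Statements; conditions ask whether an expression is positive. -/
inductive Stm (V A : Type) where
  | skip
  | set (x : V) (e : Exp V A)
  | put (a : A) (e f : Exp V A)
  | read (x : V)
  | emit (e : Exp V A)
  | seq (c d : Stm V A)
  | ite (e : Exp V A) (c d : Stm V A)
  | loop (e : Exp V A) (c : Stm V A)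

/-- A state: variables, arrays, the rest of the input, the output so far. -/
structure St (V A : Type) where
  var : V → ℤ
  arr : A → ℤ → ℤ
  inp : List ℤ
  out : List ℤ

/-- A numbering of the names of variables and of finitely many arrays. -/
structure Names (V A : Type) where
  v : V → ℕ
  v_inj : Function.Injective v
  a : A → ℕ
  a_inj : Function.Injective a
  na : ℕ
  a_lt : ∀ x, a x < na

variable {V A : Type}

/-- The value of an expression. -/
def Exp.eval (s : St V A) : Exp V A → ℤ
  | lit k => k
  | var x => s.var x
  | get a e => s.arr a (e.eval s)
  | add e f => e.eval s + f.eval s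
  | sub e f => e.eval s - f.eval s
  | mul e f => e.eval s * f.eval s
  | div e f => e.eval s / f.eval s

/-- All variables and array entries that are looked up, and all indices, have absolute value at
most `X`, and divisors are positive. -/
def Exp.Bd (s : St V A) (X : ℕ) : Exp V A → Prop
  | lit _ => True
  | var x => -(X : ℤ) ≤ s.var x ∧ s.var x ≤ X
  | get a e => e.Bd s X ∧ (-(X : ℤ) ≤ e.eval s ∧ e.eval s ≤ X) ∧
      (-(X : ℤ) ≤ s.arr a (e.eval s) ∧ s.arr a (e.eval s) ≤ X)
  | add e f => e.Bd s X ∧ f.Bd s X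
  | sub e f => e.Bd s X ∧ f.Bd s X
  | mul e f => e.Bd s X ∧ f.Bd s X
  | div e f => e.Bd s X ∧ f.Bd s X ∧ 0 < f.eval s

/-- The size of the bound. -/
def lg (X : ℕ) : ℕ := Nat.log 2 X + 1

theorem lg_pos (X : ℕ) : 1 ≤ lg X := Nat.le_add_left _ _

theorem lg_mono {X Y : ℕ} (h : X ≤ Y) : lg X ≤ lg Y :=
  Nat.add_le_add_right (Nat.log_mono_right h) 1

theorem size_pos (z : ℤ) : 1 ≤ RAM.size z := Nat.le_add_left _ _

theorem size_le_iff {z : ℤ} {k : ℕ} (hk : 1 ≤ k) : RAM.size z ≤ k ↔ z.natAbs < 2 ^ k := by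
  unfold RAM.size
  rw [← Nat.lt_iff_add_one_le]
  exact ⟨fun h => (Nat.lt_pow_succ_log_self (by norm_num) _).trans_le
    (Nat.pow_le_pow_right (by norm_num) h), Nat.log_lt_of_lt_pow' (by omega)⟩

theorem natAbs_lt_size (z : ℤ) : z.natAbs < 2 ^ RAM.size z := (size_le_iff (size_pos z)).mp le_rfl

theorem size_le_lg {z : ℤ} {X : ℕ} (h1 : -(X : ℤ) ≤ z) (h2 : z ≤ X) : RAM.size z ≤ lg X :=
  lg_mono (by omega)

theorem pow_add_pow_le {a b : ℕ} (ha : 1 ≤ a) (hb : 1 ≤ b) : 2 ^ a + 2 ^ b ≤ 2 ^ (a + b) := by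
  have h1 : 2 ^ 1 ≤ 2 ^ a := Nat.pow_le_pow_right (by norm_num) ha
  have h2 : 2 ^ 1 ≤ 2 ^ b := Nat.pow_le_pow_right (by norm_num) hb
  rw [pow_add]
  nlinarith

theorem size_add (a b : ℤ) : RAM.size (a + b) ≤ RAM.size a + RAM.size b := by
  have ha := size_pos a
  have hb := size_pos b
  rw [size_le_iff (by omega)]
  have h1 := natAbs_lt_size a
  have h2 := natAbs_lt_size b
  have h3 := pow_add_pow_le ha hb
  have := Int.natAbs_add_le a b
  omega

theorem size_sub (a b : ℤ) : RAM.size (a - b) ≤ RAM.size a + RAM.size b := by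
  have := size_add a (-b)
  rwa [← sub_eq_add_neg, show RAM.size (-b) = RAM.size b by simp [RAM.size]] at this

theorem size_mul (a b : ℤ) : RAM.size (a * b) ≤ RAM.size a + RAM.size b := by
  have ha := size_pos a
  rw [size_le_iff (by omega), Int.natAbs_mul, pow_add]
  exact Nat.mul_lt_mul'' (natAbs_lt_size a) (natAbs_lt_size b)

theorem size_div (a b : ℤ) : RAM.size (a / b) ≤ RAM.size a :=
  lg_mono (Int.natAbs_ediv_le_natAbs a b)

/-- The size of the value of an expression is linear in the size of the bound. -/
theorem Exp.size_eval (e : Exp V A) :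
    ∃ κ, ∀ (s : St V A) (X : ℕ), e.Bd s X → RAM.size (e.eval s) ≤ κ * lg X := by
  induction e with
  | lit k =>
    refine ⟨RAM.size k, fun s X _ => ?_⟩
    exact Nat.le_mul_of_pos_right _ (lg_pos X)
  | var x => exact ⟨1, fun s X h => by rw [one_mul]; exact size_le_lg h.1 h.2⟩
  | get a e _ => exact ⟨1, fun s X h => by rw [one_mul]; exact size_le_lg h.2.2.1 h.2.2.2⟩
  | add e f he hf =>
    obtain ⟨κ₁, h₁⟩ := he
    obtain ⟨κ₂, h₂⟩ := hf
    refine ⟨κ₁ + κ₂, fun s X h => (size_add _ _).trans ?_⟩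
    rw [add_mul]; exact Nat.add_le_add (h₁ s X h.1) (h₂ s X h.2)
  | sub e f he hf =>
    obtain ⟨κ₁, h₁⟩ := he
    obtain ⟨κ₂, h₂⟩ := hf
    refine ⟨κ₁ + κ₂, fun s X h => (size_sub _ _).trans ?_⟩
    rw [add_mul]; exact Nat.add_le_add (h₁ s X h.1) (h₂ s X h.2)
  | mul e f he hf =>
    obtain ⟨κ₁, h₁⟩ := he
    obtain ⟨κ₂, h₂⟩ := hf
    refine ⟨κ₁ + κ₂, fun s X h => (size_mul _ _).trans ?_⟩
    rw [add_mul]; exact Nat.add_le_add (h₁ s X h.1) (h₂ s X h.2)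
  | div e f he hf =>
    obtain ⟨κ₁, h₁⟩ := he
    exact ⟨κ₁, fun s X h => (size_div _ _).trans (h₁ s X h.1)⟩

/-- A finite run of a program, with its cost. -/
inductive Runs (P : RAM.Program) : RAM.Cfg → RAM.Cfg → ℕ → Prop
  | refl (c : RAM.Cfg) : Runs P c c 0
  | step {c c' c'' : RAM.Cfg} {i : RAM.Instr} {w m : ℕ} (hi : P[c.pc]? = some i)
      (hc : i.exec c = some (c', w)) (h : Runs P c' c'' m) : Runs P c c'' (w + m)

theorem Runs.trans {P : RAM.Program} {c c' c'' : RAM.Cfg} {m m' : ℕ} (h : Runs P c c' m)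
    (h' : Runs P c' c'' m') : Runs P c c'' (m + m') := by
  induction h with
  | refl c => simpa using h'
  | step hi hc _ ih => rw [add_assoc]; exact Runs.step hi hc (ih h')

theorem Runs.one {P : RAM.Program} {c c' : RAM.Cfg} {i : RAM.Instr} {w : ℕ}
    (hi : P[c.pc]? = some i) (hc : i.exec c = some (c', w)) : Runs P c c' w :=
  Runs.step hi hc (Runs.refl c')

theorem Runs.halts {P : RAM.Program} {c c' : RAM.Cfg} {m : ℕ} (h : Runs P c c' m)
    (hP : P[c'.pc]? = some .halt) : RAM.HaltsWith P c c'.output (m + 1) := by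
  induction h with
  | refl c => simpa using RAM.HaltsWith.halt hP
  | step hi hc _ ih => rw [add_assoc]; exact RAM.HaltsWith.step hi hc (ih hP)

/-- The instructions `l` stand in the program `P` from line `o` on. -/
def At (P : RAM.Program) (o : ℕ) (l : List RAM.Instr) : Prop :=
  ∀ i < l.length, P[o + i]? = l[i]?

theorem At.append {P : RAM.Program} {o : ℕ} {l l' : List RAM.Instr} :
    At P o (l ++ l') ↔ At P o l ∧ At P (o + l.length) l' := by
  constructor
  · intro h
    refine ⟨fun i hi => ?_, fun i hi => ?_⟩
    · rw [h i (by simp; omega), List.getElem?_append_left hi]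
    · rw [add_assoc, h _ (by simp; omega), List.getElem?_append_right (by omega)]
      congr 1; omega
  · rintro ⟨h1, h2⟩ i hi
    by_cases hl : i < l.length
    · rw [h1 i hl, List.getElem?_append_left hl]
    · rw [List.getElem?_append_right (by omega), ← h2 _ (by simp at hi; omega)]
      congr 1; omega

theorem At.cons {P : RAM.Program} {o : ℕ} {i : RAM.Instr} {l : List RAM.Instr} :
    At P o (i :: l) ↔ P[o]? = some i ∧ At P (o + 1) l := by
  have : i :: l = [i] ++ l := rfl
  rw [this, At.append]
  refine and_congr_left' ?_
  simp [At]

variable (ν : Names V A)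

/-- The register of a temporary value. -/
def taddr (d : ℕ) : ℕ := 3 * d + 1

/-- The register of a variable. -/
def Names.vaddr (x : V) : ℕ := 3 * ν.v x + 2

/-- The register of an array entry. -/
def Names.aaddr (a : A) (p : ℤ) : ℕ := 3 * (ν.na * (p * (4 * p + 1)).toNat + ν.a a) + 3

/-- The map `p ↦ p * (4 * p + 1)` embeds the integers into the natural numbers and needs no case
distinction to compute. It allows tape arrays with negative indices, and addresses have size linear
in the size of the index. -/
theorem quad_nonneg (p : ℤ) : 0 ≤ p * (4 * p + 1) := by
  rcases le_or_gt 0 p with h | h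
  · positivity
  · nlinarith

theorem Names.vaddr_inj {x x' : V} : ν.vaddr x = ν.vaddr x' ↔ x = x' := by
  unfold Names.vaddr
  constructor
  · intro h; exact ν.v_inj (by omega)
  · rintro rfl; rfl

theorem Names.aaddr_inj {a a' : A} {p p' : ℤ} :
    ν.aaddr a p = ν.aaddr a' p' ↔ a = a' ∧ p = p' := by
  unfold Names.aaddr
  constructor
  · intro h
    have h1 : ν.na * (p * (4 * p + 1)).toNat + ν.a a = ν.na * (p' * (4 * p' + 1)).toNat + ν.a a' := by
      omega
    have h2 := congrArg (· % ν.na) h1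
    have h3 := congrArg (· / ν.na) h1
    simp only [Nat.mul_add_mod, Nat.mod_eq_of_lt (ν.a_lt _)] at h2
    have hpos : 0 < ν.na := (Nat.zero_le _).trans_lt (ν.a_lt a)
    simp only [Nat.mul_add_div hpos, Nat.div_eq_of_lt (ν.a_lt _), add_zero] at h3
    refine ⟨ν.a_inj h2, ?_⟩
    have h4 : p * (4 * p + 1) = p' * (4 * p' + 1) := by
      have := quad_nonneg p
      have := quad_nonneg p'
      omega
    -- The second factor is congruent to `1` modulo `4`, hence not zero.
    have h5 : (p - p') * (4 * (p + p') + 1) = 0 := by ring_nf; ring_nf at h4; linarith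
    rcases mul_eq_zero.mp h5 with h | h <;> omega
  · rintro ⟨rfl, rfl⟩; rfl

/-- The registers of a configuration hold a state. -/
structure Rep (s : St V A) (c : RAM.Cfg) : Prop where
  var : ∀ x, c.mem (ν.vaddr x) = s.var x
  arr : ∀ a p, c.mem (ν.aaddr a p) = s.arr a p
  inp : c.input = s.inp
  out : c.output = s.out

/-- Turns the index in the accumulator into the address of an array entry, which is also stored as
temporary value `d`. -/
def indexCode (a : A) (d : ℕ) : List RAM.Instr :=
  [.store (.direct (taddr d)), .mult (.const 4), .add (.const 1), .mult (.reg (.direct (taddr d))),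
    .mult (.const (3 * ν.na)), .add (.const (3 * ν.a a + 3)), .store (.direct (taddr d))]

/-- Code which evaluates an expression, using temporary values from `d` on. -/
def Exp.comp : Exp V A → ℕ → List RAM.Instr
  | lit k, _ => [.load (.const k)]
  | var x, _ => [.load (.reg (.direct (ν.vaddr x)))]
  | get a e, d => e.comp d ++ (indexCode ν a d ++ [.load (.reg (.indirect (taddr d)))])
  | add e f, d => f.comp d ++ (.store (.direct (taddr d)) :: (e.comp (d + 1) ++
      [.add (.reg (.direct (taddr d)))]))
  | sub e f, d => f.comp d ++ (.store (.direct (taddr d)) :: (e.comp (d + 1) ++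
      [.sub (.reg (.direct (taddr d)))]))
  | mul e f, d => f.comp d ++ (.store (.direct (taddr d)) :: (e.comp (d + 1) ++
      [.mult (.reg (.direct (taddr d)))]))
  | div e f, d => f.comp d ++ (.store (.direct (taddr d)) :: (e.comp (d + 1) ++
      [.div (.reg (.direct (taddr d)))]))

/-- The effect of code for an expression. -/
def Computes (P : RAM.Program) (s : St V A) (d : ℕ) (c : RAM.Cfg) (len B : ℕ) (z : ℤ) : Prop :=
  ∃ c' m, Runs P c c' m ∧ m ≤ B ∧ c'.pc = c.pc + len ∧ Rep ν s c' ∧ c'.mem 0 = z ∧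
    ∀ d' < d, c'.mem (taddr d') = c.mem (taddr d')

variable {ν}

theorem set_mem_of_ne {c : RAM.Cfg} {r r' : ℕ} (h : r' ≠ r) (z : ℤ) :
    (c.set r z).mem r' = c.mem r' :=
  by simp [RAM.Cfg.set, h]

theorem set_mem_self (c : RAM.Cfg) (r : ℕ) (z : ℤ) : (c.set r z).mem r = z := by
  simp [RAM.Cfg.set]

theorem Rep.set_acc {s : St V A} {c : RAM.Cfg} (h : Rep ν s c) (z : ℤ) : Rep ν s (c.set 0 z) := by
  refine ⟨fun x => ?_, fun a p => ?_, h.inp, h.out⟩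
  · rw [← h.var x]; exact set_mem_of_ne (by simp [Names.vaddr]) _
  · rw [← h.arr a p]; exact set_mem_of_ne (by simp [Names.aaddr]) _

theorem Rep.set_temp {s : St V A} {c : RAM.Cfg} (h : Rep ν s c) (d : ℕ) (z : ℤ) :
    Rep ν s (c.set (taddr d) z) := by
  refine ⟨fun x => ?_, fun a p => ?_, h.inp, h.out⟩
  · rw [← h.var x]; exact set_mem_of_ne (by simp [Names.vaddr, taddr]; omega) _
  · rw [← h.arr a p]; exact set_mem_of_ne (by simp [Names.aaddr, taddr]; omega) _

/-- The right operand is computed first and parked in register `taddr d`; the left one then ends up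
in the accumulator, as subtraction and division require. It may use only temporary registers from `d
+ 1` on, so the parked value survives. -/
theorem Computes.binary {P : RAM.Program} {s : St V A} {d : ℕ} {c : RAM.Cfg} {lf le Bf Be L : ℕ}
    {zf ze z : ℤ} {op : RAM.Instr} {κ₁ κ₂ : ℕ}
    (hf : Computes ν P s d c lf Bf zf)
    (hst : P[c.pc + lf]? = some (.store (.direct (taddr d))))
    (he : ∀ c', c'.pc = c.pc + lf + 1 → Rep ν s c' → Computes ν P s (d + 1) c' le Be ze)
    (hop : P[c.pc + lf + 1 + le]? = some op)
    (hzf : RAM.size zf ≤ κ₁ * L) (hze : RAM.size ze ≤ κ₂ * L) (hL : 1 ≤ L)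
    (hex : ∀ c' : RAM.Cfg, c'.mem (taddr d) = zf → c'.mem 0 = ze →
      op.exec c' = some (c'.set 0 z, RAM.size ze + (RAM.size (taddr d) + RAM.size zf))) :
    Computes ν P s d c (lf + (1 + (le + 1)))
      (Bf + Be + (2 * κ₁ + κ₂ + 2 * RAM.size (taddr d)) * L) z := by
  obtain ⟨c1, m1, hr1, hm1, hpc1, hrep1, hacc1, htmp1⟩ := hf
  have hr2 : Runs P c1 (c1.set (taddr d) (c1.mem 0)) (RAM.size (c1.mem 0) + RAM.size (taddr d)) :=
    Runs.one (by rw [hpc1]; exact hst) rfl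
  obtain ⟨c3, m3, hr3, hm3, hpc3, hrep3, hacc3, htmp3⟩ :=
    he (c1.set (taddr d) (c1.mem 0)) (by simp [RAM.Cfg.set, hpc1]) (hrep1.set_temp d _)
  have ht : c3.mem (taddr d) = zf := by
    rw [htmp3 d (by omega), ← hacc1]; simp [RAM.Cfg.set]
  have hr4 := Runs.one (P := P) (c := c3) (by
    rw [hpc3, show (c1.set (taddr d) (c1.mem 0)).pc = c.pc + lf + 1 by simp [RAM.Cfg.set, hpc1]]
    exact hop) (hex c3 ht hacc3)
  refine ⟨_, _, ((hr1.trans hr2).trans hr3).trans hr4, ?_, ?_, hrep3.set_acc z, ?_, ?_⟩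
  · rw [hacc1]
    have : RAM.size (taddr d) ≤ RAM.size (taddr d) * L := Nat.le_mul_of_pos_right _ hL
    nlinarith
  · simp [RAM.Cfg.set, hpc3, hpc1]; omega
  · simp [RAM.Cfg.set]
  · intro d' hd'
    have e1 : (c3.set 0 z).mem (taddr d') = c3.mem (taddr d') :=
      set_mem_of_ne (by simp [taddr]) _
    have e2 : (c1.set (taddr d) (c1.mem 0)).mem (taddr d') = c1.mem (taddr d') :=
      set_mem_of_ne (by simp [taddr]; omega) _
    rw [e1, htmp3 d' (by omega), e2, htmp1 d' hd']

/-- Besides the constants of the code, every intermediate value is a product of at most two copies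
of `p`, so each of the seven instructions costs a constant multiple of `L`. The constants `20` and
`100` are generous. -/
theorem Computes.index {P : RAM.Program} {s : St V A} {d : ℕ} {c : RAM.Cfg} {le Be L : ℕ}
    {p : ℤ} {a : A} {κ₁ : ℕ} (he : Computes ν P s d c le Be p)
    (hP : At P (c.pc + le) (indexCode ν a d)) (hp : RAM.size p ≤ κ₁ * L) (hL : 1 ≤ L) :
    ∃ c' m, Runs P c c' m ∧
      m ≤ Be + (20 * κ₁ + 100 + 20 * RAM.size (taddr d) + 20 * RAM.size (3 * ν.na) +
        20 * RAM.size (3 * ν.a a + 3)) * L ∧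
      c'.pc = c.pc + (le + 7) ∧ Rep ν s c' ∧ c'.mem 0 = ν.aaddr a p ∧
      c'.mem (taddr d) = ν.aaddr a p ∧
      ∀ d' < d, c'.mem (taddr d') = c.mem (taddr d') := by
  obtain ⟨c1, m1, hr1, hm1, hpc1, hrep1, hacc1, htmp1⟩ := he
  simp only [indexCode, At.cons] at hP
  obtain ⟨h1, h2, h3, h4, h5, h6, h7, -⟩ := hP
  have t0 : taddr d ≠ 0 := by simp [taddr]
  have r1 : Runs P c1 (c1.set (taddr d) p) (RAM.size p + RAM.size (taddr d)) :=
    Runs.one (by rw [hpc1]; exact h1) (by simp [RAM.Instr.exec, RAM.Addr.eval, hacc1])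
  set c2 := c1.set (taddr d) p with hc2
  have a2 : c2.mem 0 = p := by
    rw [hc2, ← hacc1]; exact set_mem_of_ne t0.symm _
  have b2 : c2.mem (taddr d) = p := by simp [hc2, RAM.Cfg.set]
  have p2 : c2.pc = c.pc + le + 1 := by simp [hc2, RAM.Cfg.set, hpc1]
  have r2 : Runs P c2 (c2.set 0 (p * 4)) (RAM.size p + RAM.size 4) :=
    Runs.one (by rw [p2]; exact h2) (by simp [RAM.Instr.exec, RAM.Operand.eval, a2])
  set c3 := c2.set 0 (p * 4) with hc3
  have a3 : c3.mem 0 = p * 4 := by simp [hc3, RAM.Cfg.set]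
  have b3 : c3.mem (taddr d) = p := by rw [← b2]; exact set_mem_of_ne t0 _
  have p3 : c3.pc = c.pc + le + 1 + 1 := by simp [hc3, RAM.Cfg.set, p2]
  have r3 : Runs P c3 (c3.set 0 (p * 4 + 1)) (RAM.size (p * 4) + RAM.size 1) :=
    Runs.one (by rw [p3]; exact h3) (by simp [RAM.Instr.exec, RAM.Operand.eval, a3])
  set c4 := c3.set 0 (p * 4 + 1) with hc4
  have a4 : c4.mem 0 = p * 4 + 1 := by simp [hc4, RAM.Cfg.set]
  have b4 : c4.mem (taddr d) = p := by rw [← b3]; exact set_mem_of_ne t0 _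
  have p4 : c4.pc = c.pc + le + 1 + 1 + 1 := by simp [hc4, RAM.Cfg.set, p3]
  have r4 : Runs P c4 (c4.set 0 ((p * 4 + 1) * p))
      (RAM.size (p * 4 + 1) + (RAM.size (taddr d) + RAM.size p)) :=
    Runs.one (by rw [p4]; exact h4)
      (by simp [RAM.Instr.exec, RAM.Operand.eval, RAM.Addr.eval, a4, b4])
  set c5 := c4.set 0 ((p * 4 + 1) * p) with hc5
  have a5 : c5.mem 0 = (p * 4 + 1) * p := by simp [hc5, RAM.Cfg.set]
  have p5 : c5.pc = c.pc + le + 1 + 1 + 1 + 1 := by simp [hc5, RAM.Cfg.set, p4]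
  have r5 : Runs P c5 (c5.set 0 ((p * 4 + 1) * p * (3 * ν.na)))
      (RAM.size ((p * 4 + 1) * p) + RAM.size (3 * ν.na)) :=
    Runs.one (by rw [p5]; exact h5) (by simp [RAM.Instr.exec, RAM.Operand.eval, a5])
  set c6 := c5.set 0 ((p * 4 + 1) * p * (3 * ν.na)) with hc6
  have a6 : c6.mem 0 = (p * 4 + 1) * p * (3 * ν.na) := by simp [hc6, RAM.Cfg.set]
  have p6 : c6.pc = c.pc + le + 1 + 1 + 1 + 1 + 1 := by simp [hc6, RAM.Cfg.set, p5]
  have hz : (ν.aaddr a p : ℤ) = (p * 4 + 1) * p * (3 * ν.na) + (3 * ν.a a + 3) := by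
    have := quad_nonneg p
    unfold Names.aaddr
    push_cast
    rw [Int.toNat_of_nonneg this]
    ring
  have r6 : Runs P c6 (c6.set 0 (ν.aaddr a p))
      (RAM.size ((p * 4 + 1) * p * (3 * ν.na)) + RAM.size (3 * ν.a a + 3)) :=
    Runs.one (by rw [p6]; exact h6) (by simp [RAM.Instr.exec, RAM.Operand.eval, a6, hz])
  set c7 := c6.set 0 (ν.aaddr a p) with hc7
  have a7 : c7.mem 0 = ν.aaddr a p := by simp [hc7, RAM.Cfg.set]
  have p7 : c7.pc = c.pc + le + 1 + 1 + 1 + 1 + 1 + 1 := by simp [hc7, RAM.Cfg.set, p6]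
  have r7 : Runs P c7 (c7.set (taddr d) (ν.aaddr a p))
      (RAM.size (ν.aaddr a p) + RAM.size (taddr d)) :=
    Runs.one (by rw [p7]; exact h7) (by simp [RAM.Instr.exec, RAM.Addr.eval, a7])
  refine ⟨_, _, ((((((hr1.trans r1).trans r2).trans r3).trans r4).trans r5).trans r6).trans r7,
    ?_, ?_, ?_, ?_, ?_, ?_⟩
  · have s4 : RAM.size 4 = 3 := by decide
    have s1 : RAM.size 1 = 1 := by decide
    have e1 := size_mul p 4
    have e2 := size_add (p * 4) 1
    have e3 := size_mul (p * 4 + 1) p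
    have e4 := size_mul ((p * 4 + 1) * p) (3 * ν.na)
    have e5 := size_add ((p * 4 + 1) * p * (3 * ν.na)) (3 * ν.a a + 3)
    rw [← hz] at e5
    have f1 : RAM.size (taddr d) ≤ RAM.size (taddr d) * L := Nat.le_mul_of_pos_right _ hL
    have f2 : RAM.size (3 * ν.na) ≤ RAM.size (3 * ν.na) * L := Nat.le_mul_of_pos_right _ hL
    have f3 : RAM.size (3 * ν.a a + 3) ≤ RAM.size (3 * ν.a a + 3) * L :=
      Nat.le_mul_of_pos_right _ hL
    have : (20 * κ₁ + 100 + 20 * RAM.size (taddr d) + 20 * RAM.size (3 * ν.na) +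
        20 * RAM.size (3 * ν.a a + 3)) * L = 20 * (κ₁ * L) + 100 * L +
        20 * (RAM.size (taddr d) * L) + 20 * (RAM.size (3 * ν.na) * L) +
        20 * (RAM.size (3 * ν.a a + 3) * L) := by ring
    rw [this]
    omega
  · simp [RAM.Cfg.set, p7]; omega
  · exact ((((((hrep1.set_temp _ _).set_acc _).set_acc _).set_acc _).set_acc _).set_acc _).set_temp _ _
  · rw [← a7]; exact set_mem_of_ne t0.symm _
  · simp [RAM.Cfg.set]
  · intro d' hd'
    have hne : taddr d' ≠ taddr d := by simp [taddr]; omega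
    have hne0 : taddr d' ≠ 0 := by simp [taddr]
    rw [← htmp1 d' hd']
    simp [hc7, hc6, hc5, hc4, hc3, hc2, RAM.Cfg.set, hne, hne0]

end While

/-! ### Statements: compilation and cost -/

namespace While

variable {V A : Type} {ν : Names V A}

theorem size_aaddr (a : A) (p : ℤ) : RAM.size (ν.aaddr a p) ≤
    2 * RAM.size p + 4 + RAM.size (3 * ν.na) + RAM.size (3 * ν.a a + 3) := by
  have hz : (ν.aaddr a p : ℤ) = (p * 4 + 1) * p * (3 * ν.na) + (3 * ν.a a + 3) := by
    have := quad_nonneg p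
    unfold Names.aaddr
    push_cast
    rw [Int.toNat_of_nonneg this]
    ring
  have s4 : RAM.size 4 = 3 := by decide
  have s1 : RAM.size 1 = 1 := by decide
  have e1 := size_mul p 4
  have e2 := size_add (p * 4) 1
  have e3 := size_mul (p * 4 + 1) p
  have e4 := size_mul ((p * 4 + 1) * p) (3 * ν.na)
  have e5 := size_add ((p * 4 + 1) * p * (3 * ν.na)) (3 * ν.a a + 3)
  rw [← hz] at e5
  omega

theorem Computes.mono {P : RAM.Program} {s : St V A} {d : ℕ} {c : RAM.Cfg} {len B B' : ℕ} {z : ℤ}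
    (h : Computes ν P s d c len B z) (hB : B ≤ B') : Computes ν P s d c len B' z := by
  obtain ⟨c', m, h1, h2, h3⟩ := h
  exact ⟨c', m, h1, h2.trans hB, h3⟩

/-- The code of an expression computes its value at a cost linear in the size of the bound. -/
theorem Exp.computes (e : Exp V A) : ∀ d, ∃ κ, ∀ (P : RAM.Program) (s : St V A) (c : RAM.Cfg)
    (X : ℕ), e.Bd s X → Rep ν s c → At P c.pc (e.comp ν d) →
    Computes ν P s d c (e.comp ν d).length (κ * lg X) (e.eval s) := by
  induction e with
  | lit k =>
    refine fun d => ⟨RAM.size k, fun P s c X _ hrep hP => ?_⟩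
    simp only [Exp.comp, At.cons] at hP
    refine ⟨c.set 0 k, _, Runs.one hP.1 rfl, Nat.le_mul_of_pos_right _ (lg_pos X), rfl,
      hrep.set_acc k, set_mem_self _ _ _, fun d' _ => set_mem_of_ne (by simp [taddr]) _⟩
  | var x =>
    refine fun d => ⟨RAM.size (ν.vaddr x) + 1, fun P s c X hB hrep hP => ?_⟩
    simp only [Exp.comp, At.cons] at hP
    refine ⟨c.set 0 (s.var x), RAM.size (ν.vaddr x) + RAM.size (s.var x), Runs.one hP.1 ?_, ?_, rfl,
      hrep.set_acc _, set_mem_self _ _ _, fun d' _ => set_mem_of_ne (by simp [taddr]) _⟩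
    · simp [RAM.Instr.exec, RAM.Operand.eval, RAM.Addr.eval, hrep.var x]
    · have h1 := size_le_lg hB.1 hB.2
      have h2 : RAM.size (ν.vaddr x) ≤ RAM.size (ν.vaddr x) * lg X :=
        Nat.le_mul_of_pos_right _ (lg_pos X)
      rw [add_mul]; omega
  | get a e ih =>
    intro d
    obtain ⟨κ, hκ⟩ := ih d
    refine ⟨κ + (20 * 1 + 100 + 20 * RAM.size (taddr d) + 20 * RAM.size (3 * ν.na) +
        20 * RAM.size (3 * ν.a a + 3)) + (7 + RAM.size (taddr d) + RAM.size (3 * ν.na) +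
        RAM.size (3 * ν.a a + 3)), fun P s c X hB hrep hP => ?_⟩
    obtain ⟨hB1, hB2, hB3⟩ := hB
    simp only [Exp.comp, At.append] at hP
    obtain ⟨hP1, hP2, hP3⟩ := hP
    have hsz := size_le_lg hB2.1 hB2.2
    obtain ⟨c1, m1, hr1, hm1, hpc1, hrep1, hacc1, ht1, htmp1⟩ :=
      (hκ P s c X hB1 hrep hP1).index hP2 (κ₁ := 1) (by rwa [one_mul]) (lg_pos X)
    rw [At.cons] at hP3
    have hlast : Runs P c1 (c1.set 0 (s.arr a (e.eval s)))
        (RAM.size (taddr d) + RAM.size (ν.aaddr a (e.eval s)) + RAM.size (s.arr a (e.eval s))) := by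
      refine Runs.one (by rw [hpc1, ← add_assoc]; exact hP3.1) ?_
      simp [RAM.Instr.exec, RAM.Operand.eval, RAM.Addr.eval, ht1, hrep1.arr]
    refine ⟨_, _, hr1.trans hlast, ?_, ?_, hrep1.set_acc _, set_mem_self _ _ _, fun d' hd' => ?_⟩
    · have h1 := size_le_lg hB3.1 hB3.2
      have h2 := size_aaddr (ν := ν) a (e.eval s)
      have h3 := lg_pos X
      have f1 : RAM.size (taddr d) ≤ RAM.size (taddr d) * lg X := Nat.le_mul_of_pos_right _ h3
      have f2 : RAM.size (3 * ν.na) ≤ RAM.size (3 * ν.na) * lg X := Nat.le_mul_of_pos_right _ h3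
      have f3 : RAM.size (3 * ν.a a + 3) ≤ RAM.size (3 * ν.a a + 3) * lg X :=
        Nat.le_mul_of_pos_right _ h3
      have : (7 + RAM.size (taddr d) + RAM.size (3 * ν.na) + RAM.size (3 * ν.a a + 3)) * lg X =
        7 * lg X + RAM.size (taddr d) * lg X + RAM.size (3 * ν.na) * lg X +
        RAM.size (3 * ν.a a + 3) * lg X := by ring
      rw [add_mul _ (7 + _ + _ + _), this, add_mul κ]
      omega
    · simp [RAM.Cfg.set, hpc1, Exp.comp, indexCode]
      omega
    · rw [set_mem_of_ne (by simp [taddr]), htmp1 d' hd']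
  | add e f he hf =>
    intro d
    obtain ⟨κe, he⟩ := he (d + 1)
    obtain ⟨κf, hf⟩ := hf d
    obtain ⟨σe, hσe⟩ := e.size_eval
    obtain ⟨σf, hσf⟩ := f.size_eval
    refine ⟨κf + κe + (2 * σf + σe + 2 * RAM.size (taddr d)), fun P s c X hB hrep hP => ?_⟩
    simp only [Exp.comp, At.append, At.cons] at hP
    obtain ⟨hP1, hP2, hP3, hP4, -⟩ := hP
    have := Computes.binary (ν := ν) (L := lg X) (z := (Exp.add e f).eval s)
      (hf P s c X hB.2 hrep hP1) hP2
      (fun c' hpc hr => he P s c' X hB.1 hr (by rw [hpc]; exact hP3)) hP4 (hσf s X hB.2)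
      (hσe s X hB.1) (lg_pos X)
      (fun c' h1 h2 => by simp [RAM.Instr.exec, RAM.Operand.eval, RAM.Addr.eval, h1, h2, Exp.eval])
    have hl : ((Exp.add e f).comp ν d).length =
        (f.comp ν d).length + (1 + ((e.comp ν (d + 1)).length + 1)) := by
      simp [Exp.comp]; omega
    rw [hl]
    exact this.mono (le_of_eq (by ring))
  | sub e f he hf =>
    intro d
    obtain ⟨κe, he⟩ := he (d + 1)
    obtain ⟨κf, hf⟩ := hf d
    obtain ⟨σe, hσe⟩ := e.size_eval
    obtain ⟨σf, hσf⟩ := f.size_eval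
    refine ⟨κf + κe + (2 * σf + σe + 2 * RAM.size (taddr d)), fun P s c X hB hrep hP => ?_⟩
    simp only [Exp.comp, At.append, At.cons] at hP
    obtain ⟨hP1, hP2, hP3, hP4, -⟩ := hP
    have := Computes.binary (ν := ν) (L := lg X) (z := (Exp.sub e f).eval s)
      (hf P s c X hB.2 hrep hP1) hP2
      (fun c' hpc hr => he P s c' X hB.1 hr (by rw [hpc]; exact hP3)) hP4 (hσf s X hB.2)
      (hσe s X hB.1) (lg_pos X)
      (fun c' h1 h2 => by simp [RAM.Instr.exec, RAM.Operand.eval, RAM.Addr.eval, h1, h2, Exp.eval])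
    have hl : ((Exp.sub e f).comp ν d).length =
        (f.comp ν d).length + (1 + ((e.comp ν (d + 1)).length + 1)) := by
      simp [Exp.comp]; omega
    rw [hl]
    exact this.mono (le_of_eq (by ring))
  | mul e f he hf =>
    intro d
    obtain ⟨κe, he⟩ := he (d + 1)
    obtain ⟨κf, hf⟩ := hf d
    obtain ⟨σe, hσe⟩ := e.size_eval
    obtain ⟨σf, hσf⟩ := f.size_eval
    refine ⟨κf + κe + (2 * σf + σe + 2 * RAM.size (taddr d)), fun P s c X hB hrep hP => ?_⟩
    simp only [Exp.comp, At.append, At.cons] at hP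
    obtain ⟨hP1, hP2, hP3, hP4, -⟩ := hP
    have := Computes.binary (ν := ν) (L := lg X) (z := (Exp.mul e f).eval s)
      (hf P s c X hB.2 hrep hP1) hP2
      (fun c' hpc hr => he P s c' X hB.1 hr (by rw [hpc]; exact hP3)) hP4 (hσf s X hB.2)
      (hσe s X hB.1) (lg_pos X)
      (fun c' h1 h2 => by simp [RAM.Instr.exec, RAM.Operand.eval, RAM.Addr.eval, h1, h2, Exp.eval])
    have hl : ((Exp.mul e f).comp ν d).length =
        (f.comp ν d).length + (1 + ((e.comp ν (d + 1)).length + 1)) := by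
      simp [Exp.comp]; omega
    rw [hl]
    exact this.mono (le_of_eq (by ring))
  | div e f he hf =>
    intro d
    obtain ⟨κe, he⟩ := he (d + 1)
    obtain ⟨κf, hf⟩ := hf d
    obtain ⟨σe, hσe⟩ := e.size_eval
    obtain ⟨σf, hσf⟩ := f.size_eval
    refine ⟨κf + κe + (2 * σf + σe + 2 * RAM.size (taddr d)), fun P s c X hB hrep hP => ?_⟩
    simp only [Exp.comp, At.append, At.cons] at hP
    obtain ⟨hP1, hP2, hP3, hP4, -⟩ := hP
    have := Computes.binary (ν := ν) (L := lg X) (z := (Exp.div e f).eval s)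
      (hf P s c X hB.2.1 hrep hP1) hP2
      (fun c' hpc hr => he P s c' X hB.1 hr (by rw [hpc]; exact hP3)) hP4 (hσf s X hB.2.1)
      (hσe s X hB.1) (lg_pos X)
      -- The machine divides with rounding towards minus infinity; this agrees with `/` on integers
      -- because `Exp.Bd` asks for positive divisors.
      (fun c' h1 h2 => by
        simp [RAM.Instr.exec, RAM.Operand.eval, RAM.Addr.eval, h1, h2, Exp.eval, hB.2.2.ne',
          Int.fdiv_eq_ediv_of_nonneg _ hB.2.2.le])
    have hl : ((Exp.div e f).comp ν d).length =
        (f.comp ν d).length + (1 + ((e.comp ν (d + 1)).length + 1)) := by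
      simp [Exp.comp]; omega
    rw [hl]
    exact this.mono (le_of_eq (by ring))

variable (ν)

/-- The number of instructions of a statement. -/
def Stm.len : Stm V A → ℕ
  | skip => 0
  | set _ e => (e.comp ν 0).length + 1
  | put _ e f => (e.comp ν 0).length + 7 + (f.comp ν 1).length + 1
  | read _ => 1
  | emit e => (e.comp ν 0).length + 2
  | seq c d => c.len + d.len
  | ite e c d => (e.comp ν 0).length + 1 + d.len + 1 + c.len
  | loop e c => (e.comp ν 0).length + 2 + c.len + 1

/-- The code of a statement, starting in line `o`. -/
def Stm.comp : Stm V A → ℕ → List RAM.Instr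
  | skip, _ => []
  | set x e, _ => e.comp ν 0 ++ [.store (.direct (ν.vaddr x))]
  | put a e f, _ => e.comp ν 0 ++ (indexCode ν a 0 ++ (f.comp ν 1 ++
      [.store (.indirect (taddr 0))]))
  | read x, _ => [.read (.direct (ν.vaddr x))]
  | emit e, _ => e.comp ν 0 ++ [.store (.direct (taddr 0)), .write (.reg (.direct (taddr 0)))]
  | seq c d, o => c.comp o ++ d.comp (o + c.len ν)
  | ite e c d, o => e.comp ν 0 ++ (.jgtz (o + (e.comp ν 0).length + 1 + d.len ν + 1) ::
      (d.comp (o + (e.comp ν 0).length + 1) ++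
      (.jump (o + (e.comp ν 0).length + 1 + d.len ν + 1 + c.len ν) ::
      c.comp (o + (e.comp ν 0).length + 1 + d.len ν + 1))))
  | loop e c, o => e.comp ν 0 ++ (.jgtz (o + (e.comp ν 0).length + 2) ::
      .jump (o + (e.comp ν 0).length + 2 + c.len ν + 1) ::
      (c.comp (o + (e.comp ν 0).length + 2) ++ [.jump o]))

theorem Stm.comp_length (c : Stm V A) : ∀ o, (c.comp ν o).length = c.len ν := by
  induction c with
  | skip => intro o; rfl
  | set x e => intro o; simp [Stm.comp, Stm.len]
  | put a e f => intro o; simp [Stm.comp, Stm.len, indexCode]; omega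
  | read x => intro o; rfl
  | emit e => intro o; simp [Stm.comp, Stm.len]
  | seq c d hc hd => intro o; simp [Stm.comp, Stm.len, hc, hd]
  | ite e c d hc hd => intro o; simp [Stm.comp, Stm.len, hc, hd]; omega
  | loop e c hc => intro o; simp [Stm.comp, Stm.len, hc]; omega

/-- The code of `c` takes the state `s` to the state `s'` at cost at most `B`. -/
def Does (c : Stm V A) (s s' : St V A) (B : ℕ) : Prop :=
  ∀ (P : RAM.Program) (cf : RAM.Cfg), Rep ν s cf → At P cf.pc (c.comp ν cf.pc) →
    ∃ cf' m, Runs P cf cf' m ∧ m ≤ B ∧ cf'.pc = cf.pc + c.len ν ∧ Rep ν s' cf'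

variable {ν}

theorem Does.mono {c : Stm V A} {s s' : St V A} {B B' : ℕ} (h : Does ν c s s' B) (hB : B ≤ B') :
    Does ν c s s' B' := by
  intro P cf hr hP
  obtain ⟨cf', m, h1, h2, h3⟩ := h P cf hr hP
  exact ⟨cf', m, h1, h2.trans hB, h3⟩

theorem Does.skip (s : St V A) : Does ν .skip s s 0 := by
  intro P cf hr _
  exact ⟨cf, 0, Runs.refl cf, le_rfl, rfl, hr⟩

theorem Does.seq {c d : Stm V A} {s s' s'' : St V A} {B B' : ℕ} (h : Does ν c s s' B)
    (h' : Does ν d s' s'' B') : Does ν (.seq c d) s s'' (B + B') := by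
  intro P cf hr hP
  simp only [Stm.comp, At.append, Stm.comp_length] at hP
  obtain ⟨c1, m1, hr1, hm1, hpc1, hrep1⟩ := h P cf hr hP.1
  obtain ⟨c2, m2, hr2, hm2, hpc2, hrep2⟩ := h' P c1 hrep1 (by rw [hpc1]; exact hP.2)
  exact ⟨c2, _, hr1.trans hr2, Nat.add_le_add hm1 hm2, by rw [hpc2, hpc1, Stm.len]; omega, hrep2⟩

theorem Rep.set_var [DecidableEq V] {s : St V A} {c : RAM.Cfg} (h : Rep ν s c) (x : V) (z : ℤ) :
    Rep ν { s with var := Function.update s.var x z } (c.set (ν.vaddr x) z) := by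
  refine ⟨fun x' => ?_, fun a p => ?_, h.inp, h.out⟩
  · by_cases hx : x' = x
    · subst hx; simp [set_mem_self]
    · rw [set_mem_of_ne (by rwa [Ne, ν.vaddr_inj]), h.var x']; simp [hx]
  · rw [← h.arr a p]; exact set_mem_of_ne (by simp [Names.aaddr, Names.vaddr]; omega) _

theorem Rep.set_arr [DecidableEq A] {s : St V A} {c : RAM.Cfg} (h : Rep ν s c) (a : A) (p z : ℤ) :
    Rep ν { s with arr := Function.update s.arr a (Function.update (s.arr a) p z) }
      (c.set (ν.aaddr a p) z) := by
  refine ⟨fun x => ?_, fun a' p' => ?_, h.inp, h.out⟩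
  · rw [← h.var x]; exact set_mem_of_ne (by simp [Names.aaddr, Names.vaddr]; omega) _
  · by_cases hx : a' = a ∧ p' = p
    · obtain ⟨rfl, rfl⟩ := hx; simp [set_mem_self]
    · rw [set_mem_of_ne (by rwa [Ne, ν.aaddr_inj]), h.arr a' p']
      by_cases ha : a' = a
      · subst ha
        have : p' ≠ p := fun h => hx ⟨rfl, h⟩
        simp [this]
      · simp [ha]

theorem Does.set [DecidableEq V] (x : V) (e : Exp V A) : ∃ κ, ∀ (s : St V A) (X : ℕ), e.Bd s X →
    Does ν (.set x e) s { s with var := Function.update s.var x (e.eval s) } (κ * lg X) := by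
  obtain ⟨κ, hκ⟩ := e.computes (ν := ν) 0
  obtain ⟨σ, hσ⟩ := e.size_eval
  refine ⟨κ + (σ + RAM.size (ν.vaddr x)), fun s X hB P cf hr hP => ?_⟩
  simp only [Stm.comp, At.append, At.cons] at hP
  obtain ⟨c1, m1, hr1, hm1, hpc1, hrep1, hacc1, -⟩ := hκ P s cf X hB hr hP.1
  have hlast : Runs P c1 (c1.set (ν.vaddr x) (e.eval s))
      (RAM.size (e.eval s) + RAM.size (ν.vaddr x)) :=
    Runs.one (by rw [hpc1]; exact hP.2.1) (by simp [RAM.Instr.exec, RAM.Addr.eval, hacc1])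
  refine ⟨_, _, hr1.trans hlast, ?_, ?_, hrep1.set_var x _⟩
  · have h1 := hσ s X hB
    have f1 : RAM.size (ν.vaddr x) ≤ RAM.size (ν.vaddr x) * lg X :=
      Nat.le_mul_of_pos_right _ (lg_pos X)
    rw [add_mul, add_mul]; omega
  · simp [RAM.Cfg.set, hpc1, Stm.len]; omega

theorem Does.put [DecidableEq A] (a : A) (e f : Exp V A) : ∃ κ, ∀ (s : St V A) (X : ℕ),
    e.Bd s X → f.Bd s X →
    Does ν (.put a e f) s
      { s with arr := Function.update s.arr a (Function.update (s.arr a) (e.eval s) (f.eval s)) }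
      (κ * lg X) := by
  obtain ⟨κ, hκ⟩ := e.computes (ν := ν) 0
  obtain ⟨σ, hσ⟩ := e.size_eval
  obtain ⟨κ', hκ'⟩ := f.computes (ν := ν) 1
  obtain ⟨σ', hσ'⟩ := f.size_eval
  refine ⟨κ + (20 * σ + 100 + 20 * RAM.size (taddr 0) + 20 * RAM.size (3 * ν.na) +
        20 * RAM.size (3 * ν.a a + 3)) + κ' + (σ' + 2 * σ + 4 + RAM.size (taddr 0) +
        RAM.size (3 * ν.na) + RAM.size (3 * ν.a a + 3)), fun s X hB hB' P cf hr hP => ?_⟩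
  simp only [Stm.comp, At.append, At.cons] at hP
  obtain ⟨hP1, hP2, hP3, hP4, -⟩ := hP
  obtain ⟨c1, m1, hr1, hm1, hpc1, hrep1, hacc1, ht1, -⟩ :=
    (hκ P s cf X hB hr hP1).index hP2 (κ₁ := σ) (hσ s X hB) (lg_pos X)
  have hpc1' : c1.pc = cf.pc + (e.comp ν 0).length + (indexCode ν a 0).length := by
    rw [hpc1]; simp [indexCode]; omega
  obtain ⟨c2, m2, hr2, hm2, hpc2, hrep2, hacc2, ht2⟩ :=
    hκ' P s c1 X hB' hrep1 (by rw [hpc1']; exact hP3)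
  have ht : c2.mem (taddr 0) = ν.aaddr a (e.eval s) := by rw [ht2 0 (by omega), ht1]
  have hlast : Runs P c2 (c2.set (ν.aaddr a (e.eval s)) (f.eval s))
      (RAM.size (f.eval s) + (RAM.size (taddr 0) + RAM.size (ν.aaddr a (e.eval s)))) :=
    Runs.one (by rw [hpc2, hpc1']; exact hP4)
      (by simp [RAM.Instr.exec, RAM.Addr.eval, hacc2, ht])
  refine ⟨_, _, (hr1.trans hr2).trans hlast, ?_, ?_, hrep2.set_arr a _ _⟩
  · have h1 := hσ s X hB
    have h1' := hσ' s X hB'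
    have h2 := size_aaddr (ν := ν) a (e.eval s)
    have h3 := lg_pos X
    have f1 : RAM.size (taddr 0) ≤ RAM.size (taddr 0) * lg X := Nat.le_mul_of_pos_right _ h3
    have f2 : RAM.size (3 * ν.na) ≤ RAM.size (3 * ν.na) * lg X := Nat.le_mul_of_pos_right _ h3
    have f3 : RAM.size (3 * ν.a a + 3) ≤ RAM.size (3 * ν.a a + 3) * lg X :=
      Nat.le_mul_of_pos_right _ h3
    have : (σ' + 2 * σ + 4 + RAM.size (taddr 0) + RAM.size (3 * ν.na) +
        RAM.size (3 * ν.a a + 3)) * lg X =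
      σ' * lg X + 2 * (σ * lg X) + 4 * lg X + RAM.size (taddr 0) * lg X +
        RAM.size (3 * ν.na) * lg X + RAM.size (3 * ν.a a + 3) * lg X := by ring
    rw [add_mul _ (σ' + _ + _ + _ + _ + _), this, add_mul _ κ', add_mul κ]
    omega
  · simp [RAM.Cfg.set, hpc2, hpc1, Stm.len]; omega

theorem Does.read [DecidableEq V] (x : V) : ∃ κ, ∀ (s : St V A) (X : ℕ),
    -(X : ℤ) ≤ s.inp.headD 0 → s.inp.headD 0 ≤ X →
    Does ν (.read x) s { s with var := Function.update s.var x (s.inp.headD 0), inp := s.inp.tail }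
      (κ * lg X) := by
  refine ⟨1 + RAM.size (ν.vaddr x), fun s X h1 h2 P cf hr hP => ?_⟩
  simp only [Stm.comp, At.cons] at hP
  have hrep := hr.set_var x (s.inp.headD 0)
  refine ⟨_, RAM.size (s.inp.headD 0) + RAM.size (ν.vaddr x), Runs.one (c' :=
    { cf.set (ν.vaddr x) (s.inp.headD 0) with input := cf.input.tail }) hP.1 ?_, ?_, ?_, ?_⟩
  · simp [RAM.Instr.exec, RAM.Addr.eval, hr.inp]
  · have := size_le_lg h1 h2
    have f1 : RAM.size (ν.vaddr x) ≤ RAM.size (ν.vaddr x) * lg X :=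
      Nat.le_mul_of_pos_right _ (lg_pos X)
    rw [add_mul]; omega
  · simp [RAM.Cfg.set, Stm.len]
  · exact ⟨hrep.var, hrep.arr, by simp [hr.inp], hrep.out⟩

theorem Does.emit (e : Exp V A) : ∃ κ, ∀ (s : St V A) (X : ℕ), e.Bd s X →
    Does ν (.emit e) s { s with out := s.out ++ [e.eval s] } (κ * lg X) := by
  obtain ⟨κ, hκ⟩ := e.computes (ν := ν) 0
  obtain ⟨σ, hσ⟩ := e.size_eval
  refine ⟨κ + (2 * σ + 2 * RAM.size (taddr 0)), fun s X hB P cf hr hP => ?_⟩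
  simp only [Stm.comp, At.append, At.cons] at hP
  obtain ⟨c1, m1, hr1, hm1, hpc1, hrep1, hacc1, -⟩ := hκ P s cf X hB hr hP.1
  have h2 : Runs P c1 (c1.set (taddr 0) (e.eval s)) (RAM.size (e.eval s) + RAM.size (taddr 0)) :=
    Runs.one (by rw [hpc1]; exact hP.2.1) (by simp [RAM.Instr.exec, RAM.Addr.eval, hacc1])
  have hrep2 := hrep1.set_temp 0 (e.eval s)
  set c2 := c1.set (taddr 0) (e.eval s) with hc2
  have p2 : c2.pc = cf.pc + (e.comp ν 0).length + 1 := by simp [hc2, RAM.Cfg.set, hpc1]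
  have a2 : c2.mem (taddr 0) = e.eval s := set_mem_self _ _ _
  have h3 : Runs P c2 { c2 with pc := c2.pc + 1, output := c2.output ++ [e.eval s] }
      (RAM.size (taddr 0) + RAM.size (e.eval s)) :=
    Runs.one (by rw [p2]; exact hP.2.2.1)
      (by simp [RAM.Instr.exec, RAM.Addr.eval, RAM.Operand.eval, a2])
  refine ⟨_, _, (hr1.trans h2).trans h3, ?_, ?_, ⟨hrep2.var, hrep2.arr, hrep2.inp, ?_⟩⟩
  · have h1 := hσ s X hB
    have f1 : RAM.size (taddr 0) ≤ RAM.size (taddr 0) * lg X :=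
      Nat.le_mul_of_pos_right _ (lg_pos X)
    have : (κ + (2 * σ + 2 * RAM.size (taddr 0))) * lg X = κ * lg X + 2 * (σ * lg X) +
      2 * (RAM.size (taddr 0) * lg X) := by ring
    omega
  · simp [p2, Stm.len]; omega
  · simp [hrep2.out]

/-- The constant depends on the condition alone and is fixed before the branches, so that branches
containing loops are covered, with `B` as their common cost. -/
theorem Does.ite (e : Exp V A) : ∃ κ, ∀ (c d : Stm V A) (s s' : St V A) (X B : ℕ), e.Bd s X →
    (0 < e.eval s → Does ν c s s' B) → (e.eval s ≤ 0 → Does ν d s s' B) →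
    Does ν (.ite e c d) s s' (κ * lg X + B) := by
  obtain ⟨κ, hκ⟩ := e.computes (ν := ν) 0
  obtain ⟨σ, hσ⟩ := e.size_eval
  refine ⟨κ + (σ + 1), fun c d s s' X B hB hc hd P cf hr hP => ?_⟩
  simp only [Stm.comp, At.append, At.cons, Stm.comp_length] at hP
  obtain ⟨hP1, hP2, hP3, hP4, hP5⟩ := hP
  obtain ⟨c1, m1, hr1, hm1, hpc1, hrep1, hacc1, -⟩ := hκ P s cf X hB hr hP1
  have h2 : Runs P c1 { c1 with pc := if 0 < e.eval s then
      cf.pc + (e.comp ν 0).length + 1 + d.len ν + 1 else c1.pc + 1 } (RAM.size (e.eval s)) :=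
    Runs.one (by rw [hpc1]; exact hP2) (by simp [RAM.Instr.exec, hacc1])
  have h1 := hσ s X hB
  have hL := lg_pos X
  by_cases he : 0 < e.eval s
  · rw [if_pos he] at h2
    obtain ⟨c3, m3, hr3, hm3, hpc3, hrep3⟩ := hc he P
      { c1 with pc := cf.pc + (e.comp ν 0).length + 1 + d.len ν + 1 }
      ⟨hrep1.var, hrep1.arr, hrep1.inp, hrep1.out⟩ hP5
    refine ⟨c3, _, (hr1.trans h2).trans hr3, ?_, ?_, hrep3⟩
    · rw [add_mul, add_mul]; omega
    · rw [hpc3, Stm.len]; simp only; omega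
  · rw [if_neg he, hpc1] at h2
    obtain ⟨c3, m3, hr3, hm3, hpc3, hrep3⟩ := hd (not_lt.mp he) P
      { c1 with pc := cf.pc + (e.comp ν 0).length + 1 }
      ⟨hrep1.var, hrep1.arr, hrep1.inp, hrep1.out⟩ hP3
    have h4 : Runs P c3 { c3 with pc := cf.pc + (e.comp ν 0).length + 1 + d.len ν + 1 + c.len ν }
        1 := Runs.one (by rw [hpc3]; exact hP4) rfl
    refine ⟨_, _, ((hr1.trans h2).trans hr3).trans h4, ?_, ?_,
      ⟨hrep3.var, hrep3.arr, hrep3.inp, hrep3.out⟩⟩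
    · rw [add_mul, add_mul]; omega
    · rw [Stm.len]; simp only; omega

/-- The variant `μ` bounds the number of iterations, each of which costs `B` for the body and a
multiple of `lg X` for the test and the jumps. Only the condition determines the constant. -/
theorem Does.loop (e : Exp V A) : ∃ κ, ∀ (c : Stm V A) (X B : ℕ) (I : St V A → Prop)
    (μ : St V A → ℕ), (∀ s, I s → e.Bd s X) →
    (∀ s, I s → 0 < e.eval s → ∃ s', Does ν c s s' B ∧ I s' ∧ μ s' < μ s) →
    ∀ s, I s → ∃ s', Does ν (.loop e c) s s' (μ s * (B + κ * lg X) + κ * lg X) ∧ I s' ∧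
      e.eval s' ≤ 0 := by
  obtain ⟨κ, hκ⟩ := e.computes (ν := ν) 0
  obtain ⟨σ, hσ⟩ := e.size_eval
  refine ⟨κ + (σ + 1), fun c X B I μ hB hc s => ?_⟩
  have hL := lg_pos X
  have hmain : ∀ n s, μ s = n → I s →
      ∃ s', Does ν (.loop e c) s s' (μ s * (B + (κ + (σ + 1)) * lg X) + (κ + (σ + 1)) * lg X) ∧
        I s' ∧ e.eval s' ≤ 0 := by
    intro n
    induction n using Nat.strong_induction_on with
    | _ n ih =>
      intro s hn hI
      by_cases he : 0 < e.eval s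
      · obtain ⟨s1, hd1, hI1, hlt⟩ := hc s hI he
        obtain ⟨s2, hd2, hI2, hle⟩ := ih (μ s1) (hn ▸ hlt) s1 rfl hI1
        refine ⟨s2, fun P cf hr hP => ?_, hI2, hle⟩
        have hP0 := hP
        simp only [Stm.comp, At.append, At.cons, Stm.comp_length] at hP
        obtain ⟨hP1, hP2, hP3, hP4, hP5, -⟩ := hP
        obtain ⟨c1, m1, hr1, hm1, hpc1, hrep1, hacc1, -⟩ := hκ P s cf X (hB s hI) hr hP1
        have h2 : Runs P c1 { c1 with pc := cf.pc + (e.comp ν 0).length + 2 }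
            (RAM.size (e.eval s)) :=
          Runs.one (by rw [hpc1]; exact hP2) (by simp [RAM.Instr.exec, hacc1, he])
        obtain ⟨c3, m3, hr3, hm3, hpc3, hrep3⟩ := hd1 P
          { c1 with pc := cf.pc + (e.comp ν 0).length + 2 }
          ⟨hrep1.var, hrep1.arr, hrep1.inp, hrep1.out⟩ hP4
        have h4 : Runs P c3 { c3 with pc := cf.pc } 1 :=
          Runs.one (by rw [hpc3]; exact hP5) rfl
        obtain ⟨c5, m5, hr5, hm5, hpc5, hrep5⟩ := hd2 P { c3 with pc := cf.pc }
          ⟨hrep3.var, hrep3.arr, hrep3.inp, hrep3.out⟩ hP0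
        refine ⟨c5, _, (((hr1.trans h2).trans hr3).trans h4).trans hr5, ?_, hpc5, hrep5⟩
        have h1 := hσ s X (hB s hI)
        have : (μ s1 + 1) * (B + (κ + (σ + 1)) * lg X) ≤ μ s * (B + (κ + (σ + 1)) * lg X) :=
          Nat.mul_le_mul_right _ hlt
        rw [add_mul (μ s1), one_mul] at this
        have e1 : (κ + (σ + 1)) * lg X = κ * lg X + (σ * lg X + lg X) := by ring
        omega
      · refine ⟨s, fun P cf hr hP => ?_, hI, not_lt.mp he⟩
        simp only [Stm.comp, At.append, At.cons, Stm.comp_length] at hP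
        obtain ⟨hP1, hP2, hP3, hP4, hP5, -⟩ := hP
        obtain ⟨c1, m1, hr1, hm1, hpc1, hrep1, hacc1, -⟩ := hκ P s cf X (hB s hI) hr hP1
        have h2 : Runs P c1 { c1 with pc := c1.pc + 1 } (RAM.size (e.eval s)) :=
          Runs.one (by rw [hpc1]; exact hP2) (by simp [RAM.Instr.exec, hacc1, he])
        have h3 : Runs P { c1 with pc := c1.pc + 1 }
            { c1 with pc := cf.pc + (e.comp ν 0).length + 2 + c.len ν + 1 } 1 :=
          Runs.one (by simp only [hpc1]; exact hP3) rfl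
        refine ⟨_, _, (hr1.trans h2).trans h3, ?_, ?_,
          ⟨hrep1.var, hrep1.arr, hrep1.inp, hrep1.out⟩⟩
        · have h1 := hσ s X (hB s hI)
          have e1 : (κ + (σ + 1)) * lg X = κ * lg X + (σ * lg X + lg X) := by ring
          omega
        · rw [Stm.len]; simp only; omega
  exact fun hI => hmain _ s rfl hI

/-- The weakest precondition of a statement without loops, including bounds on all values that are
looked up. -/
def Stm.wp [DecidableEq V] [DecidableEq A] (X : ℕ) : Stm V A → (St V A → Prop) → St V A → Prop
  | .skip, Q, s => Q s
  | .set x e, Q, s => e.Bd s X ∧ Q { s with var := Function.update s.var x (e.eval s) }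
  | .put a e f, Q, s => e.Bd s X ∧ f.Bd s X ∧ Q { s with
      arr := Function.update s.arr a (Function.update (s.arr a) (e.eval s) (f.eval s)) }
  | .read x, Q, s => (-(X : ℤ) ≤ s.inp.headD 0 ∧ s.inp.headD 0 ≤ X) ∧
      Q { s with var := Function.update s.var x (s.inp.headD 0), inp := s.inp.tail }
  | .emit e, Q, s => e.Bd s X ∧ Q { s with out := s.out ++ [e.eval s] }
  | .seq c d, Q, s => c.wp X (d.wp X Q) s
  | .ite e c d, Q, s => e.Bd s X ∧ (0 < e.eval s → c.wp X Q s) ∧ (e.eval s ≤ 0 → d.wp X Q s)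
  | .loop _ _, _, _ => False

/-- Loop-free code executes a bounded number of instructions on values of size `O(lg X)`. It is
essential that `κ` precedes the state and `X`: all asymptotic bounds below come from this
uniformity. -/
theorem Does.of_wp [DecidableEq V] [DecidableEq A] (c : Stm V A) : ∃ κ, ∀ (s : St V A) (X : ℕ)
    (Q : St V A → Prop), c.wp X Q s → ∃ s', Does ν c s s' (κ * lg X) ∧ Q s' := by
  induction c with
  | skip => exact ⟨0, fun s X Q h => ⟨s, by simpa using Does.skip s, h⟩⟩
  | set x e =>
    obtain ⟨κ, hκ⟩ := Does.set (ν := ν) x e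
    exact ⟨κ, fun s X Q h => ⟨_, hκ s X h.1, h.2⟩⟩
  | put a e f =>
    obtain ⟨κ, hκ⟩ := Does.put (ν := ν) a e f
    exact ⟨κ, fun s X Q h => ⟨_, hκ s X h.1 h.2.1, h.2.2⟩⟩
  | read x =>
    obtain ⟨κ, hκ⟩ := Does.read (ν := ν) x
    exact ⟨κ, fun s X Q h => ⟨_, hκ s X h.1.1 h.1.2, h.2⟩⟩
  | emit e =>
    obtain ⟨κ, hκ⟩ := Does.emit (ν := ν) e
    exact ⟨κ, fun s X Q h => ⟨_, hκ s X h.1, h.2⟩⟩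
  | seq c d hc hd =>
    obtain ⟨κ₁, h₁⟩ := hc
    obtain ⟨κ₂, h₂⟩ := hd
    refine ⟨κ₁ + κ₂, fun s X Q h => ?_⟩
    obtain ⟨s1, hd1, hq1⟩ := h₁ s X _ h
    obtain ⟨s2, hd2, hq2⟩ := h₂ s1 X _ hq1
    exact ⟨s2, by rw [add_mul]; exact hd1.seq hd2, hq2⟩
  | ite e c d hc hd =>
    obtain ⟨κ₁, h₁⟩ := hc
    obtain ⟨κ₂, h₂⟩ := hd
    obtain ⟨κ, hκ⟩ := Does.ite (ν := ν) e
    refine ⟨κ + (κ₁ + κ₂), fun s X Q h => ?_⟩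
    by_cases he : 0 < e.eval s
    · obtain ⟨s1, hd1, hq1⟩ := h₁ s X Q (h.2.1 he)
      refine ⟨s1, ?_, hq1⟩
      rw [add_mul κ]
      exact hκ c d s s1 X _ h.1 (fun _ => hd1.mono (Nat.mul_le_mul_right _ (by omega)))
        (fun h' => absurd he (not_lt.mpr h'))
    · obtain ⟨s1, hd1, hq1⟩ := h₂ s X Q (h.2.2 (not_lt.mp he))
      refine ⟨s1, ?_, hq1⟩
      rw [add_mul κ]
      exact hκ c d s s1 X _ h.1 (fun h' => absurd h' he)
        (fun _ => hd1.mono (Nat.mul_le_mul_right _ (by omega)))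
  | loop e c => exact ⟨0, fun s X Q h => h.elim⟩

end While

/-! ### Hoare triples with cost -/

namespace While

/-- A numbering of finitely many names. -/
noncomputable def Names.ofFinite (V A : Type) [Finite V] [Finite A] : Names V A where
  v x := Finite.equivFin V x
  v_inj := Fin.val_injective.comp (Finite.equivFin V).injective
  a x := Finite.equivFin A x
  a_inj := Fin.val_injective.comp (Finite.equivFin A).injective
  na := Nat.card A
  a_lt x := (Finite.equivFin A x).isLt

theorem Stm.wp_mono {V A : Type} [DecidableEq V] [DecidableEq A] {X : ℕ} (c : Stm V A)
    {Q Q' : St V A → Prop} {s : St V A} (h : c.wp X Q s) (hQ : ∀ s, Q s → Q' s) : c.wp X Q' s := by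
  induction c generalizing Q Q' s with
  | skip => exact hQ _ h
  | set x e => exact ⟨h.1, hQ _ h.2⟩
  | put a e f => exact ⟨h.1, h.2.1, hQ _ h.2.2⟩
  | read x => exact ⟨h.1, hQ _ h.2⟩
  | emit e => exact ⟨h.1, hQ _ h.2⟩
  | seq c d hc hd => exact hc h fun s h' => hd h' hQ
  | ite e c d hc hd => exact ⟨h.1, fun he => hc (h.2.1 he) hQ, fun he => hd (h.2.2 he) hQ⟩
  | loop e c => exact h.elim

/-- From states with `P`, the statement leads at cost at most `B` to states with `Q`. -/
def Meets {V A : Type} (ν : Names V A) (c : Stm V A) (P Q : St V A → Prop) (B : ℕ) : Prop :=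
  ∀ s, P s → ∃ s', Does ν c s s' B ∧ Q s'

section
variable {V A : Type} {ν : Names V A}

theorem Meets.seq {c d : Stm V A} {P Q R : St V A → Prop} {B B' : ℕ} (h : Meets ν c P Q B)
    (h' : Meets ν d Q R B') : Meets ν (.seq c d) P R (B + B') := fun s hs => by
  obtain ⟨s1, hd1, h1⟩ := h s hs
  obtain ⟨s2, hd2, h2⟩ := h' s1 h1
  exact ⟨s2, hd1.seq hd2, h2⟩

theorem Meets.mono {c : Stm V A} {P P' Q Q' : St V A → Prop} {B B' : ℕ} (h : Meets ν c P Q B)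
    (hB : B ≤ B') (hP : ∀ s, P' s → P s) (hQ : ∀ s, Q s → Q' s) : Meets ν c P' Q' B' := fun s hs => by
  obtain ⟨s1, hd1, h1⟩ := h s (hP s hs)
  exact ⟨s1, hd1.mono hB, hQ s1 h1⟩

theorem Meets.of_wp [DecidableEq V] [DecidableEq A] (ν : Names V A) (c : Stm V A) :
    ∃ κ, ∀ (X : ℕ) (P Q : St V A → Prop), (∀ s, P s → c.wp X Q s) → Meets ν c P Q (κ * lg X) := by
  obtain ⟨κ, hκ⟩ := Does.of_wp (ν := ν) c
  exact ⟨κ, fun X P Q h s hs => hκ s X Q (h s hs)⟩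

/-- The rule for loops with an invariant and a variant bounded by `m`. -/
theorem Meets.loop (ν : Names V A) (e : Exp V A) : ∃ κ, ∀ (c : Stm V A) (X B m : ℕ)
    (I : St V A → Prop) (μ : St V A → ℕ), (∀ s, I s → e.Bd s X ∧ μ s ≤ m) →
    (∀ d, Meets ν c (fun s => I s ∧ 0 < e.eval s ∧ μ s = d) (fun s => I s ∧ μ s < d) B) →
    Meets ν (.loop e c) I (fun s => I s ∧ e.eval s ≤ 0) (m * (B + κ * lg X) + κ * lg X) := by
  obtain ⟨κ, hκ⟩ := Does.loop (ν := ν) e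
  refine ⟨κ, fun c X B m I μ hI hc s hs => ?_⟩
  obtain ⟨s', hd, h1, h2⟩ := hκ c X B I μ (fun s h => (hI s h).1) (fun s h he => by
    obtain ⟨s', hd, h1, h2⟩ := hc _ s ⟨h, he, rfl⟩
    exact ⟨s', hd, h1, h2⟩) s hs
  exact ⟨s', hd.mono (Nat.add_le_add_right (Nat.mul_le_mul_right _ (hI s hs).2) _), h1, h2⟩

/-- The rule for loops whose body is free of loops. -/
theorem Meets.loop_wp [DecidableEq V] [DecidableEq A] (ν : Names V A) (e : Exp V A) (c : Stm V A) :
    ∃ κ, ∀ (X m : ℕ) (I : St V A → Prop) (μ : St V A → ℕ), (∀ s, I s → e.Bd s X ∧ μ s ≤ m) →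
    (∀ s, I s → 0 < e.eval s → c.wp X (fun s' => I s' ∧ μ s' < μ s) s) →
    Meets ν (.loop e c) I (fun s => I s ∧ e.eval s ≤ 0) (κ * ((m + 1) * lg X)) := by
  obtain ⟨κ₁, h₁⟩ := Meets.loop ν e
  obtain ⟨κ₂, h₂⟩ := Meets.of_wp ν c
  refine ⟨κ₂ + κ₁, fun X m I μ hI hc => ?_⟩
  refine (h₁ c X (κ₂ * lg X) m I μ hI fun d => h₂ X _ _ ?_).mono ?_ (fun _ h => h) (fun _ h => h)
  · rintro s ⟨h, he, rfl⟩
    exact hc s h he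
  · have : (κ₂ + κ₁) * ((m + 1) * lg X)
      = m * (κ₂ * lg X + κ₁ * lg X) + κ₁ * lg X + κ₂ * lg X := by ring
    omega

end

end While

/-! ### The 3SUM program: reading the numbers and finding their length -/

namespace ThreeSum

open While

/-- The scalar variables of the program. -/
inductive Var (k : ℕ) where
  | n | K | W | x | i | off | cnt | y | z | l | j | w | t | T | st | run | ans | pos (i : Fin k)
deriving DecidableEq, Fintype

/-- The arrays of the program. -/
inductive Arr (k : ℕ) where
  | bits | dp | perm | tape (i : Fin k)
deriving DecidableEq, Fintype

variable {k : ℕ}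

/-- A scalar variable as an expression. -/
abbrev v (u : Var k) : Exp (Var k) (Arr k) := .var u

/-- Sequential composition. -/
abbrev sq (c d : Stm (Var k) (Arr k)) : Stm (Var k) (Arr k) := .seq c d

/-- The numbering of the variables and arrays. -/
noncomputable abbrev nm (k : ℕ) : Names (Var k) (Arr k) := Names.ofFinite _ _

/-- Nothing has been printed, and the tapes are still empty. -/
structure Fresh (s : St (Var k) (Arr k)) : Prop where
  out : s.out = []
  tape : ∀ i p, s.arr (.tape i) p = 0
  pos : ∀ i, s.var (.pos i) = 0

theorem two_pow_two_pow_succ (K : ℕ) : (2 : ℤ) ^ 2 ^ (K + 1) = 2 ^ 2 ^ K * 2 ^ 2 ^ K := by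
  rw [← pow_add, pow_succ]; congr 1; ring

theorem headD_drop (L : List ℤ) (i : ℕ) : (L.drop i).headD 0 = L.getD i 0 := by
  simp [List.getD_eq_getElem?_getD, List.headD_eq_head?_getD, List.head?_drop]

/-- Square the bound on the numbers. -/
def grow : Stm (Var k) (Arr k) :=
  sq (.put .dp (.add (v .K) (.lit 1)) (.mul (.get .dp (v .K)) (.get .dp (v .K))))
    (sq (.set .K (.add (v .K) (.lit 1))) (.set .W (.add (v .W) (v .W))))

/-- Process the current item: either enlarge the bound, or store the item and read the next one. -/
def readBody : Stm (Var k) (Arr k) :=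
  .ite (.sub (.add (.mul (.lit 3) (v .x)) (.lit 1)) (.get .dp (v .K))) grow
    (.ite (.sub (.sub (.lit 1) (.mul (.lit 3) (v .x))) (.get .dp (v .K))) grow
      (sq (.put .bits (v .i) (v .x)) (sq (.set .i (.add (v .i) (.lit 1))) (.read .x))))

/-- Initialisation of the first phase. -/
def readInit : Stm (Var k) (Arr k) :=
  sq (.put .dp (.lit 0) (.lit 2)) (sq (.set .K (.lit 0)) (sq (.set .W (.lit 1))
    (sq (.set .i (.lit (-1))) (.set .x (v .n)))))

/-- The invariant of the first phase, for the input `L`, whose first item is `N`. -/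
structure ReadInv (N Km : ℕ) (L : List ℤ) (Kc ic : ℕ) (s : St (Var k) (Arr k)) : Prop
    extends Fresh s where
  n : s.var .n = N
  K : s.var .K = Kc
  W : s.var .W = 2 ^ Kc
  K_le : Kc ≤ Km
  dp : ∀ j : ℕ, j ≤ Kc → s.arr .dp j = 2 ^ 2 ^ j
  i : s.var .i = ic - 1
  ic_le : ic ≤ N + 1
  bits : ∀ j : ℕ, j < ic → s.arr .bits (j - 1) = L.getD j 0 ∧ 3 * |L.getD j 0| + 1 ≤ 2 ^ 2 ^ Kc
  x : s.var .x = L.getD ic 0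
  inp : s.inp = L.drop (ic + 1)

theorem abs_bounds {z : ℤ} {X : ℕ} (h : 3 * |z| + 1 ≤ X) : -(X : ℤ) ≤ z ∧ z ≤ X := by
  have := abs_le.mp (show |z| ≤ X by have := abs_nonneg z; omega)
  exact ⟨this.1, this.2⟩

/-- An iteration either squares the current bound, which happens at most `Km` times since `2 ^ 2 ^
Km` suffices for all items, or stores an item and reads the next. The count `N` itself is treated as
an item and stored at index `-1`, so the bound finally reached also exceeds `N`. -/
theorem readBody_wp {N Km Kc ic : ℕ} {L : List ℤ}
    (hL : ∀ j, 3 * |L.getD j 0| + 1 ≤ 2 ^ 2 ^ Km) {s : St (Var k) (Arr k)}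
    (h : ReadInv N Km L Kc ic s) (hN : (N : ℤ) ≤ 2 ^ 2 ^ Km) (hlt : 0 < s.var .n - s.var .i) :
    readBody.wp (2 ^ 2 ^ Km) (fun s' => ReadInv N Km L (Kc + 1) ic s' ∧ Kc < Km ∨
      ReadInv N Km L Kc (ic + 1) s' ∧ ic ≤ N) s := by
  have hX := abs_bounds (X := 2 ^ 2 ^ Km) (by push_cast; exact hL ic)
  have hX' := abs_bounds (X := 2 ^ 2 ^ Km) (by push_cast; exact hL (ic + 1))
  have hK2 : Kc < 2 ^ 2 ^ Km :=
    (Nat.lt_two_pow_self.trans_le (Nat.pow_le_pow_right (by norm_num) h.K_le)).trans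
      Nat.lt_two_pow_self
  have hd := h.dp Kc le_rfl
  have hdX : (2 : ℕ) ^ 2 ^ Kc ≤ 2 ^ 2 ^ Km :=
    Nat.pow_le_pow_right (by norm_num) (Nat.pow_le_pow_right (by norm_num) h.K_le)
  have hWX : (2 : ℕ) ^ Kc ≤ 2 ^ 2 ^ Km :=
    (Nat.lt_two_pow_self.le).trans hdX
  have hdX' : ((2 : ℤ) ^ 2 ^ Kc) ≤ 2 ^ 2 ^ Km := by exact_mod_cast hdX
  have hWX' : ((2 : ℤ) ^ Kc) ≤ 2 ^ 2 ^ Km := by exact_mod_cast hWX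
  have hK2' : ((Kc : ℤ)) ≤ 2 ^ 2 ^ Km := by exact_mod_cast hK2.le
  have hp1 : (0 : ℤ) < 2 ^ 2 ^ Kc := by positivity
  have hp2 : (0 : ℤ) < 2 ^ Kc := by positivity
  have hi := h.i
  have hn := h.n
  have hicN : ic ≤ N := by omega
  have hicX : (ic : ℤ) ≤ 2 ^ 2 ^ Km := le_trans (by exact_mod_cast hicN) hN
  push_cast at hX hX'
  have hgrow : 2 ^ 2 ^ Kc < 3 * |L.getD ic 0| + 1 → grow.wp (2 ^ 2 ^ Km)
      (fun s' => ReadInv N Km L (Kc + 1) ic s' ∧ Kc < Km ∨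
        ReadInv N Km L Kc (ic + 1) s' ∧ ic ≤ N) s := by
    intro hbig
    have hKlt : Kc < Km := by
      rcases h.K_le.lt_or_eq with h' | rfl
      · exact h'
      · exact absurd (hL ic) (not_le.mpr hbig)
    simp only [grow, Stm.wp, Exp.Bd, Exp.eval, ne_eq, reduceCtorEq,
      not_false_eq_true, Function.update_of_ne, h.K, h.W, hd]
    push_cast
    refine ⟨⟨⟨by omega, by omega⟩, trivial⟩, ⟨⟨⟨by omega, by omega⟩, ⟨by omega, by omega⟩,
      by omega, by omega⟩, ⟨by omega, by omega⟩, ⟨by omega, by omega⟩, by omega, by omega⟩,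
      ⟨⟨by omega, by omega⟩, trivial⟩, ⟨⟨by omega, by omega⟩, by omega, by omega⟩,
      Or.inl ⟨⟨⟨h.out, ?_, ?_⟩, ?_, ?_, ?_, ?_, ?_, ?_, h.ic_le, ?_, ?_, h.inp⟩, hKlt⟩⟩
    · intro i p; simp [h.tape]
    · intro i; simp [h.pos]
    · simp [h.n]
    · simp
    · simp; ring
    · omega
    · intro j hj
      rcases hj.lt_or_eq with hj | rfl
      · have : (j : ℤ) ≠ Kc + 1 := by omega
        simp [this, h.dp j (by omega)]
      · simp [two_pow_two_pow_succ]
    · simp [h.i]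
    · intro j hj
      simp only [ne_eq, reduceCtorEq, not_false_eq_true, Function.update_of_ne]
      exact ⟨(h.bits j hj).1, (h.bits j hj).2.trans
        (pow_le_pow_right₀ (by norm_num) (Nat.pow_le_pow_right (by norm_num) (by omega)))⟩
    · simp [h.x]
  have h3 : 3 * |L.getD ic 0| = |3 * L.getD ic 0| := by rw [abs_mul]; simp
  simp only [readBody, Stm.wp, Exp.Bd, Exp.eval, h.K, hd, h.x]
  push_cast
  refine ⟨⟨⟨⟨trivial, hX⟩, trivial⟩, ⟨by omega, by omega⟩, ⟨by omega, by omega⟩, by omega,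
    by omega⟩, fun hg => hgrow ?_, fun hg1 => ⟨⟨⟨trivial, trivial, hX⟩, ⟨by omega, by omega⟩,
      ⟨by omega, by omega⟩, by omega, by omega⟩, fun hg => hgrow ?_, fun hg2 => ?_⟩⟩
  · rw [h3]; have := le_abs_self (3 * L.getD ic 0); omega
  · rw [h3]; have := neg_le_abs (3 * L.getD ic 0); omega
  have hsmall : 3 * |L.getD ic 0| + 1 ≤ 2 ^ 2 ^ Kc := by
    rw [h3]
    have := abs_le.mpr (⟨by omega, by omega⟩ :
      -((2 : ℤ) ^ 2 ^ Kc - 1) ≤ 3 * L.getD ic 0 ∧ 3 * L.getD ic 0 ≤ 2 ^ 2 ^ Kc - 1)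
    omega
  rw [h.inp, headD_drop, hi]
  refine ⟨⟨by omega, by omega⟩, hX, ⟨⟨by omega, by omega⟩, trivial⟩, hX', Or.inr
    ⟨⟨⟨h.out, ?_, ?_⟩, ?_, ?_, ?_, h.K_le, ?_, ?_, ?_, ?_, ?_, ?_⟩, hicN⟩⟩
  · intro i p; simp [h.tape]
  · intro i; simp [h.pos]
  · simp [h.n]
  · simp [h.K]
  · simp [h.W]
  · intro j hj; simp [h.dp j hj]
  · simp
  · omega
  · intro j hj
    rcases (Nat.lt_succ_iff.mp hj).lt_or_eq with hj | rfl
    · have : (j : ℤ) - 1 ≠ ic - 1 := by omega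
      simp only [Function.update_self, ne_eq, this, not_false_eq_true, Function.update_of_ne]
      exact h.bits j hj
    · simpa using hsmall
  · simp
  · simp

/-- The first phase: read the numbers. -/
def reading : Stm (Var k) (Arr k) := sq readInit (.loop (.sub (v .n) (v .i)) readBody)

theorem reading_meets (k : ℕ) : ∃ κ, ∀ (N Km : ℕ) (L : List ℤ),
    (∀ j, 3 * |L.getD j 0| + 1 ≤ 2 ^ 2 ^ Km) → L.getD 0 0 = N →
    Meets (nm k) reading (fun s => Fresh s ∧ s.var .n = N ∧ s.inp = L.drop 1)
      (fun s => ∃ Kc, ReadInv N Km L Kc (N + 1) s) (κ * ((N + Km + 3) * lg (2 ^ 2 ^ Km))) := by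
  obtain ⟨κ₁, h₁⟩ := Meets.of_wp (nm k) readInit
  obtain ⟨κ₂, h₂⟩ := Meets.loop_wp (nm k) (.sub (v .n) (v .i)) readBody
  refine ⟨κ₁ + κ₂, fun N Km L hL h0 => ?_⟩
  have hN : (N : ℤ) ≤ 2 ^ 2 ^ Km := by
    have := hL 0; rw [h0, abs_of_nonneg (by omega)] at this; omega
  have hp : (1 : ℤ) ≤ 2 ^ 2 ^ Km := one_le_pow₀ (by norm_num)
  have hB : κ₁ * lg (2 ^ 2 ^ Km) + κ₂ * ((N + Km + 1 + 1) * lg (2 ^ 2 ^ Km)) ≤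
      (κ₁ + κ₂) * ((N + Km + 3) * lg (2 ^ 2 ^ Km)) := by
    rw [add_mul κ₁]
    exact Nat.add_le_add (Nat.mul_le_mul_left _ (Nat.le_mul_of_pos_left _ (by omega)))
      (Nat.mul_le_mul_left _ (Nat.mul_le_mul_right _ (by omega)))
  refine ((h₁ (2 ^ 2 ^ Km) _ (ReadInv N Km L 0 0) ?_).seq (((h₂ (2 ^ 2 ^ Km) (N + Km + 1)
    (fun s => ∃ Kc ic, ReadInv N Km L Kc ic s)
    (fun s => (N - s.var .i + (Km - s.var .K)).toNat) ?_ ?_)).mono le_rfl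
      (fun s hs => ⟨_, _, hs⟩) (fun s hs => hs))).mono hB (fun _ h => h) ?_
  · rintro s ⟨hf, hn, hi⟩
    simp only [readInit, Stm.wp, Exp.Bd, Exp.eval, ne_eq, reduceCtorEq,
      not_false_eq_true, Function.update_of_ne, hn]
    push_cast
    refine ⟨trivial, trivial, trivial, trivial, trivial, ⟨by omega, hN⟩,
      ⟨hf.out, ?_, ?_⟩, ?_, ?_, ?_, by omega, ?_, ?_, by omega, ?_, ?_, ?_⟩
    · intro i p; simp [hf.tape]
    · intro i; simp [hf.pos]
    · simp [hn]
    · simp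
    · simp
    · intro j hj
      obtain rfl : j = 0 := by omega
      simp
    · simp
    · intro j hj; omega
    · rw [h0]; simp
    · simp [hi]
  · rintro s ⟨Kc, ic, h⟩
    have := h.ic_le
    have := h.K_le
    simp only [Exp.Bd, h.n, h.i, h.K]
    push_cast
    exact ⟨⟨⟨by omega, hN⟩, by omega, by omega⟩, by omega⟩
  · rintro s ⟨Kc, ic, h⟩ hpos
    refine Stm.wp_mono _ (readBody_wp hL h hN hpos) ?_
    rintro s' (⟨h', hlt⟩ | ⟨h', hlt⟩)
    · have := h.ic_le
      refine ⟨⟨_, _, h'⟩, ?_⟩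
      rw [h'.K, h'.i, h.K, h.i]; push_cast; omega
    · have := h.K_le
      refine ⟨⟨_, _, h'⟩, ?_⟩
      rw [h'.K, h'.i, h.K, h.i]; push_cast; omega
  · rintro s ⟨⟨Kc, ic, h⟩, hle⟩
    have h1 := h.ic_le
    simp only [Exp.eval, h.n, h.i] at hle
    obtain rfl : ic = N + 1 := by omega
    exact ⟨Kc, h⟩

end ThreeSum

namespace While

theorem lg_add (a b : ℕ) : lg (a + b) ≤ lg a + lg b := by
  have := size_add a b
  rw [← Nat.cast_add] at this
  exact this

theorem lg_two_pow (m : ℕ) : lg (2 ^ m) = m + 1 := by simp [lg]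

end While

/-! ### Shifting the numbers and cutting them into bits -/

namespace ThreeSum

open While

variable {k : ℕ}

/-- The number of items and the number of bits are known. -/
structure Base (N W : ℕ) (s : St (Var k) (Arr k)) : Prop extends Fresh s where
  n : s.var .n = N
  W : s.var .W = W

/-- The amount by which the numbers are shifted to make them nonnegative. -/
def offset (Kf : ℕ) : ℤ := (2 ^ 2 ^ Kf - 1) / 3

/-- Initialisation of the second phase. -/
def shiftInit : Stm (Var k) (Arr k) :=
  sq (.set .off (.div (.sub (.get .dp (v .K)) (.lit 1)) (.lit 3))) (.set .i (.lit 0))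

/-- Shift one number, and initialise the permutation. -/
def shiftBody : Stm (Var k) (Arr k) :=
  sq (.put .bits (v .i) (.add (.get .bits (v .i)) (v .off)))
    (sq (.put .perm (v .i) (v .i)) (.set .i (.add (v .i) (.lit 1))))

/-- The second phase. -/
def shifting : Stm (Var k) (Arr k) := sq shiftInit (.loop (.sub (v .n) (v .i)) shiftBody)

/-- The invariant of the second phase. -/
structure ShiftInv (N Kf : ℕ) (a : ℕ → ℤ) (ic : ℕ) (s : St (Var k) (Arr k)) : Prop
    extends Base N (2 ^ Kf) s where
  K : s.var .K = Kf
  dp : ∀ j : ℕ, j ≤ Kf → s.arr .dp j = 2 ^ 2 ^ j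
  off : s.var .off = offset Kf
  i : s.var .i = ic
  ic_le : ic ≤ N
  bits : ∀ j : ℕ, j < N → s.arr .bits j = if j < ic then a j + offset Kf else a j
  perm : ∀ j : ℕ, j < ic → s.arr .perm j = j

theorem shifting_meets (k : ℕ) : ∃ κ, ∀ (N Kf Km : ℕ) (L : List ℤ), L.getD 0 0 = N →
    Meets (nm k) shifting (ReadInv N Km L Kf (N + 1))
      (fun s => ShiftInv N Kf (fun j => L.getD (j + 1) 0) N s)
      (κ * ((N + 2) * lg (2 ^ 2 ^ Kf))) := by
  obtain ⟨κ₁, h₁⟩ := Meets.of_wp (nm k) shiftInit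
  obtain ⟨κ₂, h₂⟩ := Meets.loop_wp (nm k) (.sub (v .n) (v .i)) shiftBody
  refine ⟨κ₁ + κ₂, fun N Kf Km L h0 => ?_⟩
  have hp : (1 : ℤ) ≤ 2 ^ 2 ^ Kf := one_le_pow₀ (by norm_num)
  have hK : (Kf : ℤ) ≤ 2 ^ 2 ^ Kf := by
    exact_mod_cast (Nat.lt_two_pow_self.trans Nat.lt_two_pow_self).le
  have hB : κ₁ * lg (2 ^ 2 ^ Kf) + κ₂ * ((N + 1) * lg (2 ^ 2 ^ Kf)) ≤
      (κ₁ + κ₂) * ((N + 2) * lg (2 ^ 2 ^ Kf)) := by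
    rw [add_mul κ₁]
    exact Nat.add_le_add (Nat.mul_le_mul_left _ (Nat.le_mul_of_pos_left _ (by omega)))
      (Nat.mul_le_mul_left _ (Nat.mul_le_mul_right _ (by omega)))
  -- The final bound `Kf` is known only from the state. If it were too small for `N` or for one of
  -- the numbers, no state would satisfy the precondition and nothing would have to be shown.
  by_cases hbd : 3 * (N : ℤ) + 1 ≤ 2 ^ 2 ^ Kf ∧
    ∀ j < N, 3 * |L.getD (j + 1) 0| + 1 ≤ 2 ^ 2 ^ Kf
  swap
  · intro s h
    refine absurd ⟨?_, fun j hj => (h.bits (j + 1) (by omega)).2⟩ hbd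
    have := (h.bits 0 (by omega)).2
    rwa [h0, abs_of_nonneg (by omega)] at this
  obtain ⟨hN, hL⟩ := hbd
  have hNX : (N : ℤ) ≤ 2 ^ 2 ^ Kf := by omega
  have hLX := fun j hj => abs_bounds (X := 2 ^ 2 ^ Kf) (by push_cast; exact hL j hj)
  push_cast at hLX
  refine ((h₁ (2 ^ 2 ^ Kf) _ (ShiftInv N Kf (fun j => L.getD (j + 1) 0) 0) ?_).seq
    (((h₂ (2 ^ 2 ^ Kf) N (fun s => ∃ ic, ShiftInv N Kf (fun j => L.getD (j + 1) 0) ic s)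
    (fun s => (N - s.var .i).toNat) ?_ ?_)).mono le_rfl
      (fun s hs => ⟨_, hs⟩) (fun s hs => hs))).mono hB (fun _ h => h) ?_
  · rintro s h
    have hd := h.dp Kf le_rfl
    simp only [shiftInit, Stm.wp, Exp.Bd, Exp.eval, h.K, hd]
    push_cast
    refine ⟨⟨⟨⟨⟨by omega, by omega⟩, ⟨by omega, by omega⟩, by omega, by omega⟩, trivial⟩, trivial,
      by norm_num⟩, trivial, ⟨⟨h.out, ?_, ?_⟩, ?_, ?_⟩, ?_, ?_, ?_, ?_, by omega, ?_, ?_⟩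
    · intro i p; simp [h.tape]
    · intro i; simp [h.pos]
    · simp [h.n]
    · simp [h.W]
    · simp [h.K]
    · exact h.dp
    · simp [offset]
    · simp
    · intro j hj
      have := (h.bits (j + 1) (by omega)).1
      push_cast at this
      rw [add_sub_cancel_right] at this
      simpa using this
    · intro j hj; omega
  · rintro s ⟨ic, h⟩
    have := h.ic_le
    simp only [Exp.Bd, h.n, h.i]
    push_cast
    exact ⟨⟨⟨by omega, hNX⟩, by omega, by omega⟩, by omega⟩
  · rintro s ⟨ic, h⟩ hpos
    simp only [Exp.eval, h.n, h.i] at hpos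
    have hic : ic < N := by omega
    have hb : s.arr .bits ic = L.getD (ic + 1) 0 := by rw [h.bits ic hic, if_neg (by omega)]
    have ho : 0 ≤ offset Kf ∧ offset Kf ≤ 2 ^ 2 ^ Kf := by unfold offset; omega
    simp only [shiftBody, Stm.wp, Exp.Bd, Exp.eval, ne_eq, reduceCtorEq, not_false_eq_true,
      Function.update_of_ne, Function.update_self, h.i, h.off, hb]
    push_cast
    refine ⟨⟨by omega, by omega⟩, ⟨⟨⟨by omega, by omega⟩, ⟨by omega, by omega⟩, hLX ic hic⟩,
      by omega, by omega⟩, ⟨by omega, by omega⟩, ⟨by omega, by omega⟩, ⟨⟨by omega, by omega⟩,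
      trivial⟩, ⟨ic + 1, ⟨⟨⟨h.out, ?_, ?_⟩, ?_, ?_⟩, ?_, ?_, ?_, ?_, by omega, ?_, ?_⟩⟩, by omega⟩
    · intro i p; simp [h.tape]
    · intro i; simp [h.pos]
    · simp [h.n]
    · simp [h.W]
    · simp [h.K]
    · intro j hj; simp [h.dp j hj]
    · simp [h.off]
    · simp
    · intro j hj
      have h' := h.bits j hj
      simp only [ne_eq, reduceCtorEq, not_false_eq_true, Function.update_of_ne,
        Function.update_self, Function.update_apply, Nat.cast_inj]
      split_ifs with h1 h2 h2
      · rw [h1]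
      · omega
      · rw [h', if_pos (by omega)]
      · rw [h', if_neg (by omega)]
    · intro j hj
      simp only [Function.update_self, Function.update_apply, Nat.cast_inj]
      split_ifs with h1
      · rw [h1]
      · exact h.perm j (by omega)
  · rintro s ⟨⟨ic, h⟩, hle⟩
    have h1 := h.ic_le
    simp only [Exp.eval, h.n, h.i] at hle
    obtain rfl : ic = N := by omega
    exact h

/-- The binary expansions after `l` halvings of the pieces. -/
def part (A : ℕ → ℕ) (Kf : ℕ) : ℕ → ℕ → ℕ
  | 0, i => A i
  | l + 1, i => if i % 2 = 0 then part A Kf l (i / 2) / 2 ^ 2 ^ (Kf - (l + 1))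
      else part A Kf l (i / 2) % 2 ^ 2 ^ (Kf - (l + 1))

/-- Cutting every piece into its upper and lower half `l` times leaves blocks of `2 ^ (Kf - l)`
binary digits, counted from the most significant one. For `l = Kf` the blocks are single bits. -/
theorem part_eq (A : ℕ → ℕ) (Kf : ℕ) : ∀ l ≤ Kf, ∀ x r, (∀ x, A x < 2 ^ 2 ^ Kf) → r < 2 ^ l →
    part A Kf l (x * 2 ^ l + r) =
      A x / 2 ^ (2 ^ (Kf - l) * (2 ^ l - 1 - r)) % 2 ^ 2 ^ (Kf - l)
  | 0, _, x, r, hA, hr => by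
    obtain rfl : r = 0 := by simpa using hr
    simp [part, Nat.mod_eq_of_lt (hA x)]
  | l + 1, hl, x, r, hA, hr => by
    have hr2 : r / 2 < 2 ^ l := by rw [pow_succ] at hr; omega
    have ih := part_eq A Kf l (by omega) x (r / 2) hA hr2
    obtain ⟨m, rfl⟩ : ∃ m, Kf = l + 1 + m := ⟨Kf - (l + 1), by omega⟩
    rw [show l + 1 + m - l = m + 1 by omega] at ih
    rw [show l + 1 + m - (l + 1) = m by omega]
    have hx : x * 2 ^ (l + 1) = 2 * (x * 2 ^ l) := by ring
    have hd : (x * 2 ^ (l + 1) + r) / 2 = x * 2 ^ l + r / 2 := by omega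
    have hm : (x * 2 ^ (l + 1) + r) % 2 = r % 2 := by omega
    rw [part, hd, hm, ih, show l + 1 + m - (l + 1) = m by omega]
    have h2 : 2 ^ (m + 1) = 2 ^ m + 2 ^ m := by rw [pow_succ]; ring
    split_ifs with hpar
    · have e1 : 2 ^ m * (2 ^ (l + 1) - 1 - r) = 2 ^ (m + 1) * (2 ^ l - 1 - r / 2) + 2 ^ m := by
        rw [show 2 ^ (l + 1) - 1 - r = 2 * (2 ^ l - 1 - r / 2) + 1 by rw [pow_succ] at *; omega]
        rw [pow_succ]; ring
      rw [e1, h2, pow_add, pow_add, ← Nat.div_div_eq_div_mul, Nat.mod_mul_left_div_self]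
    · have e1 : 2 ^ m * (2 ^ (l + 1) - 1 - r) = 2 ^ (m + 1) * (2 ^ l - 1 - r / 2) := by
        rw [show 2 ^ (l + 1) - 1 - r = 2 * (2 ^ l - 1 - r / 2) by rw [pow_succ] at *; omega]
        rw [pow_succ]; ring
      rw [e1, h2, pow_add 2 (2 ^ m) (2 ^ m), Nat.mod_mul_left_mod]

theorem part_lt (A : ℕ → ℕ) (Kf : ℕ) (hA : ∀ x, A x < 2 ^ 2 ^ Kf) (l : ℕ) (hl : l ≤ Kf) (i : ℕ) :
    part A Kf l i < 2 ^ 2 ^ (Kf - l) := by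
  have hp : 0 < 2 ^ l := by positivity
  have := part_eq A Kf l hl (i / 2 ^ l) (i % 2 ^ l) hA (Nat.mod_lt _ hp)
  rw [Nat.div_add_mod'] at this
  rw [this]
  exact Nat.mod_lt _ (by positivity)

/-- Halve one piece. -/
def splitBody : Stm (Var k) (Arr k) :=
  sq (.set .i (.sub (v .i) (.lit 1)))
    (sq (.set .x (.get .bits (v .i)))
      (sq (.put .bits (.mul (.lit 2) (v .i)) (.div (v .x) (.get .dp (v .K))))
        (.put .bits (.add (.mul (.lit 2) (v .i)) (.lit 1))
          (.sub (v .x) (.mul (.div (v .x) (.get .dp (v .K))) (.get .dp (v .K)))))))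

/-- Preparation of one level. -/
def splitInit : Stm (Var k) (Arr k) :=
  sq (.set .K (.sub (v .K) (.lit 1))) (.set .i (v .cnt))

/-- The third phase: replace the numbers by their binary expansions. -/
def splitting : Stm (Var k) (Arr k) :=
  sq (.set .cnt (v .n)) (.loop (v .K) (sq splitInit (sq (.loop (v .i) splitBody)
    (.set .cnt (.mul (.lit 2) (v .cnt))))))

/-- The invariant of the third phase. -/
structure SplitInv (N Kf : ℕ) (A : ℕ → ℕ) (l : ℕ) (s : St (Var k) (Arr k)) : Prop
    extends Base N (2 ^ Kf) s where
  K : s.var .K = (Kf - l : ℕ)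
  dp : ∀ j : ℕ, j ≤ Kf → s.arr .dp j = 2 ^ 2 ^ j
  cnt : s.var .cnt = (N * 2 ^ l : ℕ)
  l_le : l ≤ Kf
  bits : ∀ j : ℕ, j < N * 2 ^ l → s.arr .bits j = part A Kf l j
  perm : ∀ j : ℕ, j < N → s.arr .perm j = j

/-- The invariant of the inner loop of the third phase. -/
structure SplitInv' (N Kf : ℕ) (A : ℕ → ℕ) (l ic : ℕ) (s : St (Var k) (Arr k)) : Prop
    extends Base N (2 ^ Kf) s where
  K : s.var .K = (Kf - (l + 1) : ℕ)
  dp : ∀ j : ℕ, j ≤ Kf → s.arr .dp j = 2 ^ 2 ^ j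
  cnt : s.var .cnt = (N * 2 ^ l : ℕ)
  i : s.var .i = ic
  ic_le : ic ≤ N * 2 ^ l
  bits : ∀ j : ℕ, j < ic → s.arr .bits j = part A Kf l j
  bits' : ∀ j : ℕ, 2 * ic ≤ j → j < N * 2 ^ (l + 1) → s.arr .bits j = part A Kf (l + 1) j
  perm : ∀ j : ℕ, j < N → s.arr .perm j = j

/-- The pieces are cut in place, from the last to the first: piece `ic` goes to the cells `2 * ic`
and `2 * ic + 1`, and neither of them lies below `ic`, so the pieces still to be cut are intact. -/
theorem splitBody_wp {N Kf l ic : ℕ} {A : ℕ → ℕ} (hA : ∀ x, A x < 2 ^ 2 ^ Kf) (hl : l < Kf)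
    {s : St (Var k) (Arr k)} (h : SplitInv' N Kf A l (ic + 1) s) :
    splitBody.wp (2 ^ 2 ^ (Kf - l) + N * 2 ^ Kf) (SplitInv' N Kf A l ic) s := by
  have hi := h.ic_le
  have hi' : ic < N * 2 ^ Kf := by
    have : N * 2 ^ l ≤ N * 2 ^ Kf := Nat.mul_le_mul_left _ (Nat.pow_le_pow_right (by norm_num) hl.le)
    omega
  have hK : Kf - (l + 1) < 2 ^ 2 ^ (Kf - l) :=
    lt_of_le_of_lt (by omega) (Nat.lt_two_pow_self.trans Nat.lt_two_pow_self : Kf - l < _)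
  have hb := h.bits ic (by omega)
  have hp := part_lt A Kf hA l hl.le ic
  have hd := h.dp (Kf - (l + 1)) (by omega)
  have hd0 : (2 : ℕ) ^ 2 ^ (Kf - (l + 1)) ≤ 2 ^ 2 ^ (Kf - l) :=
    Nat.pow_le_pow_right (by norm_num) (Nat.pow_le_pow_right (by norm_num) (by omega))
  have hd1 : (0 : ℤ) < 2 ^ 2 ^ (Kf - (l + 1)) := by positivity
  have e1 : (ic : ℤ) + 1 - 1 = ic := by ring
  zify at hi' hK hp hd0
  simp only [splitBody, Stm.wp, Exp.Bd, Exp.eval, ne_eq, reduceCtorEq, not_false_eq_true,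
      Function.update_of_ne, Function.update_self, h.i, h.K, Nat.cast_add, Nat.cast_one, e1, hb, hd]
  push_cast
  have hdK : (-((2 : ℤ) ^ 2 ^ (Kf - l) + N * 2 ^ Kf) ≤ (Kf - (l + 1) : ℕ) ∧
    ((Kf - (l + 1) : ℕ) : ℤ) ≤ 2 ^ 2 ^ (Kf - l) + N * 2 ^ Kf) := ⟨by omega, by omega⟩
  have hdd : (-((2 : ℤ) ^ 2 ^ (Kf - l) + N * 2 ^ Kf) ≤ 2 ^ 2 ^ (Kf - (l + 1)) ∧
    (2 : ℤ) ^ 2 ^ (Kf - (l + 1)) ≤ 2 ^ 2 ^ (Kf - l) + N * 2 ^ Kf) := ⟨by omega, by omega⟩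
  have hii : (-((2 : ℤ) ^ 2 ^ (Kf - l) + N * 2 ^ Kf) ≤ ic ∧
    (ic : ℤ) ≤ 2 ^ 2 ^ (Kf - l) + N * 2 ^ Kf) := ⟨by omega, by omega⟩
  have hpp : (-((2 : ℤ) ^ 2 ^ (Kf - l) + N * 2 ^ Kf) ≤ part A Kf l ic ∧
    (part A Kf l ic : ℤ) ≤ 2 ^ 2 ^ (Kf - l) + N * 2 ^ Kf) := ⟨by omega, by omega⟩
  refine ⟨⟨⟨by omega, by omega⟩, trivial⟩, ⟨hii, hii, hpp⟩, ⟨trivial, hii⟩,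
    ⟨hpp, ⟨hdK, hdK, hdd⟩, hd1⟩, ⟨⟨trivial, hii⟩, trivial⟩,
    ⟨hpp, ⟨hpp, ⟨hdK, hdK, hdd⟩, hd1⟩, hdK, hdK, hdd⟩,
    ⟨⟨⟨h.out, ?_, ?_⟩, ?_, ?_⟩, ?_, ?_, ?_, ?_, by omega, ?_, ?_, ?_⟩⟩
  · intro i p; simp [h.tape]
  · intro i; simp [h.pos]
  · simp [h.n]
  · simp [h.W]
  · simp [h.K]
  · intro j hj; simp [h.dp j hj]
  · simp [h.cnt]
  · simp
  · intro j hj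
    have h1 : (j : ℤ) ≠ 2 * ic + 1 := by omega
    have h2 : (j : ℤ) ≠ 2 * ic := by omega
    simp [h1, h2, h.bits j (by omega)]
  · intro j hj hj'
    by_cases h2 : j = 2 * ic
    · subst h2
      simp [part]
    by_cases h1 : j = 2 * ic + 1
    · subst h1
      rw [part, if_neg (by omega), show (2 * ic + 1) / 2 = ic by omega]
      simp [Int.emod_def, mul_comm]
    · have h1 : (j : ℤ) ≠ 2 * ic + 1 := by omega
      have h2 : (j : ℤ) ≠ 2 * ic := by omega
      simp [h1, h2, h.bits' j (by omega) hj']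
  · intro j hj; simp [h.perm j hj]

/-- Level `l` treats `N * 2 ^ l` pieces of at most `2 ^ (Kf - l)` bits, so with `Y = N * 2 ^ Kf`
each of the `Kf` levels costs `O(Y * lg Y)` under the logarithmic measure. Peeling single bits off
whole numbers would cost a quadratic amount in the length of the numbers. -/
theorem splitting_meets (k : ℕ) : ∃ κ, ∀ (N Kf : ℕ) (a : ℕ → ℤ) (A : ℕ → ℕ), 1 ≤ N → 1 ≤ Kf →
    (∀ x, A x < 2 ^ 2 ^ Kf) → (∀ j < N, (A j : ℤ) = a j + offset Kf) →
    Meets (nm k) splitting (ShiftInv N Kf a N) (SplitInv N Kf A Kf)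
      (κ * (N * 2 ^ Kf * lg (N * 2 ^ Kf) ^ 2)) := by
  obtain ⟨κ₁, h₁⟩ := Meets.of_wp (nm k) (.set .cnt (v .n))
  obtain ⟨κ₂, h₂⟩ := Meets.loop (nm k) (v .K)
  obtain ⟨κ₃, h₃⟩ := Meets.of_wp (nm k) splitInit
  obtain ⟨κ₄, h₄⟩ := Meets.loop_wp (nm k) (v .i) splitBody
  obtain ⟨κ₅, h₅⟩ := Meets.of_wp (nm k) (.set .cnt (.mul (.lit 2) (v .cnt)))
  refine ⟨κ₁ + (κ₃ + (6 * κ₄ + κ₅) + 2 * κ₂), fun N Kf a A hN hKf hA ha => ?_⟩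
  set Y := N * 2 ^ Kf with hY
  have hK2 : Kf < 2 ^ Kf := Nat.lt_two_pow_self
  have h2Y : 2 ^ Kf ≤ Y := Nat.le_mul_of_pos_left _ hN
  have hNY : N ≤ Y := Nat.le_mul_of_pos_right _ (by positivity)
  have hYl := lg_pos Y
  have hKl : Kf + 1 ≤ lg Y := by rw [← lg_two_pow]; exact lg_mono h2Y
  have hcntY : ∀ l ≤ Kf, N * 2 ^ l ≤ Y := fun l hl =>
    Nat.mul_le_mul_left _ (Nat.pow_le_pow_right (by norm_num) hl)
  have hlev : ∀ l < Kf, Meets (nm k) (sq splitInit (sq (.loop (v .i) splitBody)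
      (.set .cnt (.mul (.lit 2) (v .cnt))))) (SplitInv N Kf A l) (SplitInv N Kf A (l + 1))
      (κ₃ * lg Y + (κ₄ * (6 * (Y * lg Y)) + κ₅ * lg Y)) := by
    intro l hl
    have hX : (N * 2 ^ l + 1) * lg (2 ^ 2 ^ (Kf - l) + Y) ≤ 6 * (Y * lg Y) := by
      have e1 : N * 2 ^ l * 2 ^ (Kf - l) = Y := by
        rw [mul_assoc, ← pow_add, Nat.add_sub_of_le hl.le]
      have e2 := lg_add (2 ^ 2 ^ (Kf - l)) Y
      rw [lg_two_pow] at e2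
      have e3 : 1 ≤ N * 2 ^ l := Nat.mul_pos hN (by positivity)
      calc (N * 2 ^ l + 1) * lg (2 ^ 2 ^ (Kf - l) + Y)
          ≤ (2 * (N * 2 ^ l)) * (2 ^ (Kf - l) + 1 + lg Y) := Nat.mul_le_mul (by omega) e2
        _ = 2 * (N * 2 ^ l * 2 ^ (Kf - l) + N * 2 ^ l * (1 + lg Y)) := by ring
        _ ≤ 2 * (Y * lg Y + Y * (2 * lg Y)) := by
          rw [e1]
          exact Nat.mul_le_mul_left _ (Nat.add_le_add (Nat.le_mul_of_pos_right _ hYl)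
            (Nat.mul_le_mul (hcntY l hl.le) (by omega)))
        _ = 6 * (Y * lg Y) := by ring
    have hcl := hcntY l hl.le
    refine (h₃ Y _ (SplitInv' N Kf A l (N * 2 ^ l)) ?_).seq
      (((h₄ (2 ^ 2 ^ (Kf - l) + Y) (N * 2 ^ l) (fun s => ∃ ic, SplitInv' N Kf A l ic s)
      (fun s => (s.var .i).toNat) ?_ ?_).mono (Nat.mul_le_mul_left _ hX)
      (fun s hs => ⟨_, hs⟩) (fun s hs => hs)).seq (h₅ Y _ _ ?_))
    · rintro s h
      simp only [splitInit, Stm.wp, Exp.Bd, Exp.eval, ne_eq, reduceCtorEq, not_false_eq_true,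
        Function.update_of_ne, h.K, h.cnt]
      refine ⟨⟨⟨by omega, by omega⟩, trivial⟩, ⟨by omega, by omega⟩, ⟨⟨⟨h.out, ?_, ?_⟩, ?_, ?_⟩,
        ?_, h.dp, ?_, ?_, le_rfl, h.bits, ?_, h.perm⟩⟩
      · intro i p; simp [h.tape]
      · intro i; simp [h.pos]
      · simp [h.n]
      · simp [h.W]
      · simp; omega
      · simp [h.cnt]
      · simp
      · intro j hj hj'
        rw [pow_succ] at hj'
        rw [← mul_assoc] at hj'
        omega
    · rintro s ⟨ic, h⟩
      have := h.ic_le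
      simp only [Exp.Bd, h.i]
      have := Nat.zero_le (2 ^ 2 ^ (Kf - l))
      exact ⟨⟨by omega, by omega⟩, by omega⟩
    · rintro s ⟨ic, h⟩ hpos
      simp only [Exp.eval, h.i] at hpos
      obtain ⟨ic, rfl⟩ : ∃ i', ic = i' + 1 := ⟨ic - 1, by omega⟩
      refine Stm.wp_mono _ (splitBody_wp hA hl h) fun s' h' => ⟨⟨_, h'⟩, ?_⟩
      rw [h'.i, h.i]
      omega
    · rintro s ⟨⟨ic, h⟩, hle⟩
      simp only [Exp.eval, h.i] at hle
      obtain rfl : ic = 0 := by omega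
      simp only [Stm.wp, Exp.Bd, Exp.eval, h.cnt]
      refine ⟨⟨trivial, by omega, by omega⟩, ⟨⟨⟨h.out, h.tape, ?_⟩, ?_, ?_⟩, ?_, h.dp, ?_, hl,
        fun j hj => h.bits' j (by omega) hj, h.perm⟩⟩
      · intro i; simp [h.pos]
      · simp [h.n]
      · simp [h.W]
      · simp [h.K]
      · simp [pow_succ]; ring
  refine ((h₁ Y _ (SplitInv N Kf A 0) ?_).seq ((h₂ _ Y
    (κ₃ * lg Y + (κ₄ * (6 * (Y * lg Y)) + κ₅ * lg Y)) Kf (fun s => ∃ l, SplitInv N Kf A l s)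
    (fun s => (s.var .K).toNat) ?_ ?_).mono le_rfl (fun s hs => ⟨_, hs⟩) (fun s hs => hs))).mono
    ?_ (fun _ h => h) ?_
  · rintro s h
    simp only [Stm.wp, Exp.Bd, Exp.eval, h.n]
    refine ⟨⟨by omega, by omega⟩, ⟨⟨⟨h.out, h.tape, ?_⟩, ?_, ?_⟩, ?_, h.dp, ?_, by omega,
      ?_, h.perm⟩⟩
    · intro i; simp [h.pos]
    · simp [h.n]
    · simp [h.W]
    · simp [h.K]
    · simp
    · intro j hj
      have hj : j < N := by simpa using hj
      have := h.bits j hj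
      rw [if_pos hj] at this
      rw [this, part, ha j hj]
  · rintro s ⟨l, h⟩
    simp only [Exp.Bd, h.K]
    exact ⟨⟨by omega, by omega⟩, by omega⟩
  · rintro d s ⟨⟨l, h⟩, hpos, hd⟩
    simp only [Exp.eval, h.K] at hpos hd
    obtain ⟨s', hd', h'⟩ := hlev l (by omega) s h
    refine ⟨s', hd', ⟨_, h'⟩, ?_⟩
    rw [h'.K]
    omega
  · have e1 : Kf * (κ₃ * lg Y + (κ₄ * (6 * (Y * lg Y)) + κ₅ * lg Y) + κ₂ * lg Y) ≤
        lg Y * (κ₃ * (Y * lg Y) + (κ₄ * (6 * (Y * lg Y)) + κ₅ * (Y * lg Y)) + κ₂ * (Y * lg Y)) := by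
      have : lg Y ≤ Y * lg Y := Nat.le_mul_of_pos_left _ (by omega)
      gcongr
      omega
    have e2 : lg Y ≤ Y * lg Y ^ 2 := by
      rw [pow_two, ← mul_assoc]
      exact Nat.le_mul_of_pos_left _ (Nat.mul_pos (by omega) hYl)
    have e3 := Nat.mul_le_mul_left κ₁ e2
    have e4 := Nat.mul_le_mul_left κ₂ e2
    calc _ ≤ κ₁ * (Y * lg Y ^ 2) + (lg Y * (κ₃ * (Y * lg Y) + (κ₄ * (6 * (Y * lg Y)) +
          κ₅ * (Y * lg Y)) + κ₂ * (Y * lg Y)) + κ₂ * (Y * lg Y ^ 2)) :=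
          Nat.add_le_add e3 (Nat.add_le_add e1 e4)
      _ = _ := by ring
  · rintro s ⟨⟨l, h⟩, hle⟩
    have h1 := h.l_le
    simp only [Exp.eval, h.K] at hle
    obtain rfl : l = Kf := by omega
    exact h

end ThreeSum

/-! ### Radix sort -/

namespace ThreeSum

open While

variable {k : ℕ}

/-- The array `f` contains the list `L` from position `o` on. -/
def Holds (f : ℤ → ℤ) (o : ℤ) (L : List ℕ) : Prop :=
  ∀ (i : ℕ) (h : i < L.length), f (o + i) = L[i]

theorem Holds.append {f : ℤ → ℤ} {o p : ℤ} {L : List ℕ} (h : Holds f o L) (x : ℕ)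
    (hp : p = o + L.length) : Holds (Function.update f p x) o (L ++ [x]) := by
  intro i hi
  rw [List.length_append, List.length_singleton] at hi
  rcases (Nat.lt_succ_iff.mp hi).lt_or_eq with hi | rfl
  · rw [Function.update_of_ne (by omega), h i hi, List.getElem_append_left hi]
  · simp [hp]

theorem Holds.update {f : ℤ → ℤ} {o p : ℤ} {L : List ℕ} (h : Holds f o L) (z : ℤ)
    (hp : p < o ∨ o + L.length ≤ p) : Holds (Function.update f p z) o L := by
  intro i hi
  rw [Function.update_of_ne (by omega), h i hi]

/-- A stable partition by one bit. -/
def pass (A : ℕ → ℕ) (l : ℕ) (L : List ℕ) : List ℕ :=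
  L.filter (fun x => A x / 2 ^ l % 2 = 0) ++ L.filter (fun x => A x / 2 ^ l % 2 = 1)

/-- Radix sort of `0, …, N - 1` by the lowest `l` bits of `A`. -/
def radix (A : ℕ → ℕ) (N : ℕ) : ℕ → List ℕ
  | 0 => List.range N
  | l + 1 => pass A l (radix A N l)

theorem pass_perm (A : ℕ → ℕ) (l : ℕ) (L : List ℕ) : (pass A l L).Perm L := by
  have : (fun x => decide (A x / 2 ^ l % 2 = 1)) = fun x => !decide (A x / 2 ^ l % 2 = 0) := by
    funext x
    rcases Nat.mod_two_eq_zero_or_one (A x / 2 ^ l) with h | h <;> simp [h]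
  rw [pass, this]
  exact List.filter_append_perm _ L

theorem radix_perm (A : ℕ → ℕ) (N : ℕ) : ∀ l, (radix A N l).Perm (List.range N)
  | 0 => List.Perm.refl _
  | l + 1 => (pass_perm A l _).trans (radix_perm A N l)

theorem radix_length (A : ℕ → ℕ) (N l : ℕ) : (radix A N l).length = N := by
  rw [(radix_perm A N l).length_eq, List.length_range]

theorem mem_radix {A : ℕ → ℕ} {N l x : ℕ} : x ∈ radix A N l ↔ x < N := by
  rw [(radix_perm A N l).mem_iff, List.mem_range]

/-- The residue modulo `2 ^ (l + 1)` is the residue modulo `2 ^ l` plus `2 ^ l` times bit `l`. A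
partition by that bit which keeps the order inside each class therefore extends the sorting by one
bit. -/
theorem radix_sorted (A : ℕ → ℕ) (N : ℕ) :
    ∀ l, (radix A N l).Pairwise fun x y => A x % 2 ^ l ≤ A y % 2 ^ l
  | 0 => List.pairwise_of_forall fun _ _ => by simp [Nat.mod_one]
  | l + 1 => by
    have key : ∀ x, A x % 2 ^ (l + 1) = A x % 2 ^ l + 2 ^ l * (A x / 2 ^ l % 2) := fun x => by
      rw [pow_succ, Nat.mod_mul]
    have hlt : ∀ x, A x % 2 ^ l < 2 ^ l := fun x => Nat.mod_lt _ (by positivity)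
    have ih := radix_sorted A N l
    rw [radix, pass, List.pairwise_append]
    refine ⟨?_, ?_, ?_⟩
    · rw [List.pairwise_filter]
      refine ih.imp fun {x y} h hx hy => ?_
      simp only [decide_eq_true_eq] at hx hy
      rw [key, key, hx, hy]; omega
    · rw [List.pairwise_filter]
      refine ih.imp fun {x y} h hx hy => ?_
      simp only [decide_eq_true_eq] at hx hy
      rw [key, key, hx, hy]; omega
    · intro x hx y hy
      simp only [List.mem_filter, decide_eq_true_eq] at hx hy
      rw [key, key, hx.2, hy.2]
      have := hlt x
      omega

/-- What has been copied after `j` steps of a pass. -/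
def partial_pass (A : ℕ → ℕ) (l N : ℕ) (L : List ℕ) (j : ℕ) : List ℕ :=
  (L.take j).filter (fun x => A x / 2 ^ l % 2 = 0) ++
    (L.take (j - N)).filter (fun x => A x / 2 ^ l % 2 = 1)

/-- The index runs through the list twice, collecting zeros in the first sweep and ones in the
second. During the first sweep the truncated difference `j - N` is zero, so one formula describes
both. -/
theorem partial_pass_two_mul (A : ℕ → ℕ) (l : ℕ) (L : List ℕ) :
    partial_pass A l L.length L (2 * L.length) = pass A l L := by
  rw [partial_pass, List.take_of_length_le (by omega), List.take_of_length_le (by omega), pass]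

theorem partial_pass_succ_of_lt (A : ℕ → ℕ) (l : ℕ) (L : List ℕ) (j : ℕ) (h : j < L.length) :
    partial_pass A l L.length L (j + 1) = if A L[j] / 2 ^ l % 2 = 0 then
      partial_pass A l L.length L j ++ [L[j]] else partial_pass A l L.length L j := by
  rw [partial_pass, partial_pass, show j + 1 - L.length = 0 by omega,
    show j - L.length = 0 by omega, List.take_succ_eq_append_getElem h, List.filter_append]
  split_ifs with h0 <;> simp [h0]

theorem partial_pass_succ_of_le (A : ℕ → ℕ) (l : ℕ) (L : List ℕ) (j : ℕ) (h : j < L.length) :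
    partial_pass A l L.length L (L.length + j + 1) = if A L[j] / 2 ^ l % 2 = 1 then
      partial_pass A l L.length L (L.length + j) ++ [L[j]]
      else partial_pass A l L.length L (L.length + j) := by
  have h1 : L.take (L.length + j + 1) = L := List.take_of_length_le (by omega)
  have h2 : L.take (L.length + j) = L := List.take_of_length_le (by omega)
  rw [partial_pass, partial_pass, h1, h2, show L.length + j + 1 - L.length = j + 1 by omega,
    show L.length + j - L.length = j by omega, List.take_succ_eq_append_getElem h,
    List.filter_append]
  split_ifs with h0 <;> simp [h0]

/-- The bit that is looked at. -/
def theBit : Exp (Var k) (Arr k) :=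
  .get .bits (.add (.mul (v .x) (v .W)) (.sub (.sub (v .W) (.lit 1)) (v .l)))

/-- Copy the current item. -/
def copyItem : Stm (Var k) (Arr k) :=
  sq (.put .perm (.add (.mul (.add (v .l) (.lit 1)) (v .n)) (v .w)) (v .x))
    (.set .w (.add (v .w) (.lit 1)))

/-- One step of a pass of radix sort. -/
def passBody : Stm (Var k) (Arr k) :=
  sq (.ite (.sub (v .n) (v .j))
    (sq (.set .x (.get .perm (.add (.mul (v .l) (v .n)) (v .j))))
      (.ite (.sub (.lit 1) theBit) copyItem .skip))
    (sq (.set .x (.get .perm (.add (.mul (v .l) (v .n)) (.sub (v .j) (v .n)))))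
      (.ite theBit copyItem .skip)))
    (.set .j (.add (v .j) (.lit 1)))

/-- The initialisation of a pass. -/
def passInit : Stm (Var k) (Arr k) := sq (.set .j (.lit 0)) (.set .w (.lit 0))

/-- The fourth phase: radix sort. -/
def sorting : Stm (Var k) (Arr k) :=
  sq (.set .l (.lit 0)) (.loop (.sub (v .W) (v .l)) (sq passInit
    (sq (.loop (.sub (.mul (.lit 2) (v .n)) (v .j)) passBody) (.set .l (.add (v .l) (.lit 1))))))

/-- The invariant of radix sort. -/
structure SortInv (N Wn : ℕ) (A : ℕ → ℕ) (lev : ℕ) (s : St (Var k) (Arr k)) : Prop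
    extends Base N Wn s where
  l : s.var .l = lev
  l_le : lev ≤ Wn
  bits : ∀ x < N, ∀ b < Wn, s.arr .bits ((x * Wn + b : ℕ) : ℤ) = (A x / 2 ^ (Wn - 1 - b) % 2 : ℕ)
  perm : Holds (s.arr .perm) (lev * N) (radix A N lev)

/-- The invariant of one pass. -/
structure PassInv (N Wn : ℕ) (A : ℕ → ℕ) (lev jn : ℕ) (s : St (Var k) (Arr k)) : Prop
    extends SortInv N Wn A lev s where
  j : s.var .j = jn
  j_le : jn ≤ 2 * N
  w : s.var .w = (partial_pass A lev N (radix A N lev) jn).length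
  perm' : Holds (s.arr .perm) ((lev + 1) * N) (partial_pass A lev N (radix A N lev) jn)

theorem theBit_eval {N W l x : ℕ} {A : ℕ → ℕ} {s : St (Var k) (Arr k)} (h : SortInv N W A l s)
    (hl : l < W) (hs : s.var .x = x) (hx : x < N) :
    theBit.eval s = (A x / 2 ^ l % 2 : ℕ) ∧ theBit.Bd s (2 * (N * W)) := by
  have hNW : 1 ≤ N * W := Nat.mul_pos (by omega) (by omega)
  have hW : W ≤ N * W := Nat.le_mul_of_pos_left _ (by omega)
  have hN : N ≤ N * W := Nat.le_mul_of_pos_right _ (by omega)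
  have e : (x : ℤ) * W + (W - 1 - l) = ((x * W + (W - 1 - l) : ℕ) : ℤ) := by
    push_cast
    omega
  have hb := h.bits x hx (W - 1 - l) (by omega)
  rw [show W - 1 - (W - 1 - l) = l by omega] at hb
  have hlt : x * W + (W - 1 - l) ≤ N * W := by
    have : x * W + W ≤ N * W := by
      rw [← Nat.succ_mul]; exact Nat.mul_le_mul_right _ hx
    omega
  simp only [theBit, Exp.eval, Exp.Bd, h.W, h.l, hs]
  rw [e, hb]
  refine ⟨rfl, ⟨⟨⟨by omega, by omega⟩, by omega, by omega⟩, ⟨⟨by omega, by omega⟩, trivial⟩,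
    by omega, by omega⟩, ⟨by omega, by omega⟩, by omega, ?_⟩
  have := Nat.mod_lt (A x / 2 ^ l) two_pos
  omega

/-- Pass `l` reads the row of `perm` starting at `l * N` and appends to the next row. As rows have
length `N`, the row being read is not disturbed, and nothing is copied back. -/
theorem copyItem_wp {N W l x : ℕ} {A : ℕ → ℕ} {s : St (Var k) (Arr k)} {P : List ℕ}
    (h : SortInv N W A l s) (hl : l < W) (hs : s.var .x = x) (hx : x < N)
    (hw : s.var .w = P.length) (hP : P.length ≤ 2 * N) (h' : Holds (s.arr .perm) ((l + 1) * N) P) :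
    copyItem.wp (2 * (N * W)) (fun s' => SortInv N W A l s' ∧ s'.var .j = s.var .j ∧
      s'.var .w = (P ++ [x]).length ∧ Holds (s'.arr .perm) ((l + 1) * N) (P ++ [x])) s := by
  have hNW : 1 ≤ N * W := Nat.mul_pos (by omega) (by omega)
  have hW : W ≤ N * W := Nat.le_mul_of_pos_left _ (by omega)
  have hN : N ≤ N * W := Nat.le_mul_of_pos_right _ (by omega)
  simp only [copyItem, Exp.eval, Exp.Bd, Stm.wp, h.l, hs, hw, h.n]
  refine ⟨⟨⟨⟨⟨by omega, by omega⟩, trivial⟩, by omega, by omega⟩, by omega, by omega⟩,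
    ⟨by omega, by omega⟩, ⟨⟨by omega, by omega⟩, trivial⟩,
    ⟨⟨⟨h.out, ?_, ?_⟩, ?_, ?_⟩, ?_, h.l_le, ?_, ?_⟩, ?_, ?_, ?_⟩
  · intro i p; simp [h.tape]
  · intro i; simp [h.pos]
  · simp [h.n]
  · simp [h.W]
  · simp [h.l]
  · intro x hx b hb; simp only [ne_eq, reduceCtorEq, not_false_eq_true, Function.update_of_ne]
    exact h.bits x hx b hb
  · simp only [Function.update_self]
    refine h.perm.update _ (Or.inr ?_)
    rw [radix_length, add_mul]
    omega
  · simp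
  · simp
  · simp only [Function.update_self]
    exact h'.append x rfl

theorem passBody_wp {N W l j : ℕ} {A : ℕ → ℕ} {s : St (Var k) (Arr k)}
    (h : PassInv N W A l j s) (hl : l < W) (hj : j < 2 * N) :
    passBody.wp (2 * (N * W)) (PassInv N W A l (j + 1)) s := by
  have hNW : 1 ≤ N * W := Nat.mul_pos (by omega) (by omega)
  have hW : W ≤ N * W := Nat.le_mul_of_pos_left _ (by omega)
  have hN : N ≤ N * W := Nat.le_mul_of_pos_right _ (by omega)
  have hlen := radix_length A N l
  have hlN : l * N + N ≤ N * W := by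
    rw [← Nat.succ_mul, mul_comm N]; exact Nat.mul_le_mul_right _ hl
  have hPl : (partial_pass A l N (radix A N l) j).length ≤ 2 * N := by
    rw [partial_pass, List.length_append]
    have h1 := (List.length_filter_le (fun x => A x / 2 ^ l % 2 = 0) ((radix A N l).take j)).trans
      (List.length_take_le' _ _)
    have h2 := (List.length_filter_le (fun x => A x / 2 ^ l % 2 = 1)
      ((radix A N l).take (j - N))).trans (List.length_take_le' _ _)
    omega
  have fin : ∀ (P : List ℕ) (s' : St (Var k) (Arr k)),
      P = partial_pass A l N (radix A N l) (j + 1) → (SortInv N W A l s' ∧ s'.var .j = s.var .j ∧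
      s'.var .w = P.length ∧ Holds (s'.arr .perm) ((l + 1) * N) P) →
      (Stm.set .j (.add (v .j) (.lit 1))).wp (2 * (N * W)) (PassInv N W A l (j + 1)) s' := by
    rintro P s' rfl ⟨g1, g2, g3, g4⟩
    simp only [Exp.eval, Exp.Bd, Stm.wp, g2, h.j]
    refine ⟨⟨⟨by omega, by omega⟩, trivial⟩, ⟨⟨⟨g1.out, g1.tape, ?_⟩, ?_, ?_⟩, ?_, h.l_le, g1.bits,
      g1.perm⟩, ?_, by omega, ?_, g4⟩
    · intro i; simp [g1.pos]
    · simp [g1.n]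
    · simp [g1.W]
    · simp [g1.l]
    · simp
    · simp [g3]
  have setx : ∀ x : ℕ, SortInv N W A l { s with var := Function.update s.var .x (x : ℤ) } := by
    intro x
    refine ⟨⟨⟨h.out, h.tape, ?_⟩, ?_, ?_⟩, ?_, h.l_le, h.bits, h.perm⟩
    · intro i; simp [h.pos]
    · simp [h.n]
    · simp [h.W]
    · simp [h.l]
  simp only [passBody, Stm.wp, Exp.eval, Exp.Bd, h.n, h.j, h.l]
  refine ⟨⟨⟨by omega, by omega⟩, by omega, by omega⟩, fun hlt => ?_, fun hge => ?_⟩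
  · have hjN : j < N := by omega
    have hjL : j < (radix A N l).length := by omega
    have hp := h.perm j hjL
    have hxN : (radix A N l)[j] < N := mem_radix.mp (List.getElem_mem hjL)
    have hsucc := partial_pass_succ_of_lt A l (radix A N l) j hjL
    rw [hlen] at hsucc
    rw [hp]
    set x := (radix A N l)[j] with hx
    obtain ⟨hb, hB⟩ := theBit_eval (setx x) hl (by simp) hxN
    have e : (l : ℤ) * N + j = (l * N + j : ℕ) := by push_cast; ring
    refine ⟨⟨⟨⟨⟨by omega, by omega⟩, by omega, by omega⟩, by omega, by omega⟩,
      ⟨by omega, by omega⟩, by omega, by omega⟩, ⟨trivial, hB⟩, fun h0 => ?_, fun h1 => ?_⟩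
    · rw [hb] at h0
      rw [if_pos (by omega)] at hsucc
      exact Stm.wp_mono _ (copyItem_wp (setx x) hl (by simp) hxN (by simpa using h.w) hPl h.perm')
        fun s' hs' => fin _ s' hsucc.symm ⟨hs'.1, by simpa using hs'.2.1, hs'.2.2⟩
    · rw [hb] at h1
      rw [if_neg (by omega)] at hsucc
      exact fin _ _ hsucc.symm ⟨setx x, by simp, by simpa using h.w, h.perm'⟩
  · obtain ⟨j', rfl⟩ : ∃ j', j = N + j' := ⟨j - N, by omega⟩
    have hjL : j' < (radix A N l).length := by omega
    have hp := h.perm j' hjL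
    have hxN : (radix A N l)[j'] < N := mem_radix.mp (List.getElem_mem hjL)
    have hsucc := partial_pass_succ_of_le A l (radix A N l) j' hjL
    rw [hlen] at hsucc
    rw [show (l : ℤ) * N + ((N + j' : ℕ) - N) = l * N + j' by push_cast; ring, hp]
    set x := (radix A N l)[j'] with hx
    obtain ⟨hb, hB⟩ := theBit_eval (setx x) hl (by simp) hxN
    have e : (l : ℤ) * N + j' = (l * N + j' : ℕ) := by push_cast; ring
    refine ⟨⟨⟨⟨⟨by omega, by omega⟩, by omega, by omega⟩, ⟨by omega, by omega⟩, by omega, by omega⟩,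
      ⟨by omega, by omega⟩, by omega, by omega⟩, hB, fun h0 => ?_, fun h1 => ?_⟩
    · rw [hb] at h0
      rw [if_pos (by omega)] at hsucc
      exact Stm.wp_mono _ (copyItem_wp (setx x) hl (by simp) hxN (by simpa using h.w) hPl h.perm')
        fun s' hs' => fin _ s' hsucc.symm ⟨hs'.1, by simpa using hs'.2.1, hs'.2.2⟩
    · rw [hb] at h1
      rw [if_neg (by omega)] at hsucc
      exact fin _ _ hsucc.symm ⟨setx x, by simp, by simpa using h.w, h.perm'⟩

/-- There are `2 ^ Kf` passes of `2 * N` steps, each handling indices and single bits only, so the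
cost is linear in the number of bits up to a logarithm. -/
theorem sorting_meets (k : ℕ) : ∃ κ, ∀ (N Kf : ℕ) (A : ℕ → ℕ), 1 ≤ N → (∀ x, A x < 2 ^ 2 ^ Kf) →
    Meets (nm k) sorting (SplitInv N Kf A Kf) (SortInv N (2 ^ Kf) A (2 ^ Kf))
      (κ * (N * 2 ^ Kf * lg (2 * (N * 2 ^ Kf)))) := by
  obtain ⟨κ₁, h₁⟩ := Meets.of_wp (nm k) (.set .l (.lit 0))
  obtain ⟨κ₂, h₂⟩ := Meets.loop (nm k) (.sub (v .W) (v .l))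
  obtain ⟨κ₃, h₃⟩ := Meets.of_wp (nm k) passInit
  obtain ⟨κ₄, h₄⟩ := Meets.loop_wp (nm k) (.sub (.mul (.lit 2) (v .n)) (v .j)) passBody
  obtain ⟨κ₅, h₅⟩ := Meets.of_wp (nm k) (.set .l (.add (v .l) (.lit 1)))
  refine ⟨κ₁ + (κ₃ + (3 * κ₄ + κ₅) + 2 * κ₂), fun N Kf A hN hA => ?_⟩
  obtain ⟨W, hW⟩ : ∃ W, W = 2 ^ Kf := ⟨_, rfl⟩
  have hW1 : 1 ≤ W := hW ▸ Nat.one_le_two_pow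
  have hNW : 1 ≤ N * W := Nat.mul_pos (by omega) (by omega)
  have hWN : W ≤ N * W := Nat.le_mul_of_pos_left _ (by omega)
  have hNN : N ≤ N * W := Nat.le_mul_of_pos_right _ (by omega)
  have hlev : ∀ l < W, Meets (nm k) (sq passInit (sq (.loop (.sub (.mul (.lit 2) (v .n)) (v .j))
      passBody) (.set .l (.add (v .l) (.lit 1))))) (SortInv N W A l) (SortInv N W A (l + 1))
      (κ₃ * lg (2 * (N * W)) + (κ₄ * ((2 * N + 1) * lg (2 * (N * W))) + κ₅ * lg (2 * (N * W)))) := by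
    intro l hl
    refine (h₃ (2 * (N * W)) _ (PassInv N W A l 0) ?_).seq
      (((h₄ (2 * (N * W)) (2 * N) (fun s => ∃ j, PassInv N W A l j s)
      (fun s => (2 * N - s.var .j).toNat) ?_ ?_).mono le_rfl
      (fun s hs => ⟨_, hs⟩) (fun s hs => hs)).seq (h₅ (2 * (N * W)) _ _ ?_))
    · rintro s h
      simp only [passInit, Stm.wp, Exp.Bd, Exp.eval]
      refine ⟨trivial, trivial, ⟨⟨⟨h.out, h.tape, ?_⟩, ?_, ?_⟩, ?_, h.l_le, h.bits, h.perm⟩,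
        ?_, by omega, ?_, ?_⟩
      · intro i; simp [h.pos]
      · simp [h.n]
      · simp [h.W]
      · simp [h.l]
      · simp
      · simp [partial_pass]
      · simp [partial_pass, Holds]
    · rintro s ⟨j, h⟩
      have := h.j_le
      simp only [Exp.Bd, h.n, h.j]
      exact ⟨⟨⟨trivial, by omega, by omega⟩, by omega, by omega⟩, by omega⟩
    · rintro s ⟨j, h⟩ hpos
      simp only [Exp.eval, h.n, h.j] at hpos
      refine Stm.wp_mono _ (passBody_wp h hl (by omega)) fun s' h' => ⟨⟨_, h'⟩, ?_⟩
      rw [h'.j, h.j]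
      omega
    · rintro s ⟨⟨j, h⟩, hle⟩
      have := h.j_le
      simp only [Exp.eval, h.n, h.j] at hle
      obtain rfl : j = 2 * N := by omega
      simp only [Stm.wp, Exp.Bd, Exp.eval, h.l]
      refine ⟨⟨⟨by omega, by omega⟩, trivial⟩, ⟨⟨h.out, h.tape, ?_⟩, ?_, ?_⟩, ?_, by omega, h.bits, ?_⟩
      · intro i; simp [h.pos]
      · simp [h.n]
      · simp [h.W]
      · simp
      · have h1 := partial_pass_two_mul A l (radix A N l)
        rw [radix_length] at h1
        have h2 := h.perm'
        rw [h1] at h2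
        push_cast
        exact h2
  rw [← hW]
  refine ((h₁ (2 * (N * W)) _ (SortInv N W A 0) ?_).seq ((h₂ _ (2 * (N * W))
    (κ₃ * lg (2 * (N * W)) + (κ₄ * ((2 * N + 1) * lg (2 * (N * W))) + κ₅ * lg (2 * (N * W))))
    W (fun s => ∃ l, SortInv N W A l s)
    (fun s => (W - s.var .l).toNat) ?_ ?_).mono le_rfl (fun s hs => ⟨_, hs⟩) (fun s hs => hs))).mono
    ?_ (fun _ h => h) ?_
  · rintro s h
    simp only [Stm.wp, Exp.Bd, Exp.eval]
    refine ⟨trivial, ⟨⟨h.out, h.tape, ?_⟩, ?_, ?_⟩, ?_, by omega, ?_, ?_⟩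
    · intro i; simp [h.pos]
    · simp [h.n]
    · simp [h.W, hW]
    · simp
    · intro x hx b hb
      rw [hW] at hb ⊢
      have h1 : x * 2 ^ Kf + b < N * 2 ^ Kf := by
        have : x * 2 ^ Kf + 2 ^ Kf ≤ N * 2 ^ Kf := by
          rw [← Nat.succ_mul]; exact Nat.mul_le_mul_right _ hx
        omega
      have h2 := h.bits _ h1
      rw [part_eq A Kf Kf le_rfl x b hA hb] at h2
      simpa using h2
    · intro i hi
      have hi : i < N := by simpa [radix] using hi
      simpa [radix] using h.perm i hi
  · rintro s ⟨l, h⟩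
    have := h.l_le
    simp only [Exp.Bd, h.W, h.l]
    exact ⟨⟨⟨by omega, by omega⟩, by omega, by omega⟩, by omega⟩
  · rintro d s ⟨⟨l, h⟩, hpos, hd⟩
    simp only [Exp.eval, h.W, h.l] at hpos hd
    obtain ⟨s', hd', h'⟩ := hlev l (by omega) s h
    refine ⟨s', hd', ⟨_, h'⟩, ?_⟩
    rw [h'.l]
    omega
  · set Λ := lg (2 * (N * W))
    have e1 : W * (κ₃ * Λ + (κ₄ * ((2 * N + 1) * Λ) + κ₅ * Λ) + κ₂ * Λ) ≤
        W * (κ₃ * (N * Λ) + (κ₄ * ((3 * N) * Λ) + κ₅ * (N * Λ)) + κ₂ * (N * Λ)) := by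
      have : Λ ≤ N * Λ := Nat.le_mul_of_pos_left _ (by omega)
      gcongr
      omega
    have e2 : Λ ≤ N * W * Λ := Nat.le_mul_of_pos_left _ (by omega)
    have e3 := Nat.mul_le_mul_left κ₁ e2
    have e4 := Nat.mul_le_mul_left κ₂ e2
    calc _ ≤ κ₁ * (N * W * Λ) + (W * (κ₃ * (N * Λ) + (κ₄ * ((3 * N) * Λ) + κ₅ * (N * Λ)) +
          κ₂ * (N * Λ)) + κ₂ * (N * W * Λ)) :=
          Nat.add_le_add e3 (Nat.add_le_add e1 e4)
      _ = _ := by ring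
  · rintro s ⟨⟨l, h⟩, hle⟩
    have h1 := h.l_le
    simp only [Exp.eval, h.W, h.l] at hle
    obtain rfl : l = W := by omega
    exact h

end ThreeSum

/-! ### Computing the length of the word and writing it -/

namespace ThreeSum

open While

variable {k : ℕ}

/-- The length of the padded word, divided by five. -/
def width (p q N W : ℕ) : ℕ := (2 ^ p) ^ Nat.clog (2 ^ (q + 1)) N + N * W + N

/-- One step of the computation of the powers. -/
def scaleBody (p q : ℕ) : Stm (Var k) (Arr k) :=
  sq (.set .y (.mul (v .y) (.lit (2 ^ (q + 1))))) (.set .z (.mul (v .z) (.lit (2 ^ p))))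

/-- The fifth phase: compute the length of the word. -/
def scaling (p q : ℕ) : Stm (Var k) (Arr k) :=
  sq (sq (.set .y (.lit 1)) (.set .z (.lit 1)))
    (sq (.loop (.sub (v .n) (v .y)) (scaleBody p q))
      (.set .T (.add (.add (v .z) (.mul (v .n) (v .W))) (v .n))))

/-- The invariant of the fifth phase. -/
structure ScaleInv (p q N Wn : ℕ) (A : ℕ → ℕ) (g : ℕ) (s : St (Var k) (Arr k)) : Prop
    extends SortInv N Wn A Wn s where
  y : s.var .y = ((2 ^ (q + 1)) ^ g : ℕ)
  z : s.var .z = ((2 ^ p) ^ g : ℕ)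
  g_le : g ≤ Nat.clog (2 ^ (q + 1)) N

/-- In `width` the power of `2 ^ p` makes the word long enough for the machine to complete `Nat.clog
(2 ^ (q + 1)) N` rounds, hence to guess at least `log₂ N` bits; the other summands make room for the
list and for the clock. Both powers are computed in one loop, since the exponent is found by
comparing with `N`. -/
theorem scaling_meets (k p q : ℕ) : ∃ κ, ∀ (N W X : ℕ) (A : ℕ → ℕ), 2 ≤ N →
    2 ^ (q + 1) * N + width p q N W ≤ X → W ≤ X →
    Meets (nm k) (scaling p q) (SortInv N W A W)
      (fun s => SortInv N W A W s ∧ s.var .T = width p q N W) (κ * ((N + 1) * lg X)) := by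
  obtain ⟨κ₁, h₁⟩ := Meets.of_wp (nm k) (sq (.set .y (.lit 1)) (.set .z (.lit 1)))
  obtain ⟨κ₂, h₂⟩ := Meets.loop_wp (nm k) (.sub (v .n) (v .y)) (scaleBody p q)
  obtain ⟨κ₃, h₃⟩ := Meets.of_wp (nm k) (.set .T (.add (.add (v .z) (.mul (v .n) (v .W))) (v .n)))
  refine ⟨κ₁ + (κ₂ + κ₃), fun N W X A hN hX hWX => ?_⟩
  have hb : 1 < 2 ^ (q + 1) := Nat.one_lt_two_pow (by omega)
  have hNX : N ≤ X := by
    have : N ≤ 2 ^ (q + 1) * N := Nat.le_mul_of_pos_left _ (by omega)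
    omega
  -- The powers of `2 ^ (q + 1)` may overshoot `N` by one factor at most, whence the summand `2 ^ (q
  -- + 1) * N` in the bound.
  have hyX : ∀ g ≤ Nat.clog (2 ^ (q + 1)) N, (2 ^ (q + 1)) ^ g ≤ X := by
    intro g hg
    rcases g with _ | g
    · rw [pow_zero]; omega
    · have := Nat.pow_lt_of_lt_clog (b := 2 ^ (q + 1)) (y := g) (x := N) (by omega)
      rw [pow_succ']
      have := Nat.mul_le_mul_left (2 ^ (q + 1)) this.le
      omega
  have hzX : ∀ g ≤ Nat.clog (2 ^ (q + 1)) N, (2 ^ p) ^ g ≤ X := by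
    intro g hg
    have : (2 ^ p) ^ g ≤ (2 ^ p) ^ Nat.clog (2 ^ (q + 1)) N := Nat.pow_le_pow_right (by positivity) hg
    unfold width at hX
    omega
  refine ((h₁ X _ (ScaleInv p q N W A 0) ?_).seq (((h₂ X N (fun s => ∃ g, ScaleInv p q N W A g s)
    (fun s => (N - s.var .y).toNat) ?_ ?_).mono le_rfl
    (fun s hs => ⟨_, hs⟩) (fun s hs => hs)).seq (h₃ X _ _ ?_))).mono ?_ (fun _ h => h) (fun _ h => h)
  · rintro s h
    simp only [Stm.wp, Exp.Bd, Exp.eval]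
    refine ⟨trivial, trivial, ⟨⟨⟨h.out, h.tape, ?_⟩, ?_, ?_⟩, ?_, h.l_le, h.bits, h.perm⟩,
      ?_, ?_, by omega⟩
    · intro i; simp [h.pos]
    · simp [h.n]
    · simp [h.W]
    · simp [h.l]
    · simp
    · simp
  · rintro s ⟨g, h⟩
    have h1 := hyX g h.g_le
    simp only [Exp.Bd, h.n, h.y]
    exact ⟨⟨⟨by omega, by omega⟩, by omega, by omega⟩, by omega⟩
  · rintro s ⟨g, h⟩ hpos
    simp only [Exp.eval, h.n, h.y] at hpos
    have h1 := hyX g h.g_le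
    have h2 := hzX g h.g_le
    have hlt : (2 ^ (q + 1)) ^ g < N := by omega
    simp only [scaleBody, Stm.wp, Exp.Bd, Exp.eval, ne_eq, reduceCtorEq, not_false_eq_true,
      Function.update_of_ne, h.y, h.z]
    refine ⟨⟨⟨by omega, by omega⟩, trivial⟩, ⟨⟨by omega, by omega⟩, trivial⟩, ⟨g + 1,
      ⟨⟨⟨h.out, h.tape, ?_⟩, ?_, ?_⟩, ?_, h.l_le, h.bits, h.perm⟩, ?_, ?_, ?_⟩, ?_⟩
    · intro i; simp [h.pos]
    · simp [h.n]
    · simp [h.W]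
    · simp [h.l]
    · simp [pow_succ]
    · simp [pow_succ]
    · exact (Nat.lt_clog_iff_pow_lt hb).mpr hlt
    · simp only [Function.update_self]
      have h3 : (2 ^ (q + 1)) ^ g < (2 ^ (q + 1)) ^ g * 2 ^ (q + 1) :=
        lt_mul_of_one_lt_right (by positivity) hb
      zify at h3 hlt ⊢
      omega
  · rintro s ⟨⟨g, h⟩, hle⟩
    simp only [Exp.eval, h.n, h.y] at hle
    have hg : g = Nat.clog (2 ^ (q + 1)) N :=
      le_antisymm h.g_le ((Nat.clog_le_iff_le_pow hb).mpr (by omega))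
    have h2 := hzX g h.g_le
    simp only [Stm.wp, Exp.Bd, Exp.eval, h.n, h.W, h.z]
    refine ⟨⟨⟨⟨by omega, by omega⟩, ⟨by omega, by omega⟩, by omega, by omega⟩, by omega, by omega⟩,
      ⟨⟨⟨h.out, h.tape, ?_⟩, ?_, ?_⟩, ?_, h.l_le, h.bits, h.perm⟩, ?_⟩
    · intro i; simp [h.pos]
    · simp [h.n]
    · simp [h.W]
    · simp [h.l]
    · simp [width, hg]
  · have e2 : lg X ≤ (N + 1) * lg X := Nat.le_mul_of_pos_left _ (by omega)
    have e3 := Nat.mul_le_mul_left κ₁ e2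
    have e4 := Nat.mul_le_mul_left κ₃ e2
    calc _ ≤ κ₁ * ((N + 1) * lg X) + (κ₂ * ((N + 1) * lg X) + κ₃ * ((N + 1) * lg X)) := by omega
      _ = _ := by ring

/-- The bits of the sorted numbers, most significant first. -/
def sortedBit (A : ℕ → ℕ) (N W i b : ℕ) : Bool :=
  decide (A ((radix A N W).getD i 0) / 2 ^ (W - 1 - b) % 2 = 1)

theorem toNat_decide_mod_two (m : ℕ) : (decide (m % 2 = 1)).toNat = m % 2 := by
  rcases Nat.mod_two_eq_zero_or_one m with h | h <;> simp [h]

/-- Compute the five letters of a cell, unless the cell is padding. -/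
def cellCalc : Stm (Var k) (Arr k) :=
  sq (.set .i (.div (v .t) (v .W)))
    (sq (.set .j (.sub (v .t) (.mul (v .i) (v .W))))
      (sq (.ite (.sub (.lit 1) (v .j)) (.set .z (v .i)) .skip)
        (sq (.set .x (.get .perm (.add (.mul (v .W) (v .n)) (v .i))))
          (sq (.set .y (.get .bits (.add (.mul (v .x) (v .W)) (v .j))))
            (sq (.set .x (.get .perm (.add (.mul (v .W) (v .n)) (.sub (.sub (v .n) (.lit 1)) (v .i)))))
              (sq (.set .off (.get .bits (.add (.mul (v .x) (v .W)) (v .j))))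
                (sq (.set .cnt (.div (.add (v .j) (.lit 1)) (v .W)))
                  (sq (.set .w (.sub (v .z) (.mul (.lit 2) (.div (v .z) (.lit 2)))))
                    (sq (.set .z (.div (v .z) (.lit 2)))
                      (.ite (.sub (.sub (v .n) (.lit 1)) (v .t))
                        (.set .run (.lit 1)) (.set .run (.lit 0))))))))))))

/-- The five letters of a padding cell. -/
def cellZero : Stm (Var k) (Arr k) :=
  sq (.set .y (.lit 0)) (sq (.set .off (.lit 0)) (sq (.set .cnt (.lit 0))
    (sq (.set .w (.lit 0)) (.set .run (.lit 0)))))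

/-- The code of the letter whose bit is the value of a variable, if the two letters have the codes
`cf` and `ct`. -/
def letterExp (cf ct : ℤ) (u : Var k) : Exp (Var k) (Arr k) :=
  .add (.lit cf) (.mul (.lit (ct - cf)) (v u))

/-- The position of a letter. -/
def posExp (c : ℕ) : Exp (Var k) (Arr k) :=
  .add (.mul (.lit 5) (.sub (.sub (v .T) (.lit 1)) (v .t))) (.lit c)

variable {e : ℕ}

/-- Write the five letters of a cell on the first tape. -/
def cellWrite (cf ct : ℤ) : Stm (Var (e + 1)) (Arr (e + 1)) :=
  sq (.put (.tape 0) (posExp 0) (letterExp cf ct .y))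
    (sq (.put (.tape 0) (posExp 1) (letterExp cf ct .off))
      (sq (.put (.tape 0) (posExp 2) (letterExp cf ct .cnt))
        (sq (.put (.tape 0) (posExp 3) (letterExp cf ct .w))
          (sq (.put (.tape 0) (posExp 4) (letterExp cf ct .run))
            (.set .t (.add (v .t) (.lit 1)))))))

/-- The sixth phase: write the word on the first tape. -/
def filling (cf ct : ℤ) : Stm (Var (e + 1)) (Arr (e + 1)) :=
  sq (.set .t (.lit 0)) (.loop (.sub (v .T) (v .t))
    (sq (.ite (.sub (.mul (v .n) (v .W)) (v .t)) cellCalc cellZero) (cellWrite cf ct)))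

/-- The part of the invariant that does not depend on the label. -/
structure FillCore (Tn N Wn : ℕ) (A : ℕ → ℕ) (cf ct : ℤ) (tn : ℕ)
    (s : St (Var (e + 1)) (Arr (e + 1))) : Prop where
  out : s.out = []
  pos : ∀ i, s.var (.pos i) = 0
  n : s.var .n = N
  W : s.var .W = Wn
  T : s.var .T = Tn
  t : s.var .t = tn
  t_le : tn ≤ Tn
  bits : ∀ x < N, ∀ b < Wn, s.arr .bits ((x * Wn + b : ℕ) : ℤ) = (A x / 2 ^ (Wn - 1 - b) % 2 : ℕ)
  perm : Holds (s.arr .perm) (Wn * N) (radix A N Wn)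
  tape : ∀ i, i ≠ 0 → ∀ p, s.arr (.tape i) p = 0
  tape_out : ∀ p : ℤ, p < 5 * ((Tn : ℤ) - tn) ∨ 5 * (Tn : ℤ) ≤ p → s.arr (.tape 0) p = 0
  tape_in : ∀ i < tn, ∀ c : ℕ, c < 5 → s.arr (.tape 0) (5 * ((Tn : ℤ) - 1 - i) + c) =
    cf + (ct - cf) * (TripleTM.cellBit N Wn (sortedBit A N Wn) i c).toNat

/-- What is left of the label in the cell `tn`. -/
def LabelAt (N W tn : ℕ) (s : St (Var k) (Arr k)) : Prop :=
  tn < N * W → tn % W ≠ 0 → s.var .z = (tn / W / 2 ^ (tn % W) : ℕ)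

/-- The five letters have been computed. -/
def Letters (N W : ℕ) (A : ℕ → ℕ) (tn : ℕ) (s : St (Var k) (Arr k)) : Prop :=
  s.var .y = (TripleTM.cellBit N W (sortedBit A N W) tn 0).toNat ∧
  s.var .off = (TripleTM.cellBit N W (sortedBit A N W) tn 1).toNat ∧
  s.var .cnt = (TripleTM.cellBit N W (sortedBit A N W) tn 2).toNat ∧
  s.var .w = (TripleTM.cellBit N W (sortedBit A N W) tn 3).toNat ∧
  s.var .run = (TripleTM.cellBit N W (sortedBit A N W) tn 4).toNat

theorem FillCore.of_eq {T N W : ℕ} {A : ℕ → ℕ} {cf ct : ℤ} {tn : ℕ}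
    {s s' : St (Var (e + 1)) (Arr (e + 1))} (h : FillCore T N W A cf ct tn s)
    (ho : s'.out = s.out) (ha : s'.arr = s.arr) (hp : ∀ i, s'.var (.pos i) = s.var (.pos i))
    (hn : s'.var .n = s.var .n) (hW : s'.var .W = s.var .W) (hT : s'.var .T = s.var .T)
    (ht : s'.var .t = s.var .t) : FillCore T N W A cf ct tn s' := by
  refine ⟨ho ▸ h.out, fun i => (hp i).trans (h.pos i), hn ▸ h.n, hW ▸ h.W, hT ▸ h.T, ht ▸ h.t,
    h.t_le, ?_, ?_, ?_, ?_, ?_⟩ <;> rw [ha]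
  exacts [h.bits, h.perm, h.tape, h.tape_out, h.tape_in]

theorem cellZero_wp {T N W X : ℕ} {A : ℕ → ℕ} {cf ct : ℤ} {tn : ℕ}
    {s : St (Var (e + 1)) (Arr (e + 1))} (h : FillCore T N W A cf ct tn s) (ht : N * W ≤ tn) :
    cellZero.wp X (fun s' => FillCore T N W A cf ct tn s' ∧ LabelAt N W (tn + 1) s' ∧
      Letters N W A tn s') s := by
  simp only [cellZero, Stm.wp, Exp.Bd, Exp.eval]
  refine ⟨trivial, trivial, trivial, trivial, trivial, h.of_eq rfl rfl (fun i => by simp)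
    (by simp) (by simp) (by simp) (by simp), fun h' => absurd h' (by omega), ?_⟩
  have : ∀ c, TripleTM.cellBit N W (sortedBit A N W) tn c = false := fun c =>
    if_neg (by omega)
  simp [Letters, this]

/-- The bits of the label come from the variable `z`, which is reset to the index at the beginning
of each entry and halved from cell to cell, so no powers of two are needed. The end flag is `(j + 1)
/ W`, which equals `1` in the last cell of an entry and `0` before. -/
theorem cellCalc_wp {T N W X : ℕ} {A : ℕ → ℕ} {cf ct : ℤ} {tn : ℕ} (hX : N * W + N + W ≤ X)
    (hW : 0 < W)
    {s : St (Var (e + 1)) (Arr (e + 1))} (h : FillCore T N W A cf ct tn s) (ht : tn < N * W)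
    (hz : LabelAt N W tn s) :
    cellCalc.wp X (fun s' => FillCore T N W A cf ct tn s' ∧ LabelAt N W (tn + 1) s' ∧
      Letters N W A tn s') s := by
  obtain ⟨i, r, hr, rfl⟩ : ∃ i r, r < W ∧ tn = i * W + r :=
    ⟨tn / W, tn % W, Nat.mod_lt _ hW, (Nat.div_add_mod' tn W).symm⟩
  have hi : i < N := by
    by_contra hcon
    have := Nat.mul_le_mul_right W (not_lt.mp hcon)
    omega
  have hdiv : (i * W + r) / W = i := by
    rw [mul_comm, Nat.mul_add_div hW, Nat.div_eq_of_lt hr, add_zero]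
  have hmod : (i * W + r) % W = r := by rw [mul_comm, Nat.mul_add_mod, Nat.mod_eq_of_lt hr]
  have hdivZ : ((i * W + r : ℕ) : ℤ) / (W : ℤ) = i := by exact_mod_cast hdiv
  have hmodZ : ((i * W + r : ℕ) : ℤ) - i * W = r := by push_cast; ring
  have hlen := radix_length A N W
  have hx : ∀ i' < N, ∃ x < N, s.arr .perm (W * N + i') = x ∧ x = (radix A N W).getD i' 0 := by
    intro i' hi'
    have hi'' : i' < (radix A N W).length := by omega
    exact ⟨(radix A N W)[i'], mem_radix.mp (List.getElem_mem hi''), h.perm i' hi'',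
      (List.getD_eq_getElem _ _ hi'').symm⟩
  obtain ⟨x₁, hx₁, hp₁, he₁⟩ := hx i hi
  obtain ⟨x₂, hx₂, hp₂, he₂⟩ := hx (N - 1 - i) (by omega)
  rw [show ((N - 1 - i : ℕ) : ℤ) = N - 1 - i by omega] at hp₂
  have hb₁ := h.bits x₁ hx₁ r hr
  have hb₂ := h.bits x₂ hx₂ r hr
  have hle : ∀ x < N, x * W + r ≤ X := by
    intro x hx
    have : x * W + W ≤ N * W := by
      rw [← Nat.succ_mul]; exact Nat.mul_le_mul_right _ hx
    omega
  have hl₁ := hle x₁ hx₁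
  have hl₂ := hle x₂ hx₂
  push_cast at hb₁ hb₂
  have hWN : (W : ℤ) * N = (N * W : ℕ) := by push_cast; ring
  have hm₁ := Nat.mod_lt (A x₁ / 2 ^ (W - 1 - r)) two_pos
  have hm₂ := Nat.mod_lt (A x₂ / 2 ^ (W - 1 - r)) two_pos
  have hWX : -(X : ℤ) ≤ W ∧ (W : ℤ) ≤ X := ⟨by omega, by omega⟩
  have hNX : -(X : ℤ) ≤ N ∧ (N : ℤ) ≤ X := ⟨by omega, by omega⟩
  have hiX : -(X : ℤ) ≤ i ∧ (i : ℤ) ≤ X := ⟨by omega, by omega⟩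
  have hrX : -(X : ℤ) ≤ r ∧ (r : ℤ) ≤ X := ⟨by omega, by omega⟩
  have htX : -(X : ℤ) ≤ (i * W + r : ℕ) ∧ ((i * W + r : ℕ) : ℤ) ≤ X := ⟨by omega, by omega⟩
  have hx₁X : -(X : ℤ) ≤ x₁ ∧ (x₁ : ℤ) ≤ X := ⟨by omega, by omega⟩
  have hx₂X : -(X : ℤ) ≤ x₂ ∧ (x₂ : ℤ) ≤ X := ⟨by omega, by omega⟩
  have hi₁X : -(X : ℤ) ≤ W * N + i ∧ (W : ℤ) * N + i ≤ X := ⟨by omega, by omega⟩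
  have hi₂X : -(X : ℤ) ≤ W * N + (N - 1 - i) ∧ (W : ℤ) * N + (N - 1 - i) ≤ X :=
    ⟨by omega, by omega⟩
  have hbi₁ : -(X : ℤ) ≤ x₁ * W + r ∧ (x₁ : ℤ) * W + r ≤ X := by
    have : (x₁ : ℤ) * W + r = (x₁ * W + r : ℕ) := by push_cast; ring
    exact ⟨by omega, by omega⟩
  have hbi₂ : -(X : ℤ) ≤ x₂ * W + r ∧ (x₂ : ℤ) * W + r ≤ X := by
    have : (x₂ : ℤ) * W + r = (x₂ * W + r : ℕ) := by push_cast; ring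
    exact ⟨by omega, by omega⟩
  have hv₁ : -(X : ℤ) ≤ (A x₁ / 2 ^ (W - 1 - r) % 2 : ℕ) ∧
    ((A x₁ / 2 ^ (W - 1 - r) % 2 : ℕ) : ℤ) ≤ X := ⟨by omega, by omega⟩
  have hv₂ : -(X : ℤ) ≤ (A x₂ / 2 ^ (W - 1 - r) % 2 : ℕ) ∧
    ((A x₂ / 2 ^ (W - 1 - r) % 2 : ℕ) : ℤ) ≤ X := ⟨by omega, by omega⟩
  push_cast at hv₁ hv₂
  have hzi : i / 2 ^ r ≤ i := Nat.div_le_self _ _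
  have hzX : -(X : ℤ) ≤ (i / 2 ^ r : ℕ) ∧ ((i / 2 ^ r : ℕ) : ℤ) ≤ X := by
    generalize i / 2 ^ r = w at hzi ⊢
    omega
  -- With or without the reset of `z`, the remaining assignments start from a state of the same
  -- description; they are treated once for both branches.
  have main : ∀ s' : St (Var (e + 1)) (Arr (e + 1)), FillCore T N W A cf ct (i * W + r) s' →
      s'.var .i = i → s'.var .j = r → s'.var .z = (i / 2 ^ r : ℕ) → s'.arr = s.arr →
      Stm.wp X (sq (.set .x (.get .perm (.add (.mul (v .W) (v .n)) (v .i))))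
          (sq (.set .y (.get .bits (.add (.mul (v .x) (v .W)) (v .j))))
            (sq (.set .x (.get .perm (.add (.mul (v .W) (v .n)) (.sub (.sub (v .n) (.lit 1)) (v .i)))))
              (sq (.set .off (.get .bits (.add (.mul (v .x) (v .W)) (v .j))))
                (sq (.set .cnt (.div (.add (v .j) (.lit 1)) (v .W)))
                  (sq (.set .w (.sub (v .z) (.mul (.lit 2) (.div (v .z) (.lit 2)))))
                    (sq (.set .z (.div (v .z) (.lit 2)))
                      (.ite (.sub (.sub (v .n) (.lit 1)) (v .t))
                        (.set .run (.lit 1)) (.set .run (.lit 0)))))))))) (fun s' => FillCore T N W A cf ct (i * W + r) s' ∧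
        LabelAt N W (i * W + r + 1) s' ∧ Letters N W A (i * W + r) s') s' := by
    intro s' g gi gj gz ga
    have fin : ∀ (b : ℤ) (s'' : St (Var (e + 1)) (Arr (e + 1))),
        s'' = { s' with var := Function.update (Function.update (Function.update (Function.update
          (Function.update (Function.update (Function.update (Function.update s'.var .x x₁)
          .y (A x₁ / 2 ^ (W - 1 - r) % 2)) .x x₂) .off (A x₂ / 2 ^ (W - 1 - r) % 2))
          .cnt ((r + 1) / W)) .w ((i : ℤ) / 2 ^ r - 2 * ((i : ℤ) / 2 ^ r / 2)))
          .z ((i : ℤ) / 2 ^ r / 2)) .run b } →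
        b = (decide (i * W + r < N - 1)).toNat →
        FillCore T N W A cf ct (i * W + r) s'' ∧ LabelAt N W (i * W + r + 1) s'' ∧
          Letters N W A (i * W + r) s'' := by
      rintro b s'' rfl hb
      refine ⟨g.of_eq rfl rfl (fun i => by simp) (by simp) (by simp) (by simp) (by simp),
        fun h1 h2 => ?_, ?_⟩
      · have hr1 : r + 1 < W := by
          by_contra hcon
          have : r + 1 = W := by omega
          apply h2
          rw [add_assoc, this, ← Nat.succ_mul, Nat.mul_mod_left]
        have hd : (i * W + r + 1) / W = i := by
          rw [add_assoc, mul_comm, Nat.mul_add_div hW, Nat.div_eq_of_lt hr1, add_zero]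
        have hm : (i * W + r + 1) % W = r + 1 := by
          rw [add_assoc, mul_comm, Nat.mul_add_mod, Nat.mod_eq_of_lt hr1]
        rw [hd, hm, pow_succ, ← Nat.div_div_eq_div_mul]
        simp
      · simp only [Letters, TripleTM.cellBit, if_pos ht, hdiv, hmod, Nat.testBit_eq_decide_div_mod_eq,
          sortedBit, ← he₁, ← he₂, ↓reduceIte, one_ne_zero, OfNat.ofNat_ne_zero,
          OfNat.ofNat_ne_one, Nat.reduceEqDiff, toNat_decide_mod_two]
        refine ⟨by simp, by simp, ?_, ?_, ?_⟩
        · simp only [ne_eq, reduceCtorEq, not_false_eq_true, Function.update_of_ne,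
            Function.update_self]
          by_cases hc : r + 1 = W
          · have : (r : ℤ) + 1 = W := by exact_mod_cast hc
            rw [this, Int.ediv_self (by omega)]; simp [hc]
          · rw [Int.ediv_eq_zero_of_lt (by omega) (by omega)]; simp [hc]
        · simp only [ne_eq, reduceCtorEq, not_false_eq_true, Function.update_of_ne,
            Function.update_self]
          push_cast
          omega
        · simp [hb]
    simp only [Stm.wp, Exp.Bd, Exp.eval, ne_eq, reduceCtorEq, not_false_eq_true,
      Function.update_of_ne, Function.update_self, g.n, g.W, g.t, gi, gj, gz, ga, hp₁, hp₂,
      hb₁, hb₂]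
    push_cast
    refine ⟨⟨⟨⟨hWX, hNX⟩, hiX⟩, hi₁X, hx₁X⟩, ⟨⟨⟨hx₁X, hWX⟩, hrX⟩, hbi₁, hv₁⟩,
      ⟨⟨⟨hWX, hNX⟩, ⟨hNX, trivial⟩, hiX⟩, hi₂X, hx₂X⟩, ⟨⟨⟨hx₂X, hWX⟩, hrX⟩, hbi₂, hv₂⟩,
      ⟨⟨hrX, trivial⟩, hWX, by omega⟩, ⟨by exact_mod_cast hzX, trivial, by exact_mod_cast hzX,
      trivial, by norm_num⟩, ⟨by exact_mod_cast hzX, trivial, by norm_num⟩,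
      ⟨⟨hNX, trivial⟩, by exact_mod_cast htX⟩, fun hc => ⟨trivial, ?_⟩, fun hc => ⟨trivial, ?_⟩⟩
    · refine fin 1 _ (by rw [ga]) ?_
      rw [decide_eq_true (by zify at *; omega)]; rfl
    · refine fin 0 _ (by rw [ga]) ?_
      rw [decide_eq_false (by zify at *; omega)]; rfl
  rw [cellCalc]
  refine ⟨?_, ?_, ?_⟩
  · simp only [Exp.Bd, h.t, h.W, Exp.eval]
    exact ⟨htX, hWX, by omega⟩
  · simp only [Exp.Bd, h.t, h.W, Exp.eval, ne_eq, reduceCtorEq, not_false_eq_true,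
      Function.update_of_ne, Function.update_self, hdivZ]
    exact ⟨htX, hiX, hWX⟩
  · refine ⟨?_, fun h0 => ⟨?_, main _ (h.of_eq rfl rfl (fun i => ?_) ?_ ?_ ?_ ?_) ?_ ?_ ?_ rfl⟩,
      fun h0 => main _ (h.of_eq rfl rfl (fun i => ?_) ?_ ?_ ?_ ?_) ?_ ?_ ?_ rfl⟩
    all_goals
      simp only [Exp.Bd, Exp.eval, ne_eq, reduceCtorEq, not_false_eq_true, Function.update_of_ne,
        Function.update_self, h.t, h.W, hdivZ, hmodZ] at *
    · exact ⟨trivial, hrX⟩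
    · exact hiX
    · obtain rfl : r = 0 := by omega
      simp
    · have := hz ht (by rw [hmod]; omega)
      rwa [hdiv, hmod] at this

end ThreeSum

namespace ThreeSum

open While

variable {e : ℕ}

theorem cellWrite_wp {T N W X : ℕ} {A : ℕ → ℕ} {cf ct : ℤ} {tn : ℕ} (hX : T ≤ X) (hX1 : 1 ≤ X)
    {s : St (Var (e + 1)) (Arr (e + 1))} (h : FillCore T N W A cf ct tn s) (ht : tn < T)
    (hz : LabelAt N W (tn + 1) s) (hl : Letters N W A tn s) :
    (cellWrite cf ct).wp X
      (fun s' => FillCore T N W A cf ct (tn + 1) s' ∧ LabelAt N W (tn + 1) s') s := by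
  obtain ⟨h0, h1, h2, h3, h4⟩ := hl
  have hb : ∀ b : Bool, -(X : ℤ) ≤ (b.toNat : ℤ) ∧ (b.toNat : ℤ) ≤ X := by
    intro b; cases b <;> simp
    omega
  have hTX : -(X : ℤ) ≤ T ∧ (T : ℤ) ≤ X := ⟨by omega, by omega⟩
  have htX : -(X : ℤ) ≤ tn ∧ (tn : ℤ) ≤ X := ⟨by omega, by omega⟩
  simp only [cellWrite, posExp, letterExp, Stm.wp, Exp.Bd, Exp.eval, h.T, h.t, h0, h1, h2, h3, h4,
    Function.update_self]
  refine ⟨⟨⟨trivial, ⟨hTX, trivial⟩, htX⟩, trivial⟩, ⟨trivial, trivial, hb _⟩,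
    ⟨⟨trivial, ⟨hTX, trivial⟩, htX⟩, trivial⟩, ⟨trivial, trivial, hb _⟩,
    ⟨⟨trivial, ⟨hTX, trivial⟩, htX⟩, trivial⟩, ⟨trivial, trivial, hb _⟩,
    ⟨⟨trivial, ⟨hTX, trivial⟩, htX⟩, trivial⟩, ⟨trivial, trivial, hb _⟩,
    ⟨⟨trivial, ⟨hTX, trivial⟩, htX⟩, trivial⟩, ⟨trivial, trivial, hb _⟩, ⟨htX, trivial⟩,
    ⟨h.out, ?_, ?_, ?_, ?_, ?_, ht, ?_, ?_, ?_, ?_, ?_⟩, ?_⟩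
  · intro i; simp [h.pos]
  · simp [h.n]
  · simp [h.W]
  · simp [h.T]
  · simp
  · intro x hx b hb; simpa using h.bits x hx b hb
  · simpa using h.perm
  · intro i hi p; simp [hi, h.tape]
  · intro p hp
    push_cast at hp ⊢
    simp only [Function.update_self]
    rw [Function.update_of_ne (by omega), Function.update_of_ne (by omega),
      Function.update_of_ne (by omega), Function.update_of_ne (by omega),
      Function.update_of_ne (by omega)]
    exact h.tape_out p (by omega)
  · intro i hi c hc
    simp only [Function.update_self]
    rcases (Nat.lt_succ_iff.mp hi).lt_or_eq with hi | rfl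
    · push_cast
      rw [Function.update_of_ne (by omega), Function.update_of_ne (by omega),
        Function.update_of_ne (by omega), Function.update_of_ne (by omega),
        Function.update_of_ne (by omega)]
      exact h.tape_in i hi c hc
    · interval_cases c <;> simp
  · intro h1 h2
    simpa using hz h1 h2

theorem filling_meets (e : ℕ) (cf ct : ℤ) : ∃ κ, ∀ (p q N W X : ℕ) (A : ℕ → ℕ), 0 < W → 1 ≤ N →
    width p q N W + W ≤ X →
    Meets (nm (e + 1)) (filling cf ct)
      (fun s => SortInv N W A W s ∧ s.var .T = width p q N W)
      (FillCore (width p q N W) N W A cf ct (width p q N W)) (κ * ((width p q N W + 2) * lg X)) := by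
  obtain ⟨κ₁, h₁⟩ := Meets.of_wp (nm (e + 1)) (.set .t (.lit 0))
  obtain ⟨κ₂, h₂⟩ := Meets.loop_wp (nm (e + 1)) (.sub (v .T) (v .t))
    (sq (.ite (.sub (.mul (v .n) (v .W)) (v .t)) cellCalc cellZero) (cellWrite cf ct))
  refine ⟨κ₁ + κ₂, fun p q N W X A hW hN hX => ?_⟩
  have hT : N * W + N ≤ width p q N W := by
    unfold width
    omega
  set T := width p q N W
  refine ((h₁ X _ (fun s => FillCore T N W A cf ct 0 s ∧ LabelAt N W 0 s) ?_).seq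
    ((h₂ X T (fun s => ∃ tn, FillCore T N W A cf ct tn s ∧ LabelAt N W tn s)
    (fun s => (T - s.var .t).toNat) ?_ ?_).mono le_rfl
    (fun s hs => ⟨_, hs⟩) (fun s hs => hs))).mono ?_ (fun _ h => h) ?_
  · rintro s ⟨h, hTs⟩
    simp only [Stm.wp, Exp.Bd, Exp.eval]
    refine ⟨trivial, ⟨h.out, ?_, ?_, ?_, ?_, ?_, by omega, h.bits, h.perm, fun i _ => h.tape i,
      fun i _ => h.tape 0 i, fun i hi => absurd hi (by omega)⟩, fun _ h2 => ?_⟩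
    · intro i; simp [h.pos]
    · simp [h.n]
    · simp [h.W]
    · simp [hTs]
    · simp
    · simp at h2
  · rintro s ⟨tn, h, -⟩
    have := h.t_le
    simp only [Exp.Bd, h.T, h.t]
    exact ⟨⟨⟨by omega, by omega⟩, by omega, by omega⟩, by omega⟩
  · rintro s ⟨tn, h, hz⟩ hpos
    simp only [Exp.eval, h.T, h.t] at hpos
    have hlt : tn < T := by omega
    have fin : ∀ s' : St (Var (e + 1)) (Arr (e + 1)), (FillCore T N W A cf ct tn s' ∧ LabelAt N W (tn + 1) s' ∧
        Letters N W A tn s') → (cellWrite cf ct).wp X (fun s' =>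
        (∃ tn, FillCore T N W A cf ct tn s' ∧ LabelAt N W tn s') ∧
        (T - s'.var .t).toNat < (T - s.var .t).toNat) s' := fun s' h' =>
      Stm.wp_mono _ (cellWrite_wp (by omega) (by omega) h'.1 hlt h'.2.1 h'.2.2)
        fun s'' h'' => ⟨⟨tn + 1, h''⟩, by rw [h''.1.t, h.t]; omega⟩
    refine ⟨?_, fun hc => ?_, fun hc => ?_⟩
    · simp only [Exp.Bd, h.n, h.W, h.t]
      exact ⟨⟨⟨by omega, by omega⟩, by omega, by omega⟩, by omega, by omega⟩
    · simp only [Exp.eval, h.n, h.W, h.t] at hc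
      exact Stm.wp_mono _ (cellCalc_wp (by omega) hW h (by zify; omega) hz) fin
    · simp only [Exp.eval, h.n, h.W, h.t] at hc
      exact Stm.wp_mono _ (cellZero_wp h (by zify; omega)) fin
  · rw [add_mul κ₁]
    exact Nat.add_le_add (Nat.mul_le_mul_left _ (Nat.le_mul_of_pos_left _ (by omega)))
      (Nat.mul_le_mul_left _ (Nat.mul_le_mul_right _ (by omega)))
  · rintro s ⟨⟨tn, h, -⟩, hle⟩
    have := h.t_le
    simp only [Exp.eval, h.T, h.t] at hle
    obtain rfl : tn = T := by omega
    exact h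

end ThreeSum

/-! ### Simulating a Turing machine -/

namespace ThreeSum

open While

/-- A numbering of a finite pointed type that sends the base point to zero. -/
noncomputable def code {α : Type} [Finite α] (a₀ a : α) : ℤ :=
  (Finite.equivFin α a : ℕ) - (Finite.equivFin α a₀ : ℕ)

/-- Registers start at zero. Coding the blank by zero makes all cells never written on correct
without any initialisation. -/
theorem code_self {α : Type} [Finite α] (a₀ : α) : code a₀ a₀ = 0 := sub_self _

theorem code_inj {α : Type} [Finite α] {a₀ a b : α} : code a₀ a = code a₀ b ↔ a = b := by
  simp [code, Fin.val_inj]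

theorem code_bound {α : Type} [Finite α] (a₀ a : α) :
    -(Nat.card α : ℤ) ≤ code a₀ a ∧ code a₀ a ≤ Nat.card α := by
  have h1 := (Finite.equivFin α a).isLt
  have h2 := (Finite.equivFin α a₀).isLt
  unfold code
  omega

section
variable {M : OracleTM}

/-- The code of a symbol. -/
noncomputable abbrev symCode (a : M.Symbol) : ℤ := code default a

/-- The code of a state. -/
noncomputable abbrev stCode (q : M.State) : ℤ := code M.start q

/-- The state and the scanned symbols. -/
abbrev Key (M : OracleTM) : Type := M.State × (Fin (M.extra + 1) → M.Symbol)

/-- The sum of the squared differences between the scanned symbols and the given ones. -/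
noncomputable def diffSum (σ : Fin (M.extra + 1) → M.Symbol) :
    List (Fin (M.extra + 1)) → Exp (Var (M.extra + 1)) (Arr (M.extra + 1))
  | [] => .lit 0
  | i :: l => .add (.mul (.sub (.get (.tape i) (v (.pos i))) (.lit (symCode (σ i))))
      (.sub (.get (.tape i) (v (.pos i))) (.lit (symCode (σ i))))) (diffSum σ l)

/-- A positive expression if and only if the machine is in the given state and scans the given
symbols. -/
noncomputable def keyTest (κ : Key M) : Exp (Var (M.extra + 1)) (Arr (M.extra + 1)) :=
  .sub (.lit 1) (.add (.mul (.sub (v .st) (.lit (stCode κ.1))) (.sub (v .st) (.lit (stCode κ.1))))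
    (diffSum κ.2 (List.finRange _)))

/-- Write and move on the listed tapes. -/
noncomputable def tapeActs (r : Fin (M.extra + 1) → M.Symbol × Option Turing.Dir) :
    List (Fin (M.extra + 1)) → Stm (Var (M.extra + 1)) (Arr (M.extra + 1))
  | [] => .skip
  | i :: l => sq (.put (.tape i) (v (.pos i)) (.lit (symCode (r i).1)))
      (sq (.set (.pos i) (.add (v (.pos i)) (.lit (OracleTM.shift (r i).2)))) (tapeActs r l))

/-- What the machine does in a given state when it scans given symbols. -/
noncomputable def keyBody (κ : Key M) : Stm (Var (M.extra + 1)) (Arr (M.extra + 1)) :=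
  match M.verdict κ.1 with
  | some b => sq (.set .run (.lit 0)) (.set .ans (.lit b.toNat))
  | none => sq (.set .st (.lit (stCode (M.next κ.1 κ.2 false).1)))
      (sq (.set .t (.add (v .t) (.lit 1))) (tapeActs (M.next κ.1 κ.2 false).2 (List.finRange _)))

/-- Look for the key that applies. -/
noncomputable def keyChain : List (Key M) → Stm (Var (M.extra + 1)) (Arr (M.extra + 1))
  | [] => .skip
  | κ :: l => .ite (keyTest κ) (keyBody κ) (keyChain l)

/-- The state describes the configuration `c`. -/
structure Sim (c : M.FCfg) (s : St (Var (M.extra + 1)) (Arr (M.extra + 1))) : Prop where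
  out : s.out = []
  st : s.var .st = stCode c.state
  pos : ∀ i, s.var (.pos i) = c.pos i
  tape : ∀ i p, s.arr (.tape i) p = symCode (c.cell i p)

/-- All values of a configuration are bounded. -/
def Bounded (M : OracleTM) (X : ℕ) (c : M.FCfg) : Prop :=
  Nat.card M.State ≤ X ∧ Nat.card M.Symbol ≤ X ∧ ∀ i, -(X : ℤ) ≤ c.pos i ∧ c.pos i ≤ X

/-- A sum of squares vanishes only if all terms do. So `1` minus the squared differences is a
positive integer exactly when the state and all scanned symbols agree with the key, and one
positivity test selects the transition. -/
theorem diffSum_spec {c : M.FCfg} {s : St (Var (M.extra + 1)) (Arr (M.extra + 1))} {X : ℕ}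
    (h : Sim c s) (hX : Bounded M X c) (σ : Fin (M.extra + 1) → M.Symbol)
    (l : List (Fin (M.extra + 1))) : (diffSum σ l).Bd s X ∧ 0 ≤ (diffSum σ l).eval s ∧
      ((diffSum σ l).eval s = 0 ↔ ∀ i ∈ l, c.cell i (c.pos i) = σ i) := by
  induction l with
  | nil => simp [diffSum, Exp.Bd, Exp.eval]
  | cons i l ih =>
    obtain ⟨h1, h2, h3⟩ := ih
    have hc : -(Nat.card M.Symbol : ℤ) ≤ symCode (c.cell i (c.pos i)) ∧
      symCode (c.cell i (c.pos i)) ≤ Nat.card M.Symbol := code_bound _ _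
    have hs := hX.2.1
    have hp := hX.2.2 i
    have hcX : -(X : ℤ) ≤ symCode (c.cell i (c.pos i)) ∧
      symCode (c.cell i (c.pos i)) ≤ X := ⟨by omega, by omega⟩
    simp only [diffSum, Exp.Bd, Exp.eval, h.pos, h.tape, List.forall_mem_cons, ← h3]
    have hsq := mul_self_nonneg (symCode (c.cell i (c.pos i)) - symCode (σ i))
    refine ⟨⟨⟨⟨⟨hp, hp, hcX⟩, trivial⟩, ⟨hp, hp, hcX⟩, trivial⟩, h1⟩, by omega, ?_⟩
    have e1 : (symCode (c.cell i (c.pos i)) - symCode (σ i)) *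
        (symCode (c.cell i (c.pos i)) - symCode (σ i)) = 0 ↔ c.cell i (c.pos i) = σ i := by
      rw [mul_self_eq_zero, sub_eq_zero, code_inj]
    rw [← e1]
    constructor
    · intro h; constructor <;> omega
    · rintro ⟨ha, hb⟩; rw [ha, hb, add_zero]

theorem keyTest_spec {c : M.FCfg} {s : St (Var (M.extra + 1)) (Arr (M.extra + 1))} {X : ℕ}
    (h : Sim c s) (hX : Bounded M X c) (κ : Key M) : (keyTest κ).Bd s X ∧
      (0 < (keyTest κ).eval s ↔ κ = (c.state, fun i => c.cell i (c.pos i))) := by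
  obtain ⟨h1, h2, h3⟩ := diffSum_spec h hX κ.2 (List.finRange _)
  have hc : -(Nat.card M.State : ℤ) ≤ stCode c.state ∧ stCode c.state ≤ Nat.card M.State :=
    code_bound _ _
  have hs := hX.1
  have hcX : -(X : ℤ) ≤ stCode c.state ∧ stCode c.state ≤ X := ⟨by omega, by omega⟩
  simp only [keyTest, Exp.Bd, Exp.eval, h.st]
  have hsq := mul_self_nonneg (stCode c.state - stCode κ.1)
  refine ⟨⟨trivial, ⟨⟨hcX, trivial⟩, hcX, trivial⟩, h1⟩, ?_⟩
  have e1 : (stCode c.state - stCode κ.1) * (stCode c.state - stCode κ.1) = 0 ↔ c.state = κ.1 := by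
    rw [mul_self_eq_zero, sub_eq_zero, code_inj]
  have e2 : κ = (c.state, fun i => c.cell i (c.pos i)) ↔ c.state = κ.1 ∧
      ∀ i ∈ List.finRange (M.extra + 1), c.cell i (c.pos i) = κ.2 i := by
    rw [Prod.ext_iff, funext_iff]
    simp [eq_comm]
  rw [e2, ← e1, ← h3]
  constructor
  · intro h; constructor <;> omega
  · rintro ⟨ha, hb⟩; omega

theorem keyChain_wp {c : M.FCfg} {s : St (Var (M.extra + 1)) (Arr (M.extra + 1))} {X : ℕ}
    (h : Sim c s) (hX : Bounded M X c) {Q : St (Var (M.extra + 1)) (Arr (M.extra + 1)) → Prop}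
    {l : List (Key M)} (hl : (c.state, fun i => c.cell i (c.pos i)) ∈ l)
    (hQ : (keyBody (c.state, fun i => c.cell i (c.pos i))).wp X Q s) : (keyChain l).wp X Q s := by
  induction l with
  | nil => simp at hl
  | cons κ l ih =>
    obtain ⟨h1, h2⟩ := keyTest_spec h hX κ
    refine ⟨h1, fun h0 => ?_, fun h0 => ?_⟩
    · rw [h2] at h0; rwa [h0]
    · rcases List.mem_cons.mp hl with h' | h'
      · exact absurd (h2.mpr h'.symm) (not_lt.mpr h0)
      · exact ih h'

theorem tapeActs_wp (r : Fin (M.extra + 1) → M.Symbol × Option Turing.Dir) {X : ℕ}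
    (l : List (Fin (M.extra + 1))) (hl : l.Nodup)
    (s : St (Var (M.extra + 1)) (Arr (M.extra + 1)))
    (hs : ∀ i ∈ l, -(X : ℤ) ≤ s.var (.pos i) ∧ s.var (.pos i) ≤ X) :
    (tapeActs r l).wp X (fun s' => s'.out = s.out ∧
      (∀ u, (∀ i, u ≠ .pos i) → s'.var u = s.var u) ∧
      (∀ i ∈ l, s'.var (.pos i) = s.var (.pos i) + OracleTM.shift (r i).2 ∧
        s'.arr (.tape i) = Function.update (s.arr (.tape i)) (s.var (.pos i)) (symCode (r i).1)) ∧
      ∀ i ∉ l, s'.var (.pos i) = s.var (.pos i) ∧ s'.arr (.tape i) = s.arr (.tape i)) s := by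
  induction l generalizing s with
  | nil => simp [tapeActs, Stm.wp]
  | cons i l ih =>
    rw [List.nodup_cons] at hl
    refine ⟨hs i (by simp), trivial, ⟨hs i (by simp), trivial⟩,
      Stm.wp_mono _ (ih hl.2 _ fun j hj => ?_) ?_⟩
    · have hji : j ≠ i := fun h => hl.1 (h ▸ hj)
      simpa [hji] using hs j (by simp [hj])
    · rintro s' ⟨h1, h2, h3, h4⟩
      refine ⟨h1, fun u hu => ?_, fun j hj => ?_, fun j hj => ?_⟩
      · rw [h2 u hu]; simp [hu i]
      · rcases List.mem_cons.mp hj with rfl | hj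
        · obtain ⟨h5, h6⟩ := h4 j hl.1
          rw [h5, h6]; simp [Exp.eval]
        · have hji : j ≠ i := fun h => hl.1 (h ▸ hj)
          obtain ⟨h5, h6⟩ := h3 j hj
          rw [h5, h6]; simp [hji]
      · rw [List.mem_cons, not_or] at hj
        obtain ⟨h5, h6⟩ := h4 j hj.2
        rw [h5, h6]; simp [hj.1]

/-- All oracle bits are `false`, so `M.next` receives `false` whether or not the state guesses, and
the transition is determined by the key. -/
theorem keyBody_wp {c : M.FCfg} {s : St (Var (M.extra + 1)) (Arr (M.extra + 1))} {X : ℕ} {u : ℕ}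
    (h : Sim c s) (hX : Bounded M X c) (hu : s.var .t = u) (huX : u ≤ X) (y : ℕ → Bool)
    (hy : ∀ n, y n = false) :
    (keyBody (c.state, fun i => c.cell i (c.pos i))).wp X
      (fun s' => (M.verdict c.state = none ∧ Sim (M.fstep y c) s' ∧ s'.var .t = u + 1 ∧
        s'.var .run = s.var .run) ∨ ∃ b, M.verdict c.state = some b ∧ s'.out = [] ∧
          s'.var .run = 0 ∧ s'.var .ans = b.toNat) s := by
  unfold keyBody
  cases hv : M.verdict c.state with
  | some b => simp [Stm.wp, Exp.Bd, Exp.eval, h.out]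
  | none =>
    dsimp only
    refine ⟨trivial, ⟨?_, trivial⟩, Stm.wp_mono _ (tapeActs_wp _ _ (List.nodup_finRange _) _ ?_) ?_⟩
    · simp [Exp.Bd, hu]; omega
    · intro i _
      simpa [h.pos] using hX.2.2 i
    · rintro s' ⟨h1, h2, h3, -⟩
      refine Or.inl ⟨rfl, ⟨h1.trans h.out, ?_, fun i => ?_, fun i p => ?_⟩, ?_, ?_⟩
      · rw [h2 _ (by simp)]
        simp [Exp.eval, OracleTM.fstep, hv, hy]
      · rw [(h3 i (List.mem_finRange i)).1]
        simp [OracleTM.fstep, hv, hy, h.pos]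
      · rw [(h3 i (List.mem_finRange i)).2]
        simp only [OracleTM.fstep, hv, hy, Function.update_apply, reduceCtorEq, if_false,
          h.pos, h.tape, ite_self]
        split_ifs <;> rfl
      · rw [h2 _ (by simp)]
        simp [Exp.eval, hu]
      · rw [h2 _ (by simp)]
        simp

/-- All keys. -/
noncomputable def allKeys (M : OracleTM) : List (Key M) := (Set.toFinite Set.univ).toFinset.toList

theorem mem_allKeys (κ : Key M) : κ ∈ allKeys M := by simp [allKeys]

/-- The seventh phase: simulate the machine. -/
noncomputable def simulation (M : OracleTM) : Stm (Var (M.extra + 1)) (Arr (M.extra + 1)) :=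
  sq (sq (.set .st (.lit (stCode M.start))) (sq (.set .run (.lit 1)) (.set .t (.lit 0))))
    (.loop (v .run) (keyChain (allKeys M)))

/-- A head moves by at most one cell per step, so array indices are bounded by the running time and
their sizes by its logarithm. -/
theorem abs_pos_le (x : List Bool) (y : ℕ → Bool) (u : ℕ) (i : Fin (M.extra + 1)) :
    -(u : ℤ) ≤ (M.fcfgAt x y u).pos i ∧ (M.fcfgAt x y u).pos i ≤ u := by
  induction u with
  | zero => simp [OracleTM.fcfgAt, OracleTM.fstart]
  | succ u ih =>
    rw [OracleTM.fcfgAt_succ]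
    unfold OracleTM.fstep
    cases M.verdict (M.fcfgAt x y u).state with
    | some b => dsimp only; omega
    | none =>
      dsimp only
      have : ∀ d, -1 ≤ OracleTM.shift d ∧ OracleTM.shift d ≤ 1 := by
        rintro (_ | _ | _) <;> simp [OracleTM.shift]
      have := this ((M.next (M.fcfgAt x y u).state
        (fun i => (M.fcfgAt x y u).cell i ((M.fcfgAt x y u).pos i))
        (if M.guess (M.fcfgAt x y u).state then y (M.fcfgAt x y u).used else false)).2 i).2
      push_cast
      omega

theorem simulation_meets (M : OracleTM) : ∃ κ, ∀ (x : List Bool) (y : ℕ → Bool) (τ X : ℕ),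
    (∀ n, y n = false) → (∃ b, M.AnswersWithin x y τ b) → 1 ≤ X →
    τ + Nat.card M.State + Nat.card M.Symbol ≤ X →
    Meets (nm (M.extra + 1)) (simulation M)
      (fun s => s.out = [] ∧ (∀ i, s.var (.pos i) = 0) ∧
        ∀ i p, s.arr (.tape i) p = symCode ((M.fstart x).cell i p))
      (fun s => s.out = [] ∧ ∃ b : Bool, M.AnswersWithin x y τ b ∧ s.var .ans = b.toNat)
      (κ * ((τ + 3) * lg X)) := by
  obtain ⟨κ₁, h₁⟩ := Meets.of_wp (nm (M.extra + 1))
    (sq (.set .st (.lit (stCode M.start))) (sq (.set .run (.lit 1)) (.set .t (.lit 0))))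
  obtain ⟨κ₂, h₂⟩ := Meets.loop_wp (nm (M.extra + 1)) (v .run) (keyChain (allKeys M))
  refine ⟨κ₁ + κ₂, fun x y τ X hy hans hX1 hX => ?_⟩
  obtain ⟨b₀, hb₀⟩ := hans
  rw [OracleTM.answersWithin_iff] at hb₀
  have hB : ∀ u ≤ τ, Bounded M X (M.fcfgAt x y u) := fun u hu =>
    ⟨by omega, by omega, fun i => by have := abs_pos_le x y u i; omega⟩
  refine ((h₁ X _ (fun s => Sim (M.fcfgAt x y 0) s ∧ s.var .t = (0 : ℕ) ∧ s.var .run = 1) ?_).seq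
    -- There is one iteration more than there are steps: halting is noticed only when the key of the
    -- halting state is looked up. The variant therefore starts at `τ + 1` and drops to zero when
    -- `run` is cleared.
    ((h₂ X (τ + 1) (fun s => (∃ u ≤ τ, Sim (M.fcfgAt x y u) s ∧ s.var .t = u ∧ s.var .run = 1) ∨
      s.var .run = 0 ∧ s.out = [] ∧ ∃ b : Bool, M.AnswersWithin x y τ b ∧ s.var .ans = b.toNat)
    (fun s => if s.var .run = 1 then (τ + 1 - s.var .t).toNat else 0) ?_ ?_).mono le_rfl
    (fun s hs => Or.inl ⟨0, by omega, hs⟩) (fun s hs => hs))).mono ?_ (fun _ h => h) ?_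
  · rintro s ⟨ho, hp, ht⟩
    simp only [Stm.wp, Exp.Bd, Exp.eval]
    refine ⟨trivial, trivial, trivial, ⟨ho, ?_, ?_, ht⟩, ?_, ?_⟩
    · simp [OracleTM.fcfgAt, OracleTM.fstart]
    · intro i; simp [OracleTM.fcfgAt, OracleTM.fstart, hp]
    · simp
    · simp
  · rintro s (⟨u, hu, h, ht, hr⟩ | ⟨hr, -⟩)
    · simp only [Exp.Bd, hr, ht, if_true]
      exact ⟨⟨by omega, by omega⟩, by omega⟩
    · simp only [Exp.Bd, hr]
      exact ⟨⟨by omega, by omega⟩, by simp⟩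
  · rintro s (⟨u, hu, h, ht, hr⟩ | ⟨hr, -⟩) hpos
    · refine keyChain_wp h (hB u hu) (mem_allKeys _) (Stm.wp_mono _
        (keyBody_wp h (hB u hu) ht (by omega) y hy) ?_)
      rintro s' (⟨hv, h', ht', hr'⟩ | ⟨b, hv, ho, hr', ha⟩)
      · have hlt : u < τ := by
          rcases hu.lt_or_eq with h' | rfl
          · exact h'
          · rw [hv] at hb₀; cases hb₀
        rw [← OracleTM.fcfgAt_succ] at h'
        rw [hr] at hr'
        refine ⟨Or.inl ⟨u + 1, hlt, h', by simpa using ht', hr'⟩, ?_⟩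
        rw [if_pos hr, if_pos hr', ht, ht']
        omega
      · refine ⟨Or.inr ⟨hr', ho, b, ?_, ha⟩, ?_⟩
        · rw [OracleTM.answersWithin_iff]
          have := M.iterate_fstep_of_verdict y _ hv (τ - u)
          rw [OracleTM.fcfgAt, ← Function.iterate_add_apply, Nat.sub_add_cancel hu] at this
          rw [OracleTM.fcfgAt, this]
          exact hv
        · rw [if_pos hr, hr', if_neg (by norm_num), ht]
          omega
    · simp only [Exp.eval, hr] at hpos
      omega
  · rw [add_mul κ₁]
    exact Nat.add_le_add (Nat.mul_le_mul_left _ (Nat.le_mul_of_pos_left _ (by omega)))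
      (Nat.mul_le_mul_left _ (Nat.mul_le_mul_right _ (by omega)))
  · rintro s ⟨⟨u, hu, h, ht, hr⟩ | ⟨-, h⟩, hle⟩
    · simp only [Exp.eval, hr] at hle
      omega
    · exact h

end

end ThreeSum

/-! ### Correctness of the reduction -/

namespace ThreeSum

open While

/-- For `Kf ≥ 1` the number `2 ^ 2 ^ Kf` is a power of `4`, hence congruent to `1` modulo `3`. So
the division in `offset` is exact, and three shifts add up to the word of ones. -/
theorem three_mul_offset {Kf : ℕ} (hK : 1 ≤ Kf) : 3 * offset Kf = 2 ^ 2 ^ Kf - 1 := by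
  obtain ⟨K, rfl⟩ : ∃ K, Kf = K + 1 := ⟨Kf - 1, by omega⟩
  have h4 : ∀ n : ℕ, ∃ m : ℤ, (4 : ℤ) ^ n = 3 * m + 1 := by
    intro n
    induction n with
    | zero => exact ⟨0, by norm_num⟩
    | succ n ih => obtain ⟨m, hm⟩ := ih; exact ⟨4 * m + 1, by rw [pow_succ, hm]; ring⟩
  obtain ⟨m, hm⟩ := h4 (2 ^ K)
  have : (2 : ℤ) ^ 2 ^ (K + 1) = 3 * m + 1 := by
    rw [← hm, pow_succ, mul_comm, pow_mul]; norm_num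
  unfold offset
  omega

theorem pref_sortedBit (A : ℕ → ℕ) (N W i : ℕ) (hA : ∀ x, A x < 2 ^ W) :
    TripleTM.pref (sortedBit A N W i) W = A ((radix A N W).getD i 0) := by
  have key : ∀ b ≤ W, TripleTM.pref (sortedBit A N W i) b =
      A ((radix A N W).getD i 0) / 2 ^ (W - b) := by
    intro b
    induction b with
    | zero =>
      intro _
      rw [Nat.sub_zero, Nat.div_eq_of_lt (hA _)]
      rfl
    | succ b ih =>
      intro hb
      rw [TripleTM.pref, ih (by omega), sortedBit, toNat_decide_mod_two,
        show W - b = W - 1 - b + 1 by omega, show W - (b + 1) = W - 1 - b by omega, pow_succ,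
        ← Nat.div_div_eq_div_mul]
      omega
  rw [key W le_rfl, Nat.sub_self, pow_zero, Nat.div_one]

theorem getD_radix (A : ℕ → ℕ) {N W i : ℕ} (hi : i < N) :
    ∃ h : i < (radix A N W).length, (radix A N W).getD i 0 = (radix A N W)[i] := by
  have h : i < (radix A N W).length := by rwa [radix_length]
  exact ⟨h, List.getD_eq_getElem _ _ h⟩

theorem sortedBit_mono {A : ℕ → ℕ} {N W : ℕ} (hA : ∀ x, A x < 2 ^ W) (i j : ℕ) (hij : i ≤ j)
    (hj : j < N) :
    TripleTM.pref (sortedBit A N W i) W ≤ TripleTM.pref (sortedBit A N W j) W := by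
  rw [pref_sortedBit A N W i hA, pref_sortedBit A N W j hA]
  rcases hij.lt_or_eq with hij | rfl
  · obtain ⟨h1, e1⟩ := getD_radix A (W := W) (hij.trans hj)
    obtain ⟨h2, e2⟩ := getD_radix A (W := W) hj
    have := List.pairwise_iff_getElem.mp (radix_sorted A N W) i j h1 h2 hij
    rwa [Nat.mod_eq_of_lt (hA _), Nat.mod_eq_of_lt (hA _), ← e1, ← e2] at this
  · exact le_rfl

/-- Two transpositions generate all orders of three arguments, so a symmetric relation may be tested
on increasing triples only. -/
theorem exists_lt_lt {P : ℕ → ℕ → ℕ → Prop} {N : ℕ} (h1 : ∀ x y z, P x y z → P y x z)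
    (h2 : ∀ x y z, P x y z → P x z y) {x y z : ℕ} (hx : x < N) (hy : y < N) (hz : z < N)
    (hxy : x ≠ y) (hxz : x ≠ z) (hyz : y ≠ z) (h : P x y z) :
    ∃ i j l, i < j ∧ j < l ∧ l < N ∧ P i j l := by
  rcases Nat.lt_or_gt_of_ne hxy with a | a <;> rcases Nat.lt_or_gt_of_ne hxz with b | b <;>
    rcases Nat.lt_or_gt_of_ne hyz with c | c
  · exact ⟨x, y, z, a, c, hz, h⟩
  · exact ⟨x, z, y, b, c, hy, h2 _ _ _ h⟩
  · omega
  · exact ⟨z, x, y, b, a, hy, h1 _ _ _ (h2 _ _ _ h)⟩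
  · exact ⟨y, x, z, a, b, hz, h1 _ _ _ h⟩
  · omega
  · exact ⟨y, z, x, c, b, hx, h2 _ _ _ (h1 _ _ _ h)⟩
  · exact ⟨z, y, x, c, a, hx, h1 _ _ _ (h2 _ _ _ (h1 _ _ _ h))⟩

/-- The shifted numbers. -/
def shifted (Kf : ℕ) (a : ℕ → ℤ) (x : ℕ) : ℕ := (a x + offset Kf).toNat

/-- The bound says that `|a x|` is at most the offset, so the shifted number lies between `0` and
twice the offset, which is below `2 ^ 2 ^ Kf`. -/
theorem shifted_spec {Kf : ℕ} (hK : 1 ≤ Kf) {a : ℕ → ℤ} (ha : ∀ x, 3 * |a x| + 1 ≤ 2 ^ 2 ^ Kf)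
    (x : ℕ) : (shifted Kf a x : ℤ) = a x + offset Kf ∧ shifted Kf a x < 2 ^ 2 ^ Kf := by
  have h1 := three_mul_offset hK
  have h2 := ha x
  have h3 := neg_abs_le (a x)
  have h4 := le_abs_self (a x)
  unfold shifted
  have h5 : (((a x + offset Kf).toNat : ℕ) : ℤ) = a x + offset Kf := Int.toNat_of_nonneg (by omega)
  refine ⟨h5, ?_⟩
  zify
  omega

/-- Adding the offset three times turns sum zero into sum `2 ^ 2 ^ Kf - 1`. Sorting only permutes
positions, so distinct positions in the sorted list correspond to distinct positions in the input.
-/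
theorem exists_triple_iff {N Kf : ℕ} (hK : 1 ≤ Kf) {a : ℕ → ℤ}
    (ha : ∀ x, 3 * |a x| + 1 ≤ 2 ^ 2 ^ Kf) :
    (∃ i j l, i < j ∧ j < l ∧ l < N ∧
      TripleTM.pref (sortedBit (shifted Kf a) N (2 ^ Kf) i) (2 ^ Kf) +
      TripleTM.pref (sortedBit (shifted Kf a) N (2 ^ Kf) j) (2 ^ Kf) +
      TripleTM.pref (sortedBit (shifted Kf a) N (2 ^ Kf) l) (2 ^ Kf) + 1 = 2 ^ 2 ^ Kf) ↔
    HasThreeSum fun i : Fin N => a i := by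
  have hA := fun x => (shifted_spec hK ha x).2
  have hz := fun x => (shifted_spec hK ha x).1
  have hoff := three_mul_offset hK
  have hsum : ∀ x y z, shifted Kf a x + shifted Kf a y + shifted Kf a z + 1 = 2 ^ 2 ^ Kf ↔
      a x + a y + a z = 0 := by
    intro x y z
    have h1 := hz x
    have h2 := hz y
    have h3 := hz z
    zify
    constructor <;> intro h <;> omega
  simp only [pref_sortedBit _ _ _ _ hA, hsum]
  set r := radix (shifted Kf a) N (2 ^ Kf) with hr
  have hnd : r.Nodup := (radix_perm _ N _).nodup_iff.mpr List.nodup_range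
  have hlen : r.length = N := radix_length _ _ _
  constructor
  · rintro ⟨i, j, l, hij, hjl, hl, h⟩
    have key : ∀ i (hi : i < N), ∃ hi' : i < r.length, r.getD i 0 = r[i] ∧ r[i] < N := fun i hi =>
      ⟨by omega, List.getD_eq_getElem _ _ (by omega), mem_radix.mp (List.getElem_mem _)⟩
    obtain ⟨hi', ei, hiN⟩ := key i (by omega)
    obtain ⟨hj', ej, hjN⟩ := key j (by omega)
    obtain ⟨hl', el, hlN⟩ := key l hl
    rw [ei, ej, el] at h
    refine ⟨⟨r[i], hiN⟩, ⟨r[j], hjN⟩, ⟨r[l], hlN⟩, ?_, ?_, ?_, h⟩ <;>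
      rw [Ne, Fin.mk.injEq, hnd.getElem_inj_iff] <;> omega
  · rintro ⟨x, y, z, hxy, hxz, hyz, h⟩
    have key : ∀ x : Fin N, ∃ i < N, r.getD i 0 = x := by
      intro x
      obtain ⟨i, hi, e⟩ := List.getElem_of_mem (mem_radix (A := shifted Kf a) (l := 2 ^ Kf).mpr x.2)
      exact ⟨i, lt_of_lt_of_eq hi hlen, (List.getD_eq_getElem _ _ hi).trans e⟩
    obtain ⟨i, hi, ei⟩ := key x
    obtain ⟨j, hj, ej⟩ := key y
    obtain ⟨l, hl, el⟩ := key z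
    dsimp only at h
    rw [← ei, ← ej, ← el] at h
    refine exists_lt_lt (P := fun i j l => a (r.getD i 0) + a (r.getD j 0) + a (r.getD l 0) = 0)
      (fun x y z h => ?_) (fun x y z h => ?_) hi hj hl ?_ ?_ ?_ h
    · omega
    · omega
    · rintro rfl; exact hxy (Fin.ext (ei.symm.trans ej))
    · rintro rfl; exact hxz (Fin.ext (ei.symm.trans el))
    · rintro rfl; exact hyz (Fin.ext (ej.symm.trans el))

theorem FillCore.tape_eq {M : OracleTM} {T N W : ℕ} {A : ℕ → ℕ}
    {s : St (Var (M.extra + 1)) (Arr (M.extra + 1))}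
    (h : FillCore T N W A (symCode (M.letter false)) (symCode (M.letter true)) T s)
    (i : Fin (M.extra + 1)) (z : ℤ) : s.arr (.tape i) z =
      symCode ((M.fstart (TripleTM.encode T N W (sortedBit A N W))).cell i z) := by
  by_cases hi : i = 0
  · subst hi
    simp only [OracleTM.fstart, if_true, OracleTM.inputCell]
    by_cases hz : 0 ≤ z ∧ z < 5 * T
    · obtain ⟨n, rfl⟩ : ∃ n : ℕ, z = n := ⟨z.toNat, by omega⟩
      have hn : n < 5 * T := by omega
      rw [if_pos (by omega), Int.toNat_natCast, List.getElem?_eq_getElem (by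
        rw [TripleTM.encode_length]; exact hn)]
      have := h.tape_in (T - 1 - n / 5) (by omega) (n % 5) (by omega)
      rw [show (5 * ((T : ℤ) - 1 - ((T - 1 - n / 5 : ℕ) : ℤ)) + ((n % 5 : ℕ) : ℤ)) = n by omega] at this
      rw [this]
      simp only [TripleTM.encode, List.getElem_ofFn, Option.map_some, Option.getD_some]
      cases TripleTM.cellBit N W (sortedBit A N W) (T - 1 - n / 5) (n % 5) <;> simp
    · rw [h.tape_out z (by omega)]
      have : (if 0 ≤ z then Option.getD (Option.map M.letter
          ((TripleTM.encode T N W (sortedBit A N W))[z.toNat]?)) default else default) =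
          (default : M.Symbol) := by
        split_ifs with h0
        · rw [List.getElem?_eq_none (by rw [TripleTM.encode_length]; omega)]
          rfl
        · rfl
      rw [this, symCode, code_self]
  · rw [h.tape i hi, OracleTM.fstart]
    simp only [if_neg hi]
    rw [symCode, code_self]

end ThreeSum

/-! ### The complete program and its cost -/

namespace ThreeSum

open While

/-- The main part of the program. -/
noncomputable def mainPart (M : OracleTM) (p q : ℕ) : Stm (Var (M.extra + 1)) (Arr (M.extra + 1)) :=
  sq reading (sq shifting (sq splitting (sq sorting (sq (scaling p q)
    (sq (filling (symCode (M.letter false)) (symCode (M.letter true)))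
      (sq (simulation M) (.ite (v .ans) (.emit (.lit 1)) (.emit (.lit 0)))))))))

/-- The program. -/
noncomputable def program (M : OracleTM) (p q : ℕ) : Stm (Var (M.extra + 1)) (Arr (M.extra + 1)) :=
  sq (.read .n) (.ite (.sub (v .n) (.lit 2)) (mainPart M p q) (.emit (.lit 0)))

theorem width_mono (p q N : ℕ) {W W' : ℕ} (h : W ≤ W') : width p q N W ≤ width p q N W' := by
  unfold width
  have := Nat.mul_le_mul_left N h
  omega

/-- The machine `M` decides the language deterministically in time `t`. -/
def Decides (M : OracleTM) (t : ℕ → ℕ) (L : Language Bool) : Prop :=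
  ∀ x : List Bool, ∃ b, M.AnswersWithin x (fun _ => false) (t x.length) b ∧ (b = true ↔ x ∈ L)

/-- The program finds its own exponent `Kf`, which is at most the a priori `Km`. Since `width` and
`t` are monotone, every phase can be charged with the values at `Km`, and `X` bounds all numbers
that occur after the splitting. -/
theorem mainPart_meets (M : OracleTM) (p q : ℕ) (hp : 1 ≤ p) : ∃ κ, ∀ (t : ℕ → ℕ) (N Km X : ℕ)
    (L : List ℤ), Monotone t → Decides M t (TripleTM.lang (2 ^ p - 1) q) → 3 ≤ N →
    L.length = N + 1 → L.getD 0 0 = N → (∀ j, 3 * |L.getD j 0| + 1 ≤ 2 ^ 2 ^ Km) →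
    2 ^ (q + 1) * N + 5 * width p q N (2 ^ Km) + t (5 * width p q N (2 ^ Km)) +
      Nat.card M.State + Nat.card M.Symbol ≤ X →
    Meets (nm (M.extra + 1)) (mainPart M p q)
      (fun s => Fresh s ∧ s.var .n = N ∧ s.inp = L.drop 1)
      (fun s => s.out = [1] ∧ HasThreeSum (fun i : Fin N => L.getD (i + 1) 0) ∨
        s.out = [0] ∧ ¬ HasThreeSum (fun i : Fin N => L.getD (i + 1) 0))
      (κ * ((width p q N (2 ^ Km) + t (5 * width p q N (2 ^ Km)) + 3) * lg X ^ 2)) := by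
  obtain ⟨κ₁, h₁⟩ := reading_meets (M.extra + 1)
  obtain ⟨κ₂, h₂⟩ := shifting_meets (M.extra + 1)
  obtain ⟨κ₃, h₃⟩ := splitting_meets (M.extra + 1)
  obtain ⟨κ₄, h₄⟩ := sorting_meets (M.extra + 1)
  obtain ⟨κ₅, h₅⟩ := scaling_meets (M.extra + 1) p q
  obtain ⟨κ₆, h₆⟩ := filling_meets M.extra (symCode (M.letter false)) (symCode (M.letter true))
  obtain ⟨κ₇, h₇⟩ := simulation_meets M
  obtain ⟨κ₈, h₈⟩ := Meets.of_wp (nm (M.extra + 1))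
    (.ite (v .ans) (.emit (.lit 1)) (.emit (.lit 0)) : Stm (Var (M.extra + 1)) (Arr (M.extra + 1)))
  refine ⟨8 * κ₁ + (8 * κ₂ + (κ₃ + (κ₄ + (κ₅ + (κ₆ + (κ₇ + κ₈)))))),
    fun t N Km X L ht hM hN hlen h0 hL hX => ?_⟩
  set S := width p q N (2 ^ Km) with hS
  set τ := t (5 * S) with hτ
  set U := (S + τ + 3) * lg X ^ 2 with hU
  have hSN : N * 2 ^ Km + N ≤ S := by rw [hS, width]; omega
  have hKS : 2 ^ Km ≤ N * 2 ^ Km := Nat.le_mul_of_pos_left _ (by omega)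
  have hlgX : Km + 1 ≤ lg X := by rw [← lg_two_pow]; exact lg_mono (by omega)
  have hlg2 : lg X ≤ lg X ^ 2 := Nat.le_self_pow (by norm_num) _
  have hK2 : Km < 2 ^ Km := Nat.lt_two_pow_self
  have hU1 : ∀ a, a ≤ S + τ + 3 → a * lg X ≤ U := fun a ha => Nat.mul_le_mul ha hlg2
  have hb1 : (N + Km + 3) * lg (2 ^ 2 ^ Km) ≤ 8 * U := by
    rw [lg_two_pow]
    calc (N + Km + 3) * (2 ^ Km + 1) ≤ (4 * N * lg X) * (2 * 2 ^ Km) := by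
          refine Nat.mul_le_mul ?_ (by omega)
          have : N * (Km + 1) ≤ N * lg X := Nat.mul_le_mul_left _ hlgX
          have : N + Km ≤ N * (Km + 1) := by nlinarith
          nlinarith
      _ = 8 * ((N * 2 ^ Km) * lg X) := by ring
      _ ≤ 8 * U := Nat.mul_le_mul_left _ (hU1 _ (by omega))
  refine (((h₁ N Km L hL h0).mono (Nat.mul_le_mul_left _ hb1) (fun _ h => h) (fun _ h => h)).seq
    (B' := 8 * κ₂ * U + (κ₃ * U + (κ₄ * U + (κ₅ * U + (κ₆ * U + (κ₇ * U + κ₈ * U))))))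
    (?_ : Meets _ _ _ _ _)).mono (le_of_eq (by ring)) (fun _ h => h) (fun _ h => h)
  rintro s ⟨Kf, hs⟩
  have hKf := hs.K_le
  have hbd : ∀ j, 3 * |L.getD j 0| + 1 ≤ 2 ^ 2 ^ Kf := by
    intro j
    by_cases hj : j < N + 1
    · exact (hs.bits j hj).2
    · rw [List.getD_eq_default _ _ (by omega)]
      simpa using one_le_pow₀ (by norm_num : (1 : ℤ) ≤ 2)
  have hN2 : N < 2 ^ 2 ^ Kf := by
    have := hbd 0
    rw [h0, abs_of_nonneg (by omega)] at this
    zify; omega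
  -- As `N ≥ 3` lies below `2 ^ 2 ^ Kf`, the case `Kf = 0`, in which the offset is not exact, is
  -- excluded.
  have hK1 : 1 ≤ Kf := by
    rcases Kf with _ | K
    · norm_num at hN2; omega
    · omega
  have hA := fun x => (shifted_spec hK1 (a := fun j => L.getD (j + 1) 0) (fun x => hbd _) x)
  set A := shifted Kf fun j => L.getD (j + 1) 0 with hAdef
  have h2K : 2 ^ Kf ≤ 2 ^ Km := Nat.pow_le_pow_right (by norm_num) hKf
  have hNK : N * 2 ^ Kf ≤ N * 2 ^ Km := Nat.mul_le_mul_left _ h2K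
  set T := width p q N (2 ^ Kf) with hT
  have hTS : T ≤ S := width_mono p q N h2K
  have hTN : N * 2 ^ Kf + N ≤ T := by rw [hT, width]; omega
  have hKN : 2 ^ Kf ≤ N * 2 ^ Kf := Nat.le_mul_of_pos_left _ (by omega)
  set x := TripleTM.encode T N (2 ^ Kf) (sortedBit A N (2 ^ Kf)) with hx
  have hxl : x.length = 5 * T := TripleTM.encode_length _ _ _ _
  have hxt : t x.length ≤ τ := ht (by omega)
  obtain ⟨b₀, hb₀, hmem⟩ := hM x
  have hmem' : x ∈ TripleTM.lang (2 ^ p - 1) q ↔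
      HasThreeSum (fun i : Fin N => L.getD (i + 1) 0) := by
    have hp2 : 2 ^ 1 ≤ 2 ^ p := Nat.pow_le_pow_right (by norm_num) hp
    rw [← exists_triple_iff hK1 (a := fun j => L.getD (j + 1) 0) (fun x => hbd _)]
    refine TripleTM.encode_mem_lang (h := Nat.clog (2 ^ (q + 1)) N) (by omega) (by positivity)
      (by omega) (by omega) hN2.le ?_ ?_ (sortedBit_mono fun x => (hA x).2)
    · rw [pow_mul]
      exact Nat.le_pow_clog (Nat.one_lt_two_pow (by omega)) N
    · rw [Nat.sub_add_cancel (by omega), hT, width]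
      omega
  have H2 := (h₂ N Kf Km L h0).mono (B' := 8 * κ₂ * U) (by
    refine le_trans (Nat.mul_le_mul_left _ (le_trans ?_ hb1)) (le_of_eq (by ring))
    rw [lg_two_pow, lg_two_pow]
    exact Nat.mul_le_mul (by omega) (by omega)) (fun _ h => h) (fun _ h => h)
  have H3 := (h₃ N Kf (fun j => L.getD (j + 1) 0) A (by omega) hK1 (fun x => (hA x).2)
    (fun j _ => (hA j).1)).mono (B' := κ₃ * U) (Nat.mul_le_mul_left _
      (Nat.mul_le_mul (by omega) (Nat.pow_le_pow_left (lg_mono (by omega)) 2)))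
      (fun _ h => h) (fun _ h => h)
  have H4 := (h₄ N Kf A (by omega) (fun x => (hA x).2)).mono (B' := κ₄ * U) (Nat.mul_le_mul_left _
      (le_trans (Nat.mul_le_mul_left _ (lg_mono (by omega))) (hU1 _ (by omega))))
      (fun _ h => h) (fun _ h => h)
  have H5 := (h₅ N (2 ^ Kf) X A (by omega) (by omega) (by omega)).mono (B' := κ₅ * U)
    (Nat.mul_le_mul_left _ (hU1 _ (by omega))) (fun _ h => h) (fun _ h => h)
  have H6 := (h₆ p q N (2 ^ Kf) X A (by positivity) (by omega) (by omega)).mono (B' := κ₆ * U)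
    (Nat.mul_le_mul_left _ (hU1 _ (by omega))) (fun _ h => h) (fun _ h => h)
  have H7 := (h₇ x (fun _ => false) (t x.length) X (fun _ => rfl) ⟨b₀, hb₀⟩ (by omega)
    (by omega)).mono (B' := κ₇ * U) (Nat.mul_le_mul_left _ (hU1 _ (by omega)))
    (P' := FillCore T N (2 ^ Kf) A (symCode (M.letter false)) (symCode (M.letter true)) T)
    (fun s h => ⟨h.out, h.pos, h.tape_eq⟩) (fun _ h => h)
  have H8 := (h₈ X (fun s => s.out = [] ∧ ∃ b : Bool, M.AnswersWithin x (fun _ => false)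
      (t x.length) b ∧ s.var .ans = b.toNat)
    (fun s => s.out = [1] ∧ HasThreeSum (fun i : Fin N => L.getD (i + 1) 0) ∨
        s.out = [0] ∧ ¬ HasThreeSum (fun i : Fin N => L.getD (i + 1) 0)) (by
      rintro s ⟨ho, b, hb, ha⟩
      have hbb : b = b₀ := by
        rw [OracleTM.AnswersWithin] at hb hb₀
        exact Option.some.inj (hb.symm.trans hb₀)
      rw [← hmem', ← hmem, ← hbb]
      simp only [Stm.wp, Exp.Bd, Exp.eval, ha, ho]
      cases b <;> simp
      omega)).mono (B' := κ₈ * U)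
    (Nat.mul_le_mul_left _ (by simpa using hU1 1 (by omega))) (fun _ h => h) (fun _ h => h)
  exact (H2.seq (H3.seq (H4.seq (H5.seq (H6.seq (H7.seq H8)))))) s hs

end ThreeSum

namespace While

theorem Meets.haltsWith {V A : Type} {ν : Names V A} {c : Stm V A} {P Q : St V A → Prop} {B : ℕ}
    (h : Meets ν c P Q B) {inp : List ℤ} (h0 : P ⟨fun _ => 0, fun _ _ => 0, inp, []⟩) :
    ∃ s' m, Q s' ∧ m ≤ B + 1 ∧
      RAM.HaltsWith (c.comp ν 0 ++ [.halt]) (RAM.startCfg inp) s'.out m := by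
  obtain ⟨s', hd, hq⟩ := h _ h0
  have hat : At (c.comp ν 0 ++ [.halt]) 0 (c.comp ν 0 ++ [.halt]) := fun i _ => by rw [zero_add]
  rw [At.append] at hat
  obtain ⟨cf, m, hr, hm, hpc, hrep⟩ := hd (c.comp ν 0 ++ [.halt]) (RAM.startCfg inp)
    ⟨fun _ => rfl, fun _ _ => rfl, rfl, rfl⟩ hat.1
  refine ⟨s', m + 1, hq, by omega, ?_⟩
  rw [← hrep.out]
  refine hr.halts ?_
  rw [hpc, ← Stm.comp_length ν c 0]
  simp [RAM.startCfg]

end While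

namespace ThreeSum

open While

theorem not_hasThreeSum {N : ℕ} (hN : N ≤ 2) (a : Fin N → ℤ) : ¬ HasThreeSum a := by
  rintro ⟨i, j, l, hij, hil, hjl, -⟩
  rw [Ne, Fin.ext_iff] at hij hil hjl
  omega

/-- The program and `κ` depend only on `M`, `p` and `q`; the exponent `Km` of the range enters only
the analysis. This is what allows one algorithm for all ranges `k + o(1)`. Lists of at most two
numbers are answered at once. -/
theorem program_spec (M : OracleTM) (p q : ℕ) (hp : 1 ≤ p) : ∃ (P : RAM.Program) (κ : ℕ),
    ∀ (t : ℕ → ℕ) (N Km X : ℕ) (a : Fin N → ℤ), Monotone t →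
    Decides M t (TripleTM.lang (2 ^ p - 1) q) →
    3 * N + 1 ≤ 2 ^ 2 ^ Km → (∀ i, 3 * |a i| + 1 ≤ 2 ^ 2 ^ Km) →
    2 ^ (q + 1) * N + 5 * width p q N (2 ^ Km) + t (5 * width p q N (2 ^ Km)) +
      Nat.card M.State + Nat.card M.Symbol ≤ X →
    ∃ (out : List ℤ) (m : ℕ),
      m ≤ κ * ((width p q N (2 ^ Km) + t (5 * width p q N (2 ^ Km)) + 3) * lg X ^ 2) ∧
      RAM.HaltsWith P (RAM.startCfg ((N : ℤ) :: List.ofFn a)) out m ∧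
      (out = [1] ↔ HasThreeSum a) := by
  obtain ⟨κ₁, h₁⟩ := Meets.of_wp (nm (M.extra + 1)) (.read .n)
  obtain ⟨κ₂, h₂⟩ := mainPart_meets M p q hp
  obtain ⟨κ₃, h₃⟩ := Meets.of_wp (nm (M.extra + 1)) (.emit (.lit 0))
  obtain ⟨κ₄, h₄⟩ := Does.ite (ν := nm (M.extra + 1)) (.sub (v .n) (.lit 2))
  refine ⟨(program M p q).comp (nm _) 0 ++ [.halt], κ₁ + (κ₄ + (κ₂ + κ₃)) + 1,
    fun t N Km X a ht hM hN ha hX => ?_⟩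
  set L := (N : ℤ) :: List.ofFn a with hL
  have hLa : ∀ i : Fin N, L.getD (i + 1) 0 = a i := by
    intro i
    simp [hL]
  have hLb : ∀ j, 3 * |L.getD j 0| + 1 ≤ 2 ^ 2 ^ Km := by
    intro j
    rcases j with _ | j
    · have : L.getD 0 0 = N := rfl
      rw [this, abs_of_nonneg (by omega)]
      exact_mod_cast hN
    · by_cases hj : j < N
      · rw [hLa ⟨j, hj⟩]; exact ha _
      · rw [List.getD_eq_default _ _ (by simp [hL]; omega)]
        simpa using one_le_pow₀ (by norm_num : (1 : ℤ) ≤ 2)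
  set U := (width p q N (2 ^ Km) + t (5 * width p q N (2 ^ Km)) + 3) * lg X ^ 2 with hU
  have hlU : lg X ≤ U := by
    have : lg X ≤ lg X ^ 2 := Nat.le_self_pow (by norm_num) _
    exact this.trans (Nat.le_mul_of_pos_left _ (by omega))
  have hNX : N ≤ X := by
    have : N ≤ 2 ^ (q + 1) * N := Nat.le_mul_of_pos_left _ (by positivity)
    omega
  let R : St (Var (M.extra + 1)) (Arr (M.extra + 1)) → Prop := fun s =>
    Fresh s ∧ s.var .n = N ∧ s.inp = L.drop 1
  let Q : St (Var (M.extra + 1)) (Arr (M.extra + 1)) → Prop := fun s =>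
    s.out = [1] ∧ HasThreeSum a ∨ s.out = [0] ∧ ¬ HasThreeSum a
  have hread : Meets (nm _) (.read .n) (fun s => s = ⟨fun _ => 0, fun _ _ => 0, L, []⟩) R
      (κ₁ * lg X) := h₁ X _ _ (by
    rintro s rfl
    simp only [Stm.wp, hL, List.headD_cons]
    refine ⟨⟨by omega, by omega⟩, ⟨rfl, fun _ _ => rfl, fun i => ?_⟩, ?_, ?_⟩
    · simp
    · simp
    · simp [hL])
  have hite : Meets (nm _) (.ite (.sub (v .n) (.lit 2)) (mainPart M p q) (.emit (.lit 0))) R Q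
      (κ₄ * lg X + (κ₂ + κ₃) * U) := by
    intro s hs
    have hev : Exp.eval s (.sub (v .n) (.lit 2)) = (N : ℤ) - 2 := by
      simp [Exp.eval, hs.2.1]
    have hBd : Exp.Bd s X (.sub (v .n) (.lit 2)) := by
      simp only [Exp.Bd, hs.2.1]
      exact ⟨⟨by omega, by omega⟩, trivial⟩
    by_cases h3 : 3 ≤ N
    · obtain ⟨s', hd, hq⟩ := h₂ t N Km X L ht hM h3 (by simp [hL]) rfl hLb hX s hs
      simp only [hLa] at hq
      refine ⟨s', h₄ _ _ s s' X _ hBd (fun _ => hd.mono ?_) (fun h => ?_), hq⟩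
      · exact Nat.mul_le_mul_right _ (by omega)
      · rw [hev] at h; omega
    · obtain ⟨s', hd, hq⟩ := h₃ X R Q (by
        rintro s hs
        exact ⟨trivial, Or.inr ⟨by simp [hs.1.out, Exp.eval], not_hasThreeSum (by omega) a⟩⟩) s hs
      refine ⟨s', h₄ _ _ s s' X _ hBd (fun h => ?_) (fun _ => hd.mono ?_), hq⟩
      · rw [hev] at h; omega
      · exact Nat.mul_le_mul (by omega) hlU
  obtain ⟨s', m, hq, hm, hh⟩ := (hread.seq hite).haltsWith rfl
  refine ⟨s'.out, m, hm.trans ?_, hh, ?_⟩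
  · have e1 := Nat.mul_le_mul_left κ₁ hlU
    have e2 := Nat.mul_le_mul_left κ₄ hlU
    have e3 : 1 ≤ U := (lg_pos X).trans hlU
    calc _ ≤ κ₁ * U + (κ₄ * U + (κ₂ + κ₃) * U) + U := by omega
      _ = _ := by ring
  · rcases hq with ⟨h, h'⟩ | ⟨h, h'⟩
    · simp [h, h']
    · simp [h, h']

end ThreeSum

/-! ### Asymptotic estimates -/

namespace ThreeSum

open While

theorem rpow_isBigO_rpow {α β : ℝ} (h : α ≤ β) :
    (fun N : ℕ => (N : ℝ) ^ α) =O[atTop] fun N : ℕ => (N : ℝ) ^ β := by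
  refine IsBigO.of_bound 1 ?_
  filter_upwards [eventually_ge_atTop 1] with N hN
  have hN' : (1 : ℝ) ≤ N := by exact_mod_cast hN
  rw [Real.norm_of_nonneg (by positivity), Real.norm_of_nonneg (by positivity), one_mul]
  exact Real.rpow_le_rpow_of_exponent_le hN' h

theorem const_isBigO_rpow (c : ℝ) {α : ℝ} (h : 0 ≤ α) :
    (fun _ : ℕ => c) =O[atTop] fun N : ℕ => (N : ℝ) ^ α := by
  have h1 : (fun _ : ℕ => c) =O[atTop] fun N : ℕ => (N : ℝ) ^ (0 : ℝ) := by
    simpa using isBigO_const_const c (one_ne_zero : (1 : ℝ) ≠ 0) atTop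
  exact h1.trans (rpow_isBigO_rpow h)

theorem isBigO_mul_rpow {f g : ℕ → ℝ} {α β : ℝ} (hf : f =O[atTop] fun N : ℕ => (N : ℝ) ^ α)
    (hg : g =O[atTop] fun N : ℕ => (N : ℝ) ^ β) :
    (fun N => f N * g N) =O[atTop] fun N : ℕ => (N : ℝ) ^ (α + β) := by
  refine (hf.mul hg).congr' EventuallyEq.rfl ?_
  filter_upwards [eventually_ge_atTop 1] with N hN
  rw [Real.rpow_add (by exact_mod_cast hN)]

theorem isBigO_rpow_rpow {f : ℕ → ℝ} {α s : ℝ} (hs : 0 ≤ s)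
    (hf : f =O[atTop] fun N : ℕ => (N : ℝ) ^ α) :
    (fun N => f N ^ s) =O[atTop] fun N : ℕ => (N : ℝ) ^ (α * s) := by
  refine (hf.rpow hs (Eventually.of_forall fun N => by positivity)).congr' EventuallyEq.rfl ?_
  exact Eventually.of_forall fun N => by simp only; rw [Real.rpow_mul (by positivity)]

theorem lg_le_rpow (X : ℕ) {s : ℝ} (hs : 0 < s) :
    (lg X : ℝ) ≤ (X : ℝ) ^ s * (1 / (s * Real.log 2)) + 1 := by
  have h2 : 0 < Real.log 2 := Real.log_pos (by norm_num)
  have h1 : (Nat.log 2 X : ℝ) ≤ (X : ℝ) ^ s * (1 / (s * Real.log 2)) := by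
    calc (Nat.log 2 X : ℝ) ≤ Real.logb 2 X := Real.natLog_le_logb X 2
      _ = Real.log X / Real.log 2 := rfl
      _ ≤ ((X : ℝ) ^ s / s) / Real.log 2 :=
        div_le_div_of_nonneg_right (Real.log_le_rpow_div (by positivity) hs) h2.le
      _ = _ := by field_simp
  unfold lg
  push_cast
  linarith

theorem lg_isBigO {X : ℕ → ℕ} {α η : ℝ} (hα : 0 < α) (hη : 0 < η)
    (hX : (fun N => (X N : ℝ)) =O[atTop] fun N : ℕ => (N : ℝ) ^ α) :
    (fun N => (lg (X N) : ℝ)) =O[atTop] fun N : ℕ => (N : ℝ) ^ η := by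
  have hs : 0 < η / α := div_pos hη hα
  have h1 := isBigO_rpow_rpow hs.le hX
  rw [mul_div_cancel₀ _ hα.ne'] at h1
  have h2 := isBigO_mul_rpow h1 (const_isBigO_rpow (1 / (η / α * Real.log 2)) le_rfl)
  rw [add_zero] at h2
  refine IsBigO.trans (IsBigO.of_bound 1 ?_) (h2.add (const_isBigO_rpow 1 hη.le))
  refine Eventually.of_forall fun N => ?_
  rw [one_mul, Real.norm_of_nonneg (by positivity)]
  exact (lg_le_rpow (X N) hs).trans (le_abs_self _)

/-- If the rounded logarithm is `c + 1`, then `(2 ^ (q + 1)) ^ c < N`, so `(2 ^ p) ^ c ≤ N ^ (p / (q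
+ 1))`. Rounding up costs only the constant factor `2 ^ p`. -/
theorem pow_clog_isBigO {p q : ℕ} {β : ℝ} (h : (p : ℝ) / (q + 1 : ℕ) ≤ β) :
    (fun N : ℕ => (((2 ^ p) ^ Nat.clog (2 ^ (q + 1)) N : ℕ) : ℝ)) =O[atTop]
      fun N : ℕ => (N : ℝ) ^ β := by
  refine IsBigO.trans (IsBigO.of_bound (2 ^ p) ?_) (rpow_isBigO_rpow h)
  filter_upwards [eventually_ge_atTop 2] with N hN
  rw [Real.norm_of_nonneg (by positivity), Real.norm_of_nonneg (by positivity)]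
  have hb : 1 < 2 ^ (q + 1) := Nat.one_lt_two_pow (by omega)
  have hc := Nat.clog_pos hb hN
  have hlt := Nat.pow_pred_clog_lt_self hb hN
  obtain ⟨c, hc'⟩ : ∃ c, Nat.clog (2 ^ (q + 1)) N = c + 1 := ⟨_, (Nat.sub_add_cancel hc).symm⟩
  rw [hc'] at hlt ⊢
  have e1 : ((2 : ℝ) ^ p) ^ c = ((((2 ^ (q + 1)) ^ c : ℕ) : ℝ)) ^ ((p : ℝ) / (q + 1 : ℕ)) := by
    push_cast
    rw [← pow_mul, ← pow_mul, ← Real.rpow_natCast, ← Real.rpow_natCast, ← Real.rpow_mul (by norm_num)]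
    congr 1
    push_cast
    field_simp
  have e2 : ((((2 ^ (q + 1)) ^ c : ℕ) : ℝ)) ^ ((p : ℝ) / (q + 1 : ℕ)) ≤
      (N : ℝ) ^ ((p : ℝ) / (q + 1 : ℕ)) :=
    Real.rpow_le_rpow (by positivity) (by exact_mod_cast hlt.le) (by positivity)
  push_cast at e1 e2 ⊢
  rw [pow_succ, mul_comm, e1]
  gcongr

/-- The number of bits that suffice for the items. -/
noncomputable def bitLength (r : ℕ → ℝ) (N : ℕ) : ℕ := ⌈(N : ℝ) ^ r N⌉₊ + Nat.log 2 N + 3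

/-- Two bits beyond the range take care of the factor `3` and the summand `1`; the term `Nat.log 2 N
+ 3` does the same for `N` itself. -/
theorem bitLength_spec {r : ℕ → ℝ} {N : ℕ} {a : Fin N → ℤ}
    (ha : ∀ i, |(a i : ℝ)| ≤ (2 : ℝ) ^ ((N : ℝ) ^ r N)) :
    3 * N + 1 ≤ 2 ^ 2 ^ Nat.clog 2 (bitLength r N) ∧
      ∀ i, 3 * |a i| + 1 ≤ 2 ^ 2 ^ Nat.clog 2 (bitLength r N) := by
  have hle := Nat.le_pow_clog (b := 2) (by norm_num) (bitLength r N)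
  have hpow : 2 ^ bitLength r N ≤ 2 ^ 2 ^ Nat.clog 2 (bitLength r N) :=
    Nat.pow_le_pow_right (by norm_num) hle
  set c := ⌈(N : ℝ) ^ r N⌉₊ with hc
  constructor
  · refine le_trans ?_ hpow
    have h1 : N < 2 ^ (Nat.log 2 N + 1) := Nat.lt_pow_succ_log_self (by norm_num) N
    have h2 : 2 ^ (Nat.log 2 N + 3) ≤ 2 ^ bitLength r N :=
      Nat.pow_le_pow_right (by norm_num) (by unfold bitLength; omega)
    refine le_trans ?_ h2
    rw [pow_succ] at h1 ⊢
    rw [pow_succ, pow_succ]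
    omega
  · intro i
    have h1 : |(a i : ℝ)| ≤ (2 : ℝ) ^ c := by
      refine (ha i).trans ?_
      rw [← Real.rpow_natCast]
      exact Real.rpow_le_rpow_of_exponent_le (by norm_num) (Nat.le_ceil _)
    have h2 : |a i| ≤ (2 : ℤ) ^ c := by exact_mod_cast h1
    have h3 : (2 : ℤ) ^ (c + 2) ≤ 2 ^ 2 ^ Nat.clog 2 (bitLength r N) := by
      have hpow' : (2 : ℤ) ^ bitLength r N ≤ 2 ^ 2 ^ Nat.clog 2 (bitLength r N) := by
        exact_mod_cast hpow
      exact (pow_le_pow_right₀ (by norm_num) (by unfold bitLength; omega)).trans hpow'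
    have h4 : (1 : ℤ) ≤ 2 ^ c := one_le_pow₀ (by norm_num)
    rw [pow_succ, pow_succ] at h3
    omega

/-- Rounding the length up to a power of two at most doubles it, and both `δ` and the logarithm of
`N` are absorbed by `η`. -/
theorem bitLength_isBigO {k η : ℝ} (hk : 0 ≤ k) (hη : 0 < η) {δ : ℕ → ℝ}
    (hδ : Tendsto δ atTop (𝓝 0)) :
    (fun N => (2 ^ Nat.clog 2 (bitLength (fun N => k + δ N) N) : ℝ)) =O[atTop]
      fun N : ℕ => (N : ℝ) ^ (k + η) := by
  have h1 : (fun N : ℕ => (N : ℝ) ^ (k + δ N)) =O[atTop] fun N : ℕ => (N : ℝ) ^ (k + η) := by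
    refine IsBigO.of_bound 1 ?_
    filter_upwards [eventually_ge_atTop 1, hδ.eventually_lt_const hη] with N hN hd
    rw [Real.norm_of_nonneg (by positivity), Real.norm_of_nonneg (by positivity), one_mul]
    exact Real.rpow_le_rpow_of_exponent_le (by exact_mod_cast hN) (by linarith)
  have h2 : (fun N : ℕ => (lg N : ℝ)) =O[atTop] fun N : ℕ => (N : ℝ) ^ (k + η) := by
    refine lg_isBigO (α := 1) one_pos (by linarith) ?_
    simpa using isBigO_refl (fun N : ℕ => (N : ℝ)) atTop
  have h3 := const_isBigO_rpow 3 (by linarith : 0 ≤ k + η)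
  refine IsBigO.trans (IsBigO.of_bound 2 ?_) ((h1.add h2).add h3)
  refine Eventually.of_forall fun N => ?_
  rw [Real.norm_of_nonneg (by positivity), Real.norm_of_nonneg (by positivity)]
  have hlt := Nat.pow_pred_clog_lt_self (b := 2) (by norm_num)
    (show 2 ≤ bitLength (fun N => k + δ N) N by unfold bitLength; omega)
  have hpos := Nat.clog_pos (b := 2) (by norm_num)
    (show 2 ≤ bitLength (fun N => k + δ N) N by unfold bitLength; omega)
  obtain ⟨c, hc⟩ : ∃ c, Nat.clog 2 (bitLength (fun N => k + δ N) N) = c + 1 :=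
    ⟨_, (Nat.sub_add_cancel hpos).symm⟩
  rw [hc] at hlt ⊢
  have hcl : (⌈(N : ℝ) ^ (k + δ N)⌉₊ : ℝ) < (N : ℝ) ^ (k + δ N) + 1 :=
    Nat.ceil_lt_add_one (by positivity)
  have hlt' : (2 : ℝ) ^ c ≤ bitLength (fun N => k + δ N) N := by exact_mod_cast hlt.le
  unfold bitLength at hlt'
  push_cast at hlt'
  rw [pow_succ, lg]
  push_cast
  linarith

end ThreeSum

/-! ### From a deterministic machine to a 3SUM algorithm -/

namespace OracleTM

theorem AnswersWithin.mono {M : OracleTM} {x : List Bool} {y : ℕ → Bool} {t t' : ℕ} {b : Bool}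
    (h : M.AnswersWithin x y t b) (ht : t ≤ t') : M.AnswersWithin x y t' b := by
  rw [answersWithin_iff] at h ⊢
  have := M.iterate_fstep_of_verdict y _ h (t' - t)
  rw [fcfgAt, ← Function.iterate_add_apply, Nat.sub_add_cancel ht] at this
  rw [fcfgAt, this]
  exact h

end OracleTM

namespace ThreeSum

open While

/-- The finitely many lengths at which the asymptotic bound may fail are absorbed by adding their
times to the constant. Rounding up the resulting increasing function gives a monotone time bound, as
is needed when the length of a word is only estimated from above. -/
theorem exists_decides {L : Language Bool} {e' e : ℝ} (he : 0 ≤ e) (hee : e' ≤ e)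
    (hL : L ∈ DTIME fun n => (n : ℝ) ^ e') : ∃ (M : OracleTM) (t : ℕ → ℕ) (C : ℝ),
      Monotone t ∧ Decides M t L ∧ 0 ≤ C ∧ ∀ n, (t n : ℝ) ≤ C * ((n : ℝ) + 1) ^ e + 1 := by
  obtain ⟨M, t, ht, hM⟩ := hL
  obtain ⟨c, hc⟩ := ht.bound
  obtain ⟨n₀, hn₀⟩ := eventually_atTop.mp hc
  set C : ℝ := |c| + ∑ i ∈ Finset.range (n₀ + 1), (t i : ℝ) with hC
  have hC0 : 0 ≤ C := add_nonneg (abs_nonneg _) (Finset.sum_nonneg fun i _ => by positivity)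
  have hbound : ∀ n, (t n : ℝ) ≤ C * ((n : ℝ) + 1) ^ e := by
    intro n
    have h1 : (1 : ℝ) ≤ ((n : ℝ) + 1) ^ e := Real.one_le_rpow (by simp) he
    by_cases hn : n < n₀ + 1
    · have h2 : (t n : ℝ) ≤ ∑ i ∈ Finset.range (n₀ + 1), (t i : ℝ) :=
        Finset.single_le_sum (f := fun i => (t i : ℝ)) (fun i _ => by positivity)
          (Finset.mem_range.mpr hn)
      have h3 := abs_nonneg c
      nlinarith
    · have h2 := hn₀ n (by omega)
      have hn1 : (1 : ℝ) ≤ n := by exact_mod_cast (by omega : 1 ≤ n)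
      rw [Real.norm_of_nonneg (by positivity), Real.norm_of_nonneg (by positivity)] at h2
      have h3 : (n : ℝ) ^ e' ≤ ((n : ℝ) + 1) ^ e :=
        (Real.rpow_le_rpow_of_exponent_le hn1 hee).trans
          (Real.rpow_le_rpow (by positivity) (by linarith) he)
      have h4 : 0 ≤ ∑ i ∈ Finset.range (n₀ + 1), (t i : ℝ) :=
        Finset.sum_nonneg fun i _ => by positivity
      calc (t n : ℝ) ≤ c * (n : ℝ) ^ e' := h2
        _ ≤ |c| * (n : ℝ) ^ e' := mul_le_mul_of_nonneg_right (le_abs_self c) (by positivity)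
        _ ≤ C * ((n : ℝ) + 1) ^ e := mul_le_mul (by linarith) h3 (by positivity) hC0
  refine ⟨M, fun n => ⌈C * ((n : ℝ) + 1) ^ e⌉₊, C, ?_, ?_, hC0, fun n => ?_⟩
  · intro m n hmn
    refine Nat.ceil_mono (mul_le_mul_of_nonneg_left (Real.rpow_le_rpow (by positivity) ?_ he) hC0)
    have : (m : ℝ) ≤ n := by exact_mod_cast hmn
    linarith
  · intro x
    have hle : t x.length ≤ ⌈C * ((x.length : ℝ) + 1) ^ e⌉₊ := by
      exact_mod_cast (hbound x.length).trans (Nat.le_ceil _)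
    obtain ⟨h1, h2⟩ := hM x
    obtain ⟨⟨b, hb⟩, -⟩ := h1 fun _ => false
    refine ⟨b, hb.mono hle, ?_⟩
    rw [h2]
    constructor
    · rintro rfl
      exact ⟨_, hb⟩
    · rintro ⟨y, hy⟩
      have hu := (h1 y).2
      rw [OracleTM.cfgAt_used] at hu
      -- No bit is consumed, so an accepting run for any oracle is also the run for the zero oracle.
      have heq := M.fcfgAt_eq_of_used_eq_zero x y (fun _ => false) _ (Nat.le_zero.mp hu)
      rw [OracleTM.answersWithin_iff] at hb hy
      rw [heq, hy] at hb
      exact (Option.some.inj hb).symm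
  · exact (Nat.ceil_lt_add_one (by positivity)).le

/-- The machine guesses `q + 1` bits for every factor `2 ^ p` in the input length. This rate must
not exceed `1 / σ`, and `p / (q + 1)` must be close to `σ` lest the padding dominate; rounding `(q +
1) * σ` up achieves both when `q` is large. -/
theorem exists_ratio {σ η : ℝ} (hσ : 0 < σ) (hη : 0 < η) :
    ∃ p q : ℕ, 1 ≤ p ∧ ((q + 1 : ℕ) : ℝ) * σ ≤ p ∧ (p : ℝ) / (q + 1 : ℕ) ≤ σ + η := by
  obtain ⟨q, hq⟩ := exists_nat_gt (1 / η)
  have hq1 : (0 : ℝ) < ((q + 1 : ℕ) : ℝ) := by positivity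
  refine ⟨⌈((q + 1 : ℕ) : ℝ) * σ⌉₊, q, Nat.ceil_pos.mpr (by positivity), Nat.le_ceil _, ?_⟩
  have h1 : (⌈((q + 1 : ℕ) : ℝ) * σ⌉₊ : ℝ) < ((q + 1 : ℕ) : ℝ) * σ + 1 :=
    Nat.ceil_lt_add_one (by positivity)
  rw [div_le_iff₀ hq1]
  have h2 : 1 < η * ((q + 1 : ℕ) : ℝ) := by
    rw [div_lt_iff₀ hη] at hq
    push_cast
    nlinarith
  nlinarith

/-- The word has length `O(N ^ (1 + k + η))`, which accounts for the first summand of the exponent,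
and the two logarithmic factors contribute `2 * η`. Since `δ` has been absorbed by `η`, the choice
`δ' = 0` works. -/
theorem threeSumInTime_of_decides {k η e : ℝ} (hk : 0 ≤ k) (hη : 0 < η) (he : 1 ≤ e) {p q : ℕ}
    (hp : 1 ≤ p) (hpq : (p : ℝ) / (q + 1 : ℕ) ≤ 1 + k + η) {M : OracleTM} {t : ℕ → ℕ} {C : ℝ}
    (ht : Monotone t) (hM : Decides M t (TripleTM.lang (2 ^ p - 1) q))
    (htC : ∀ n, (t n : ℝ) ≤ C * ((n : ℝ) + 1) ^ e + 1) :
    ThreeSumInTime k ((1 + k + η) * e + 2 * η) := by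
  obtain ⟨P, κ, hP⟩ := program_spec M p q hp
  refine ⟨P, fun δ hδ => ?_⟩
  set Km : ℕ → ℕ := fun N => Nat.clog 2 (bitLength (fun N => k + δ N) N) with hKm
  set S : ℕ → ℕ := fun N => width p q N (2 ^ Km N) with hS
  set τ : ℕ → ℕ := fun N => t (5 * S N) with hτ
  set X : ℕ → ℕ := fun N => 2 ^ (q + 1) * N + 5 * S N + τ N + Nat.card M.State +
    Nat.card M.Symbol with hX
  have hα : 0 < 1 + k + η := by linarith
  have hN : (fun N : ℕ => (N : ℝ)) =O[atTop] fun N : ℕ => (N : ℝ) ^ (1 + k + η) := by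
    have := rpow_isBigO_rpow (show (1 : ℝ) ≤ 1 + k + η by linarith)
    simpa using this
  have hSO : (fun N => (S N : ℝ)) =O[atTop] fun N : ℕ => (N : ℝ) ^ (1 + k + η) := by
    have h1 := pow_clog_isBigO hpq
    have h2 : (fun N : ℕ => (N : ℝ) * (2 : ℝ) ^ Km N) =O[atTop]
        fun N : ℕ => (N : ℝ) ^ (1 + k + η) := by
      have h3 : (fun N : ℕ => (N : ℝ)) =O[atTop] fun N : ℕ => (N : ℝ) ^ (1 : ℝ) := by
        simpa using isBigO_refl (fun N : ℕ => (N : ℝ)) atTop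
      have := isBigO_mul_rpow h3 (bitLength_isBigO hk hη hδ)
      rwa [← add_assoc] at this
    refine ((h1.add h2).add hN).congr_left fun N => ?_
    simp [hS, width]
  have hαe : 1 + k + η ≤ (1 + k + η) * e := le_mul_of_one_le_right hα.le he
  have hτO : (fun N => (τ N : ℝ)) =O[atTop] fun N : ℕ => (N : ℝ) ^ ((1 + k + η) * e) := by
    have h1 : (fun N => 5 * (S N : ℝ) + 1) =O[atTop] fun N : ℕ => (N : ℝ) ^ (1 + k + η) :=
      (hSO.const_mul_left 5).add (const_isBigO_rpow 1 hα.le)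
    have h2 := ((isBigO_rpow_rpow (by linarith : 0 ≤ e) h1).const_mul_left C).add
      (const_isBigO_rpow 1 (by linarith : 0 ≤ (1 + k + η) * e))
    refine IsBigO.trans (IsBigO.of_bound 1 (Eventually.of_forall fun N => ?_)) h2
    rw [one_mul, Real.norm_of_nonneg (by positivity)]
    have := htC (5 * S N)
    push_cast at this
    exact this.trans (le_abs_self _)
  have hSO' := hSO.trans (rpow_isBigO_rpow hαe)
  have hXO : (fun N => (X N : ℝ)) =O[atTop] fun N : ℕ => (N : ℝ) ^ ((1 + k + η) * e) := by
    have h1 := (hN.trans (rpow_isBigO_rpow hαe)).const_mul_left (2 ^ (q + 1))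
    have h2 := hSO'.const_mul_left 5
    have h3 := const_isBigO_rpow (Nat.card M.State) (hα.le.trans hαe)
    have h4 := const_isBigO_rpow (Nat.card M.Symbol) (hα.le.trans hαe)
    refine ((((h1.add h2).add hτO).add h3).add h4).congr_left fun N => ?_
    simp [hX]
  have hlg := lg_isBigO (hα.trans_le hαe) hη hXO
  refine ⟨fun _ => 0, fun N => κ * ((S N + τ N + 3) * lg (X N) ^ 2), tendsto_const_nhds, ?_, ?_⟩
  · have h1 := (hSO'.add hτO).add (const_isBigO_rpow 3 (hα.le.trans hαe))
    have h2 := (isBigO_mul_rpow h1 (isBigO_mul_rpow hlg hlg)).const_mul_left (κ : ℝ)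
    refine (h2.congr_left fun N => ?_).congr_right fun N => ?_
    · push_cast
      ring
    · congr 1
      ring
  · intro N a ha
    obtain ⟨h1, h2⟩ := bitLength_spec (r := fun N => k + δ N) (a := a) ha
    obtain ⟨out, m, hm, hh, ho⟩ := hP t N (Km N) (X N) a ht hM h1 h2 le_rfl
    exact ⟨out, m, hm, hh, ho⟩

end ThreeSum

/-! ### Choice of the parameters -/

theorem mainTheorem2 (k : ℝ) (hk : 0 ≤ k)
    (hard : ∀ ε : ℝ, 0 < ε → ¬ ThreeSumInTime k (2 - ε + k)) :
    ∀ ε' : ℝ, 0 < ε' →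
      ¬ NDTIME (fun n => ⌈1 / (1 + k) * Real.logb 2 n⌉₊) (fun n => (n : ℝ)) ⊆
        DTIME (fun n => (n : ℝ) ^ (1 + 1 / (1 + k) - ε')) := by
  intro ε' hε' hsub
  have hσ : 0 < 1 + k := by linarith
  -- Making `ε'` smaller only weakens the deterministic bound; it ensures `e ≥ 1`, so that the time
  -- of the machine dominates the cost of preparing the word.
  obtain ⟨ε₁, hε₁, hle, hle'⟩ : ∃ ε₁ : ℝ, 0 < ε₁ ∧ ε₁ ≤ ε' ∧ ε₁ * (1 + k) ≤ 1 / 2 := by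
    refine ⟨min ε' (1 / (2 * (1 + k))), lt_min hε' (by positivity), min_le_left _ _, ?_⟩
    calc min ε' (1 / (2 * (1 + k))) * (1 + k) ≤ 1 / (2 * (1 + k)) * (1 + k) :=
          mul_le_mul_of_nonneg_right (min_le_right _ _) hσ.le
      _ = 1 / 2 := by field_simp
  set e := 1 + 1 / (1 + k) - ε₁ with he
  have heσ : (1 + k) * e = (1 + k) + 1 - (1 + k) * ε₁ := by
    rw [he]; field_simp
  have he1 : 1 ≤ e := by
    have : ε₁ ≤ 1 / (1 + k) := by rw [le_div_iff₀ hσ]; linarith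
    rw [he]; linarith
  have he2 : e ≤ 2 := by
    have : 1 / (1 + k) ≤ 1 := by rw [div_le_one hσ]; linarith
    rw [he]; linarith
  -- The gain over the exponent `2 + k` is `(1 + k) * ε₁ = 8 * η`, and since `e ≤ 2` the losses `η *
  -- e + 2 * η` use up at most half of it.
  set η := (1 + k) * ε₁ / 8 with hη
  have hη0 : 0 < η := by positivity
  obtain ⟨p, q, hp, hpq, hpq'⟩ := ThreeSum.exists_ratio hσ hη0
  obtain ⟨M, t, C, ht, hM, -, htC⟩ := ThreeSum.exists_decides (e := e) (by linarith) (by rw [he]; linarith)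
    (hsub (TripleTM.lang_mem p q hp k hk hpq))
  have h3 := ThreeSum.threeSumInTime_of_decides hk hη0 he1 hp hpq' ht hM htC
  refine hard (2 + k - ((1 + k + η) * e + 2 * η)) ?_ ?_
  · have : η * e ≤ η * 2 := mul_le_mul_of_nonneg_left he2 hη0.le
    have h8 : 8 * η = (1 + k) * ε₁ := by rw [hη]; ring
    have : 0 < (1 + k) * ε₁ := by positivity
    nlinarith
  · convert h3 using 1
    ring
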